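/- For a finite simple graph $G=(V,E)$ and an integer $k\ge 0$, the problem 4-Path Vertex Cover asks whether there is a set $S\subseteq V$ with $|S|\le k$ such that $G\setminus S$ contains no path on four vertices as a (not necessarily induced) subgraph; the parameter is $k$. A kernelization is a polynomial-time algorithm that maps every instance $(G,k)$ to an equivalent instance $(G',k')$ (one is a yes-instance if and only if the other is) such that the size of $(G',k')$ plus $k'$ is at most $g(k)$ for some computable function $g$. Theorem. 4-Path Vertex Cover admits a kernel with at most $96k^2+96k$ edges: there is a kernelization for it such that, for every instance $(G,k)$, the graph $G'$ of the returned instance $(G',k')$ has at most $96k^2+96k$ edges, where $k$ is the parameter of the input instance. The only exception are the no-instances with $k=0$, for which $G'$ has at most three edges. Here running time is the number of steps of a random access machine with unit-cost addition and subtraction, as a function of the bit length of the input, which consists of the number of vertices, the parameter $k$ in binary, and the adjacency matrix. -/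

import Mathlib

/-! ### A random access machine with a step count

Programs act on natural-number registers `x₀, x₁, …` and on unbounded arrays `A₀, A₁, …` of natural
numbers; a program mentions only finitely many of them, by fixed indices, while the cells of an
array are addressed by computed values. The only arithmetic operations are addition and truncated
subtraction, and every operation costs one step. Since there is no multiplication, one step
lengthens the longest number in use by at most one bit (up to the constants of the program), so that
polynomial time on this machine is the same as polynomial time on Turing machines. -/

namespace RAM

/-- A memory state: the contents of the registers and of the arrays. -/
structure State where
  reg : ℕ → ℕ
  arr : ℕ → ℕ → ℕ

/-- Arithmetic expressions: constants, registers, array cells `A_a[e]`, sum and truncated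
difference. -/
inductive Expr where
  | lit (c : ℕ)
  | var (x : ℕ)
  | get (a : ℕ) (e : Expr)
  | add (e₁ e₂ : Expr)
  | sub (e₁ e₂ : Expr)

/-- The value of an expression. -/
def Expr.eval (s : State) : Expr → ℕ
  | .lit c => c
  | .var x => s.reg x
  | .get a e => s.arr a (e.eval s)
  | .add e₁ e₂ => e₁.eval s + e₂.eval s
  | .sub e₁ e₂ => e₁.eval s - e₂.eval s

/-- The number of operations performed when an expression is evaluated. -/
def Expr.cost : Expr → ℕ
  | .lit _ => 1
  | .var _ => 1
  | .get _ e => e.cost + 1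
  | .add e₁ e₂ => e₁.cost + e₂.cost + 1
  | .sub e₁ e₂ => e₁.cost + e₂.cost + 1

/-- Programs. A test `e` counts as true when the value of `e` is not zero. -/
inductive Prog where
  | skip
  /-- `x := e` -/
  | assign (x : ℕ) (e : Expr)
  /-- `A_a[i] := e` -/
  | store (a : ℕ) (i e : Expr)
  | seq (p q : Prog)
  /-- if `e` then `p` else `q` -/
  | ite (e : Expr) (p q : Prog)
  /-- while `e` do `p` -/
  | loop (e : Expr) (p : Prog)

/-- Overwrite one register. -/
def State.setReg (s : State) (x v : ℕ) : State :=
  { s with reg := Function.update s.reg x v }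

/-- Overwrite one array cell. -/
def State.setArr (s : State) (a i v : ℕ) : State :=
  { s with arr := Function.update s.arr a (Function.update (s.arr a) i v) }

/-- `Exec p s t s'`: started in the state `s`, the program `p` halts after exactly `t` steps in the
state `s'`. -/
inductive Exec : Prog → State → ℕ → State → Prop where
  | skip (s : State) : Exec .skip s 1 s
  | assign (x : ℕ) (e : Expr) (s : State) :
      Exec (.assign x e) s (e.cost + 1) (s.setReg x (e.eval s))
  | store (a : ℕ) (i e : Expr) (s : State) :
      Exec (.store a i e) s (i.cost + e.cost + 1) (s.setArr a (i.eval s) (e.eval s))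
  | seq {p q : Prog} {s s' s'' : State} {t t' : ℕ} :
      Exec p s t s' → Exec q s' t' s'' → Exec (.seq p q) s (t + t') s''
  | ite_true {e : Expr} {p q : Prog} {s s' : State} {t : ℕ} :
      e.eval s ≠ 0 → Exec p s t s' → Exec (.ite e p q) s (e.cost + 1 + t) s'
  | ite_false {e : Expr} {p q : Prog} {s s' : State} {t : ℕ} :
      e.eval s = 0 → Exec q s t s' → Exec (.ite e p q) s (e.cost + 1 + t) s'
  | loop_true {e : Expr} {p : Prog} {s s' s'' : State} {t t' : ℕ} :
      e.eval s ≠ 0 → Exec p s t s' → Exec (.loop e p) s' t' s'' →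
      Exec (.loop e p) s (e.cost + 1 + t + t') s''
  | loop_false {e : Expr} {p : Prog} {s : State} :
      e.eval s = 0 → Exec (.loop e p) s (e.cost + 1) s

/-- The machine is deterministic: final state and step count are determined by the start. -/
theorem Exec.det {p : Prog} {s s₁ s₂ : State} {t₁ t₂ : ℕ}
    (h₁ : Exec p s t₁ s₁) (h₂ : Exec p s t₂ s₂) : t₁ = t₂ ∧ s₁ = s₂ := by
  induction h₁ generalizing t₂ s₂ with
  | skip s => cases h₂; exact ⟨rfl, rfl⟩
  | assign x e s => cases h₂; exact ⟨rfl, rfl⟩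
  | store a i e s => cases h₂; exact ⟨rfl, rfl⟩
  | seq _ _ ih ih' =>
    cases h₂ with
    | seq k k' =>
      obtain ⟨rfl, rfl⟩ := ih k
      obtain ⟨rfl, rfl⟩ := ih' k'
      exact ⟨rfl, rfl⟩
  | ite_true he _ ih =>
    cases h₂ with
    | ite_true _ k => obtain ⟨rfl, rfl⟩ := ih k; exact ⟨rfl, rfl⟩
    | ite_false hn _ => exact absurd hn he
  | ite_false he _ ih =>
    cases h₂ with
    | ite_true hn _ => exact absurd he hn
    | ite_false _ k => obtain ⟨rfl, rfl⟩ := ih k; exact ⟨rfl, rfl⟩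
  | loop_true he _ _ ih ih' =>
    cases h₂ with
    | loop_true _ k k' =>
      obtain ⟨rfl, rfl⟩ := ih k
      obtain ⟨rfl, rfl⟩ := ih' k'
      exact ⟨rfl, rfl⟩
    | loop_false hn => exact absurd hn he
  | loop_false he =>
    cases h₂ with
    | loop_true hn _ _ => exact absurd he hn
    | loop_false _ => exact ⟨rfl, rfl⟩

/-- The start state on the input `w`: array `0` holds the entries of `w`, register `0` holds the
length of `w`, and everything else is zero. -/
def input (w : List ℕ) : State where
  reg := fun x => if x = 0 then w.length else 0
  arr := fun a i => if a = 0 then w.getD i 0 else 0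

/-- The output in a final state: the first `m` cells of array `0`, where `m` is the content of
register `0`. -/
def output (s : State) : List ℕ :=
  (List.range (s.reg 0)).map (s.arr 0)

/-- The length of a word of natural numbers: the number of its binary digits plus the number of its
entries. -/
def wordLength (w : List ℕ) : ℕ :=
  (w.map fun a => Nat.size a + 1).sum

/-- `f` is computable in polynomial time, with respect to the encoding `enc` of inputs and outputs:
some program computes the code of `f x` from the code of `x`, in a number of steps that is at most a
polynomial in the length of the code of `x`. Writing the output costs one further step for each of
its entries. -/
def PolyTimeComputable {α : Type*} (enc : α → List ℕ) (f : α → α) : Prop :=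
  ∃ (p : Prog) (T : Polynomial ℕ), ∀ x : α, ∃ (t : ℕ) (s : State),
    Exec p (input (enc x)) t s ∧ output s = enc (f x) ∧
      t + (output s).length ≤ T.eval (wordLength (enc x))

end RAM

/-! ### Path vertex cover and kernels -/

namespace PathVertexCover

/-- `S` is a `d`-path vertex cover of `G`: the graph `G \ S` has no path on `d` vertices as a (not
necessarily induced) subgraph. -/
def IsPathVertexCover {V : Type*} (d : ℕ) (G : SimpleGraph V) (S : Finset V) : Prop :=
  (SimpleGraph.pathGraph d).Free (G.induce {v | v ∉ S})

/-- An instance: a finite simple graph, with vertices `0, …, n - 1`, and the parameter `k`. -/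
structure Inst where
  n : ℕ
  graph : SimpleGraph (Fin n)
  k : ℕ

/-- The number of edges of the graph of an instance. -/
noncomputable def Inst.numEdges (I : Inst) : ℕ :=
  I.graph.edgeSet.ncard

/-- The yes-instances of `d`-Path Vertex Cover. -/
def Inst.IsYes (d : ℕ) (I : Inst) : Prop :=
  ∃ S : Finset (Fin I.n), S.card ≤ I.k ∧ IsPathVertexCover d I.graph S

open Classical in
/-- The code of an instance: `n`, then `k`, then the adjacency matrix row by row. -/
noncomputable def Inst.encode (I : Inst) : List ℕ :=
  I.n :: I.k ::
    List.ofFn fun p : Fin (I.n * I.n) => if I.graph.Adj p.divNat p.modNat then 1 else 0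

/-- `f` is a kernelization (algorithm) for the parameterized problem whose yes-instances are given
by `Q`: it runs in polynomial time, it returns an equivalent instance, and the size of the returned
instance together with its parameter is bounded by a computable function of the parameter. -/
structure IsKernelization (Q : Inst → Prop) (f : Inst → Inst) : Prop where
  polyTime : RAM.PolyTimeComputable Inst.encode f
  equivalent : ∀ I, Q (f I) ↔ Q I
  size_le : ∃ g : ℕ → ℕ, Computable g ∧ ∀ I, RAM.wordLength (f I).encode + (f I).k ≤ g I.k

end PathVertexCover

/-! ### Programs with bounded loops -/

namespace RAM

/-! The argument uses the strict budget `K = k + 1`: covers have fewer than `K` vertices. An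
exhausted budget is then `K = 0`, which admits no cover, and truncated subtraction does no harm.

Reduction at a vertex `v` starts from a greedy maximal matching among the edges `ab` of `G - v` with
`a` adjacent to `v`. If it has at least `K` edges and `v` has degree at least `K + 2`, a cover
avoiding `v` would miss both ends of a matching edge and a further neighbour of `v`, and these form
a path with `v`. So `v` is forced and can be removed (`hasCov_isolate`).

Otherwise, by maximality, every unmarked neighbour of `v` has all its other neighbours among the
marked vertices. Each marked vertex offers two slots, and the unmarked neighbours compete for
adjacent slots in an auction with rising levels. The `2n` slots cannot occupy all levels `1, …, 2n +
1`, and the configuration above a missing level is a crown: neighbours `L` of `v` whose other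
neighbours lie in `X`, with two private neighbours in `L` for each vertex of `X`. If two candidates
end without a slot, an exchange argument deletes the edge from `v` to one of them
(`Auction.hasCov_delEdge`, `hasCov_delEdge_of_crown`). If at most one does, the degree of `v` is at
most `6(K - 1) + 2`, and `v` has at most one pendant neighbour, because a pendant neighbour never
gets a slot.

When no vertex can be reduced, edges on no four-vertex path are dropped. Outside a cover `S` the
nontrivial components are stars and triangles. Each remaining edge meets `S` or is charged to a
neighbour of `S`, at most six edges per neighbour, so there are at most `7k(6k + 2) ≤ 64(k² + k)`
edges (`card_core_le`, `ncard_core_le`). A larger count refutes the instance; otherwise the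
non-isolated vertices span the kernel.

The algorithm is written with bounded loops, whose final states are described by `run`, whose time
is bounded by `exec_compile`, and which are verified by `run_forr`. Every successful reduction
destroys an adjacent pair, so quadratically many rounds suffice. -/

@[simp] theorem State.setReg_reg (s : State) (x v y : ℕ) :
    (s.setReg x v).reg y = if y = x then v else s.reg y := Function.update_apply ..

@[simp] theorem State.setReg_arr (s : State) (x v : ℕ) : (s.setReg x v).arr = s.arr := rfl

@[simp] theorem State.setArr_reg (s : State) (a i v : ℕ) : (s.setArr a i v).reg = s.reg := rfl

@[simp] theorem State.setArr_arr (s : State) (a i v b : ℕ) :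
    (s.setArr a i v).arr b = if b = a then Function.update (s.arr a) i v else s.arr b :=
  Function.update_apply ..

attribute [simp] Expr.eval

/-! ### Boolean tests by truncated subtraction -/

namespace Expr

/-- Negation of a test. -/
def not (e : Expr) : Expr := .sub (.lit 1) e

/-- Conjunction of tests. -/
def and (e f : Expr) : Expr := .sub (.lit 1) (.add (.sub (.lit 1) e) (.sub (.lit 1) f))

/-- The test `e = f`. -/
def eq (e f : Expr) : Expr := .sub (.lit 1) (.add (.sub e f) (.sub f e))

/-- The test `e < f`. -/
def lt (e f : Expr) : Expr := .sub f e

/-- A test succeeds in a state. -/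
def Holds (e : Expr) (s : State) : Prop := e.eval s ≠ 0

@[simp] theorem holds_not (e : Expr) (s : State) : (not e).Holds s ↔ ¬ e.Holds s := by
  simp only [Holds, not, eval]; omega

@[simp] theorem holds_and (e f : Expr) (s : State) :
    (and e f).Holds s ↔ e.Holds s ∧ f.Holds s := by
  simp only [Holds, and, eval]; omega

@[simp] theorem holds_or (e f : Expr) (s : State) :
    (add e f).Holds s ↔ e.Holds s ∨ f.Holds s := by
  simp only [Holds, eval]; omega

@[simp] theorem holds_eq (e f : Expr) (s : State) : (eq e f).Holds s ↔ e.eval s = f.eval s := by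
  simp only [Holds, eq, eval]; omega

@[simp] theorem holds_lt (e f : Expr) (s : State) : (lt e f).Holds s ↔ e.eval s < f.eval s := by
  simp only [Holds, lt, eval]; omega

@[simp] theorem holds_var (x : ℕ) (s : State) : (var x).Holds s ↔ s.reg x ≠ 0 := Iff.rfl

@[simp] theorem holds_get (a : ℕ) (e : Expr) (s : State) :
    (get a e).Holds s ↔ s.arr a (e.eval s) ≠ 0 := Iff.rfl

end Expr

/-! ### A language of bounded loops, its semantics and its running time -/

/-- Programs whose loops run over `0, …, m - 1`, where `m` is the content of a register. -/
inductive FP where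
  | skip
  | asg (x : ℕ) (e : Expr)
  | sto (a : ℕ) (i e : Expr)
  | seq (p q : FP)
  | ite (e : Expr) (p q : FP)
  /-- for `x` from `0` to the content of register `r` minus one do `p` -/
  | forr (x r : ℕ) (p : FP)

/-- `iterate f m s` applies `f 0`, …, `f (m - 1)` to `s`. -/
def iterate (f : ℕ → State → State) : ℕ → State → State
  | 0, s => s
  | m + 1, s => f m (iterate f m s)

namespace FP

/-- Execution of a list of programs. -/
def block : List FP → FP
  | [] => skip
  | p :: l => seq p (block l)

/-- `if e then p`. -/
def when (e : Expr) (p : FP) : FP := ite e p skip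

open Classical in
/-- The final state. -/
noncomputable def run : FP → State → State
  | skip, s => s
  | asg x e, s => s.setReg x (e.eval s)
  | sto a i e, s => s.setArr a (i.eval s) (e.eval s)
  | seq p q, s => q.run (p.run s)
  | ite e p q, s => if e.Holds s then p.run s else q.run s
  | forr x r p, s => (iterate (fun i t => p.run (t.setReg x i)) (s.reg r) s).setReg x (s.reg r)

/-- The registers that may be written. -/
def wr : FP → List ℕ
  | skip => []
  | asg x _ => [x]
  | sto _ _ _ => []
  | seq p q => p.wr ++ q.wr
  | ite _ p q => p.wr ++ q.wr
  | forr x _ p => x :: p.wr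

/-- The arrays that may be written. -/
def wrA : FP → List ℕ
  | skip => []
  | asg _ _ => []
  | sto a _ _ => [a]
  | seq p q => p.wrA ++ q.wrA
  | ite _ p q => p.wrA ++ q.wrA
  | forr _ _ p => p.wrA

/-- The registers that bound loops. -/
def bounds : FP → List ℕ
  | skip => []
  | asg _ _ => []
  | sto _ _ _ => []
  | seq p q => p.bounds ++ q.bounds
  | ite _ p q => p.bounds ++ q.bounds
  | forr _ r p => r :: p.bounds

/-- Loop counters and loop bounds are not written by the bodies of loops. -/
def wf : FP → Bool
  | skip => true
  | asg _ _ => true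
  | sto _ _ _ => true
  | seq p q => p.wf && q.wf
  | ite _ p q => p.wf && q.wf
  | forr x r p => p.wf && x != r && !p.wr.contains x && !p.wr.contains r

/-- Translation into machine programs. -/
def compile : FP → Prog
  | skip => .skip
  | asg x e => .assign x e
  | sto a i e => .store a i e
  | seq p q => .seq p.compile q.compile
  | ite e p q => .ite e p.compile q.compile
  | forr x r p => .seq (.assign x (.lit 0))
      (.loop (.sub (.var r) (.var x)) (.seq p.compile (.assign x (.add (.var x) (.lit 1)))))

/-- A bound for the number of steps in terms of a bound for the loop bounds. -/
noncomputable def time : FP → Polynomial ℕ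
  | skip => 1
  | asg _ e => .C (e.cost + 1)
  | sto _ i e => .C (i.cost + e.cost + 1)
  | seq p q => p.time + q.time
  | ite e p q => .C (e.cost + 1) + p.time + q.time
  | forr _ _ p => 6 + .X * (p.time + 8)

theorem run_reg (p : FP) (s : State) (x : ℕ) (hx : x ∉ p.wr) : (p.run s).reg x = s.reg x := by
  induction p generalizing s with
  | skip => rfl
  | asg y e => simp_all [wr, run]
  | sto => rfl
  | seq p q ihp ihq => simp_all [wr, run]
  | ite e p q ihp ihq => simp only [wr, List.mem_append, not_or] at hx; simp only [run]; split <;> simp_all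
  | forr y r p ih =>
    simp only [wr, List.mem_cons, not_or] at hx
    simp only [run, State.setReg_reg, if_neg hx.1]
    generalize s.reg r = m
    induction m with
    | zero => rfl
    | succ m ihm => simp only [iterate]; rw [ih _ hx.2]; simp [hx.1, ihm]

theorem run_arr (p : FP) (s : State) (a : ℕ) (ha : a ∉ p.wrA) : (p.run s).arr a = s.arr a := by
  induction p generalizing s with
  | skip => rfl
  | asg y e => rfl
  | sto => simp_all [wrA, run]
  | seq p q ihp ihq => simp_all [wrA, run]
  | ite e p q ihp ihq => simp only [wrA, List.mem_append, not_or] at ha; simp only [run]; split <;> simp_all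
  | forr y r p ih =>
    simp only [wrA] at ha
    simp only [run, State.setReg_arr]
    generalize s.reg r = m
    induction m with
    | zero => rfl
    | succ m ihm => simp only [iterate]; rw [ih _ ha]; simp [ihm]

/-- Since no loop bound is written anywhere in `p`, its value at the start limits every execution of
the loop, also of nested loops, and one number `b` serves for the polynomial. -/
theorem exec_compile (p : FP) (s : State) (b : ℕ) (hwf : p.wf = true)
    (hb : ∀ r ∈ p.bounds, s.reg r ≤ b ∧ r ∉ p.wr) :
    ∃ t ≤ p.time.eval b, Exec p.compile s t (p.run s) := by
  induction p generalizing s with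
  | skip => exact ⟨1, by simp [time], .skip s⟩
  | asg x e => exact ⟨_, by simp [time], .assign x e s⟩
  | sto a i e => exact ⟨_, by simp [time], .store a i e s⟩
  | seq p q ihp ihq =>
    simp only [wf, Bool.and_eq_true, bounds, wr, List.mem_append, not_or] at hwf hb
    obtain ⟨t, ht, h⟩ := ihp s hwf.1 fun r hr => ⟨(hb r (.inl hr)).1, (hb r (.inl hr)).2.1⟩
    obtain ⟨t', ht', h'⟩ := ihq (p.run s) hwf.2 fun r hr =>
      ⟨by rw [run_reg _ _ _ (hb r (.inr hr)).2.1]; exact (hb r (.inr hr)).1, (hb r (.inr hr)).2.2⟩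
    exact ⟨t + t', by simp only [time, Polynomial.eval_add]; omega, .seq h h'⟩
  | ite e p q ihp ihq =>
    simp only [wf, Bool.and_eq_true, bounds, wr, List.mem_append, not_or] at hwf hb
    by_cases he : e.Holds s
    · obtain ⟨t, ht, h⟩ := ihp s hwf.1 fun r hr => ⟨(hb r (.inl hr)).1, (hb r (.inl hr)).2.1⟩
      refine ⟨_, ?_, by simpa [run, he, compile] using Exec.ite_true (q := q.compile) he h⟩
      simp only [time, Polynomial.eval_add, Polynomial.eval_C]; omega
    · obtain ⟨t, ht, h⟩ := ihq s hwf.2 fun r hr => ⟨(hb r (.inr hr)).1, (hb r (.inr hr)).2.2⟩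
      refine ⟨_, ?_, by simpa [run, he, compile] using Exec.ite_false (p := p.compile) (not_not.1 he) h⟩
      simp only [time, Polynomial.eval_add, Polynomial.eval_C]; omega
  | forr x r p ih =>
    simp only [wf, Bool.and_eq_true, bounds, wr, List.mem_cons, not_or, bne_iff_ne, ne_eq,
      Bool.not_eq_true', List.contains_eq_mem, decide_eq_false_iff_not] at hwf hb
    obtain ⟨⟨⟨hp, hxr⟩, hx⟩, hr⟩ := hwf
    -- `F i` is the state after `i` iterations, up to the value of the counter.
    set F : ℕ → State := fun i => iterate (fun i t => p.run (t.setReg x i)) i s with hF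
    have hreg : ∀ y, y ≠ x → y ∉ p.wr → ∀ i, (F i).reg y = s.reg y := by
      intro y hy hy' i
      induction i with
      | zero => rfl
      | succ i ihi =>
        change (p.run ((F i).setReg x i)).reg y = _
        rw [run_reg _ _ _ hy']; simp [hy, ihi]
    -- Induction on the number `d` of remaining iterations. An iteration costs 4 for the test, 4 for
    -- the increment and the body; the last, failing test costs 4.
    have key : ∀ d i, i + d = s.reg r → ∃ t ≤ d * (p.time.eval b + 8) + 4,
        Exec (.loop (.sub (.var r) (.var x)) (.seq p.compile (.assign x (.add (.var x) (.lit 1)))))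
          ((F i).setReg x i) t ((F (s.reg r)).setReg x (s.reg r)) := by
      intro d
      induction d with
      | zero =>
        rintro i hi
        obtain rfl : i = s.reg r := by omega
        refine ⟨4, by simp, .loop_false ?_⟩
        simp [Ne.symm hxr, hreg r (Ne.symm hxr) hr]
      | succ d ihd =>
        intro i hi
        obtain ⟨t, ht, h⟩ := ih ((F i).setReg x i) hp fun y hy => by
          have hyx := (hb y (.inr hy)).2
          exact ⟨by simpa [hyx.1, hreg y hyx.1 hyx.2] using (hb y (.inr hy)).1, hyx.2⟩
        obtain ⟨t', ht', h'⟩ := ihd (i + 1) (by omega)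
        have hstep : Exec (.assign x (.add (.var x) (.lit 1))) (p.run ((F i).setReg x i)) 4
            ((F (i + 1)).setReg x (i + 1)) := by
          change Exec _ _ 4 ((p.run ((F i).setReg x i)).setReg x (i + 1))
          have := Exec.assign x (.add (.var x) (.lit 1)) (p.run ((F i).setReg x i))
          have e : (p.run ((F i).setReg x i)).reg x = i := by rw [run_reg _ _ _ hx]; simp
          simpa [Expr.cost, e] using this
        refine ⟨_, ?_, .loop_true ?_ (.seq h hstep) h'⟩
        · simp only [Expr.cost]; nlinarith
        · simp only [Expr.eval, State.setReg_reg, if_neg (Ne.symm hxr), hreg r (Ne.symm hxr) hr,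
            if_true]
          omega
    obtain ⟨t, ht, h⟩ := key (s.reg r) 0 (by omega)
    refine ⟨2 + t, ?_, .seq (by simpa [F, iterate, Expr.cost] using Exec.assign x (.lit 0) s) h⟩
    have hm : s.reg r ≤ b := (hb r (.inl rfl)).1
    have := Nat.mul_le_mul_right (p.time.eval b + 8) hm
    simp only [time, Polynomial.eval_add, Polynomial.eval_mul, Polynomial.eval_X,
      Polynomial.eval_ofNat]
    omega

/-! ### Frames and loop invariants -/

/-- Only the registers in `W` and the arrays in `A` may differ. -/
structure Frame (W A : List ℕ) (s t : State) : Prop where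
  reg : ∀ x, x ∉ W → t.reg x = s.reg x
  arr : ∀ a, a ∉ A → t.arr a = s.arr a

theorem frame (p : FP) (s : State) : Frame p.wr p.wrA s (p.run s) :=
  ⟨fun x => p.run_reg s x, fun a => p.run_arr s a⟩

/-- Loop invariants. The invariant must not depend on the loop counter. -/
theorem run_forr {x r : ℕ} {p : FP} {s : State} (I : ℕ → State → Prop)
    (hI : ∀ i t v, I i t → I i (t.setReg x v))
    (h0 : I 0 s)
    (hstep : ∀ i t, i < s.reg r → Frame (x :: p.wr) p.wrA s t → t.reg x = i →
      I i t → I (i + 1) (p.run t)) :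
    I (s.reg r) ((forr x r p).run s) := by
  have key : ∀ m ≤ s.reg r, let t := iterate (fun i t => p.run (t.setReg x i)) m s
      I m t ∧ Frame (x :: p.wr) p.wrA s t := by
    intro m
    induction m with
    | zero => exact fun _ => ⟨h0, ⟨fun _ _ => rfl, fun _ _ => rfl⟩⟩
    | succ m ih =>
      intro hm
      obtain ⟨h1, h2⟩ := ih (by omega)
      have hF : Frame (x :: p.wr) p.wrA s
          ((iterate (fun i t => p.run (t.setReg x i)) m s).setReg x m) :=
        ⟨fun y hy => by simp only [List.mem_cons, not_or] at hy; simp [hy.1, h2.reg y (by simp [hy])],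
          fun a ha => h2.arr a ha⟩
      refine ⟨hstep m _ hm hF (by simp) (hI _ _ _ h1), ?_, ?_⟩
      · intro y hy
        simp only [iterate]
        rw [run_reg _ _ _ fun h => hy (.tail _ h)]
        exact hF.reg y hy
      · intro a ha
        simp only [iterate]
        rw [run_arr _ _ _ ha]
        exact hF.arr a ha
  exact hI _ _ _ (key _ le_rfl).1

end FP

end RAM

/-! ### Paths on four vertices, and reductions that preserve covers -/

namespace FourPath

variable {V : Type*}

/-- `a, b, c, d` is a path of `G`. -/
def P4 (G : SimpleGraph V) (a b c d : V) : Prop :=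
  G.Adj a b ∧ G.Adj b c ∧ G.Adj c d ∧ a ≠ c ∧ a ≠ d ∧ b ≠ d

/-- `S` meets every path on four vertices. -/
def Cov (G : SimpleGraph V) (S : Finset V) : Prop :=
  ∀ a b c d, P4 G a b c d → a ∈ S ∨ b ∈ S ∨ c ∈ S ∨ d ∈ S

/-- Some set of fewer than `K` vertices meets every path on four vertices. -/
def HasCov (G : SimpleGraph V) (K : ℕ) : Prop :=
  ∃ S : Finset V, S.card < K ∧ Cov G S

/-- The edge `ab` lies on a path on four vertices. -/
def InP4 (G : SimpleGraph V) (a b : V) : Prop :=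
  ∃ c d, P4 G a b c d ∨ P4 G b a c d ∨ P4 G c a b d

/-- `p` is a vertex of degree one, adjacent to `v`. -/
def Pendant (G : SimpleGraph V) (v p : V) : Prop :=
  G.Adj v p ∧ ∀ x, G.Adj p x → x = v

theorem P4.symm {G : SimpleGraph V} {a b c d : V} (h : P4 G a b c d) : P4 G d c b a :=
  ⟨h.2.2.1.symm, h.2.1.symm, h.1.symm, h.2.2.2.2.2.symm, h.2.2.2.2.1.symm, h.2.2.2.1.symm⟩

theorem P4.mono {G H : SimpleGraph V} (hGH : G ≤ H) {a b c d : V} (h : P4 G a b c d) :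
    P4 H a b c d :=
  ⟨hGH h.1, hGH h.2.1, hGH h.2.2.1, h.2.2.2⟩

theorem InP4.adj {G : SimpleGraph V} {a b : V} (h : InP4 G a b) : G.Adj a b := by
  obtain ⟨c, d, h | h | h⟩ := h
  · exact h.1
  · exact h.1.symm
  · exact h.2.1

theorem InP4.symm {G : SimpleGraph V} {a b : V} (h : InP4 G a b) : InP4 G b a := by
  obtain ⟨c, d, h | h | h⟩ := h
  · exact ⟨c, d, .inr (.inl h)⟩
  · exact ⟨c, d, .inl h⟩
  · exact ⟨d, c, .inr (.inr h.symm)⟩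

/-- The subgraph of the edges that lie on paths on four vertices. -/
def core (G : SimpleGraph V) : SimpleGraph V where
  Adj := InP4 G
  symm := ⟨fun _ _ h => h.symm⟩
  loopless := ⟨fun _ h => h.adj.ne rfl⟩

/-- Remove all edges at `v`. -/
def isolate (G : SimpleGraph V) (v : V) : SimpleGraph V where
  Adj a b := G.Adj a b ∧ a ≠ v ∧ b ≠ v
  symm := ⟨fun _ _ h => ⟨h.1.symm, h.2.2, h.2.1⟩⟩
  loopless := ⟨fun _ h => h.1.ne rfl⟩

/-- Remove the edge `vw`. -/
def delEdge (G : SimpleGraph V) (v w : V) : SimpleGraph V where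
  Adj a b := G.Adj a b ∧ ¬ (a = v ∧ b = w) ∧ ¬ (a = w ∧ b = v)
  symm := ⟨fun _ _ h => ⟨h.1.symm, fun e => h.2.2 ⟨e.2, e.1⟩, fun e => h.2.1 ⟨e.2, e.1⟩⟩⟩
  loopless := ⟨fun _ h => h.1.ne rfl⟩

theorem isolate_le (G : SimpleGraph V) (v : V) : isolate G v ≤ G := fun _ _ h => h.1

theorem delEdge_le (G : SimpleGraph V) (v w : V) : delEdge G v w ≤ G := fun _ _ h => h.1

/-- All three edges of a four-vertex path lie on that path, so `G` and its core have the same such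
paths. -/
theorem hasCov_core (G : SimpleGraph V) (K : ℕ) : HasCov (core G) K ↔ HasCov G K := by
  have : ∀ a b c d, P4 (core G) a b c d ↔ P4 G a b c d := fun a b c d =>
    ⟨P4.mono fun _ _ h => InP4.adj h, fun h =>
      ⟨⟨c, d, .inl h⟩, ⟨a, d, .inr (.inr h)⟩, ⟨b, a, .inr (.inl h.symm)⟩, h.2.2.2⟩⟩
  simp only [HasCov, Cov, this]

variable [DecidableEq V]

/-- A vertex that belongs to every small cover can be removed. -/
theorem hasCov_isolate {G : SimpleGraph V} {v : V} {K : ℕ}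
    (hpair : ∀ S : Finset V, S.card < K →
      ∃ a b, a ∉ S ∧ b ∉ S ∧ G.Adj v a ∧ G.Adj a b ∧ b ≠ v)
    (hdeg : ∀ S : Finset V, S.card < K + 2 → ∃ z, G.Adj v z ∧ z ∉ S) :
    HasCov G K ↔ HasCov (isolate G v) (K - 1) := by
  constructor
  · rintro ⟨S, hS, hc⟩
    have hv : v ∈ S := by
      by_contra hv
      obtain ⟨a, b, ha, hb, hva, hab, hbv⟩ := hpair S hS
      -- The set has at most `K + 1` elements, so some neighbour `z` of `v` avoids it, and `z v a b`
      -- is a path missed by `S`.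
      obtain ⟨z, hz, hzS⟩ := hdeg (insert a (insert b S)) (by
        have := Finset.card_insert_le a (insert b S)
        have := Finset.card_insert_le b S
        omega)
      simp only [Finset.mem_insert, not_or] at hzS
      rcases hc z v a b ⟨hz.symm, hva, hab, hzS.1, hzS.2.1, hbv.symm⟩ with h | h | h | h
      · exact hzS.2.2 h
      · exact hv h
      · exact ha h
      · exact hb h
    refine ⟨S.erase v, ?_, fun a b c d h => ?_⟩
    · have := Finset.card_pos.2 ⟨v, hv⟩
      rw [Finset.card_erase_of_mem hv]; omega
    · have := hc a b c d (h.mono (isolate_le G v))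
      simp only [Finset.mem_erase]
      have h1 := h.1.2.1
      have h2 := h.2.1.2.1
      have h3 := h.2.2.1.2
      tauto
  · rintro ⟨S, hS, hc⟩
    refine ⟨insert v S, by have := Finset.card_insert_le v S; omega, fun a b c d h => ?_⟩
    simp only [Finset.mem_insert]
    by_contra hcon
    push Not at hcon
    obtain ⟨⟨h1, h1'⟩, ⟨h2, h2'⟩, ⟨h3, h3'⟩, ⟨h4, h4'⟩⟩ := hcon
    rcases hc a b c d ⟨⟨h.1, h1, h2⟩, ⟨h.2.1, h2, h3⟩, ⟨h.2.2.1, h3, h4⟩, h.2.2.2⟩ with h | h | h | h <;>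
      contradiction

/-- The crown rule: `L` consists of neighbours of `v` whose other neighbours are in `X`, and every
vertex of `X` has two private neighbours in `L`. If moreover `L` contains two vertices, one of which,
`l₀`, is nobody's private neighbour, then the edge `v l₀` is redundant. -/
theorem hasCov_delEdge_of_crown {G : SimpleGraph V} {v l₀ w : V} {K : ℕ} (L X : Set V)
    (hL : ∀ l ∈ L, G.Adj v l) (hN : ∀ l ∈ L, ∀ x, G.Adj l x → x = v ∨ x ∈ X)
    (hd : ∀ x ∈ X, x ∉ L) (hvX : v ∉ X) (p q : V → V)
    (hp : ∀ x ∈ X, p x ∈ L ∧ G.Adj x (p x) ∧ p x ≠ l₀)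
    (hq : ∀ x ∈ X, q x ∈ L ∧ G.Adj x (q x) ∧ q x ≠ l₀)
    (hpp : ∀ x ∈ X, ∀ y ∈ X, p x = p y → x = y)
    (hqq : ∀ x ∈ X, ∀ y ∈ X, q x = q y → x = y)
    (hpq : ∀ x ∈ X, ∀ y ∈ X, p x ≠ q y)
    (hfin : X.Finite) (hl₀ : l₀ ∈ L) (hw : w ∈ L) (hwl : w ≠ l₀) :
    HasCov G K ↔ HasCov (delEdge G v l₀) K := by
  classical
  constructor
  · rintro ⟨S, hS, hc⟩
    exact ⟨S, hS, fun a b c d h => hc a b c d (h.mono (delEdge_le G v l₀))⟩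
  rintro ⟨S, hS, hc⟩
  have hvL : v ∉ L := fun h => (hL v h).ne rfl
  -- paths avoiding `L` survive
  have hmain : ∀ a b c d, P4 G a b c d → a ∉ L → b ∉ L → c ∉ L → d ∉ L →
      a ∈ S ∨ b ∈ S ∨ c ∈ S ∨ d ∈ S := fun a b c d h ha hb hc' hd' =>
    hc a b c d ⟨⟨h.1, fun e => hb (e.2 ▸ hl₀), fun e => ha (e.1 ▸ hl₀)⟩,
      ⟨h.2.1, fun e => hc' (e.2 ▸ hl₀), fun e => hb (e.1 ▸ hl₀)⟩,
      ⟨h.2.2.1, fun e => hd' (e.2 ▸ hl₀), fun e => hc' (e.1 ▸ hl₀)⟩, h.2.2.2⟩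
  by_cases hvS : v ∈ S
  · refine ⟨S, hS, fun a b c d h => ?_⟩
    by_contra hcon
    push Not at hcon
    obtain ⟨h1, h2, h3, h4⟩ := hcon
    have e1 : a ≠ v := fun e => h1 (e ▸ hvS)
    have e2 : b ≠ v := fun e => h2 (e ▸ hvS)
    have e3 : c ≠ v := fun e => h3 (e ▸ hvS)
    have e4 : d ≠ v := fun e => h4 (e ▸ hvS)
    rcases hc a b c d ⟨⟨h.1, fun e => e1 e.1, fun e => e2 e.2⟩,
      ⟨h.2.1, fun e => e2 e.1, fun e => e3 e.2⟩,
      ⟨h.2.2.1, fun e => e3 e.1, fun e => e4 e.2⟩, h.2.2.2⟩ with h | h | h | h <;> contradiction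
  -- every vertex of `X` outside `S` has a private neighbour in `S`
  have hpriv : ∀ x ∈ X, x ∉ S → p x ∈ S ∨ q x ∈ S := by
    intro x hx hxS
    have hp1 := (hp x hx).2.1
    have hq1 := (hq x hx).2.1
    have hxv : x ≠ v := fun e => hvX (e ▸ hx)
    have hpv : p x ≠ v := fun e => hvL (e ▸ (hp x hx).1)
    have hqv : q x ≠ v := fun e => hvL (e ▸ (hq x hx).1)
    have hxl : x ≠ l₀ := fun e => hd x hx (e ▸ hl₀)
    -- The path `p x, x, q x, v` does not use the deleted edge, since `q x ≠ l₀`.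
    rcases hc (p x) x (q x) v ⟨⟨hp1.symm, fun e => hpv e.1, fun e => hxv e.2⟩,
      ⟨hq1, fun e => hxv e.1, fun e => hqv e.2⟩,
      ⟨(hL _ (hq x hx).1).symm, fun e => hqv e.1, fun e => (hq x hx).2.2 e.1⟩,
      hpq x hx x hx, hpv, hxv⟩ with h | h | h | h
    · exact .inl h
    · exact absurd h hxS
    · exact .inr h
    · exact absurd h hvS
  set X' := hfin.toFinset with hX'
  have mX : ∀ x, x ∈ X' ↔ x ∈ X := fun x => hfin.mem_toFinset
  set SL := S.filter (· ∈ L) with hSL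
  set SN := S.filter (· ∉ L) with hSN
  have hcard : SL.card + SN.card = S.card := Finset.card_filter_add_card_filter_not _
  -- `X` is disjoint from `L`, so `X ∩ S` is already in `SN`. Only `X \ S` has to be paid for by the
  -- discarded part `SL`.
  have hsub : SN ∪ X' = SN ∪ (X' \ S) := by
    ext x
    simp only [Finset.mem_union, Finset.mem_sdiff, hSN, Finset.mem_filter, mX]
    have := hd x
    tauto
  by_cases hall : ∀ l ∈ L, l ≠ l₀ → l ∈ S
  · -- then `v` can be added
    refine ⟨insert v (SN ∪ X'), ?_, fun a b c d h => ?_⟩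
    · have h1 : (X' \ S).card + 1 ≤ SL.card := by
        have himg : (X' \ S).image p ⊆ SL := by
          intro y hy
          simp only [Finset.mem_image, Finset.mem_sdiff, mX] at hy
          obtain ⟨x, ⟨hx, -⟩, rfl⟩ := hy
          exact Finset.mem_filter.2 ⟨hall _ (hp x hx).1 (hp x hx).2.2, (hp x hx).1⟩
        have hci : ((X' \ S).image p).card = (X' \ S).card :=
          Finset.card_image_of_injOn fun x hx y hy => by
            simp only [Finset.coe_sdiff, Set.mem_sdiff, Finset.mem_coe, mX] at hx hy
            exact hpp x hx.1 y hy.1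
        -- One element of `SL` beyond the first private neighbours pays for `v`: a second private
        -- neighbour, or `w` when `X \ S` is empty.
        have hex : ∃ y ∈ SL, y ∉ (X' \ S).image p := by
          rcases (X' \ S).eq_empty_or_nonempty with he | ⟨x, hx⟩
          · exact ⟨w, Finset.mem_filter.2 ⟨hall w hw hwl, hw⟩, by simp [he]⟩
          · simp only [Finset.mem_sdiff, mX] at hx
            refine ⟨q x, Finset.mem_filter.2 ⟨hall _ (hq x hx.1).1 (hq x hx.1).2.2,
              (hq x hx.1).1⟩, ?_⟩
            simp only [Finset.mem_image, Finset.mem_sdiff, mX, not_exists, not_and]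
            exact fun y hy => hpq y hy.1 x hx.1
        obtain ⟨y, hy, hy'⟩ := hex
        rw [← hci]
        exact Finset.card_lt_card ⟨himg, fun h => hy' (h hy)⟩
      have h2 := Finset.card_insert_le v (SN ∪ X')
      have h3 := Finset.card_union_le SN (X' \ S)
      rw [hsub] at h2 ⊢
      omega
    · by_contra hcon
      simp only [Finset.mem_insert, Finset.mem_union, mX, not_or] at hcon
      obtain ⟨⟨a1, a1', a2⟩, ⟨b1, hb, b2⟩, ⟨c1, hcc, c2⟩, ⟨d1, hdd, d2⟩⟩ := hcon
      -- Once `v` and `X` are in the cover, vertices of `L` have no neighbours left.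
      have ha : a ∉ L := fun h' => (hN a h' b h.1).elim b1 b2
      have hb' : b ∉ L := fun h' => (hN b h' c h.2.1).elim c1 c2
      have hc' : c ∉ L := fun h' => (hN c h' d h.2.2.1).elim d1 d2
      have hd' : d ∉ L := fun h' => (hN d h' c h.2.2.1.symm).elim c1 c2
      rcases hmain a b c d h ha hb' hc' hd' with h | h | h | h
      exacts [a1' (Finset.mem_filter.2 ⟨h, ha⟩), hb (Finset.mem_filter.2 ⟨h, hb'⟩),
        hcc (Finset.mem_filter.2 ⟨h, hc'⟩), hdd (Finset.mem_filter.2 ⟨h, hd'⟩)]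
  · push Not at hall
    obtain ⟨u, huL, hul, huS⟩ := hall
    -- Exchange `S ∩ L` for `X`, each vertex of `X \ S` being paid for by a private neighbour in
    -- `S`.
    refine ⟨SN ∪ X', ?_, fun a b c d h => ?_⟩
    · have h1 : (X' \ S).card ≤ SL.card := by
        refine Finset.card_le_card_of_injOn (fun x => if p x ∈ S then p x else q x) ?_ ?_
        · intro x hx
          simp only [Finset.coe_sdiff, Set.mem_sdiff, Finset.mem_coe, mX] at hx
          simp only [hSL, Finset.coe_filter, Set.mem_ofPred_eq]
          split_ifs with h
          · exact ⟨h, (hp x hx.1).1⟩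
          · exact ⟨(hpriv x hx.1 hx.2).resolve_left h, (hq x hx.1).1⟩
        · intro x hx y hy hxy
          simp only [Finset.coe_sdiff, Set.mem_sdiff, Finset.mem_coe, mX] at hx hy
          simp only at hxy
          split_ifs at hxy
          · exact hpp x hx.1 y hy.1 hxy
          · exact absurd hxy (hpq x hx.1 y hy.1)
          · exact absurd hxy.symm (hpq y hy.1 x hx.1)
          · exact hqq x hx.1 y hy.1 hxy
      have h3 := Finset.card_union_le SN (X' \ S)
      rw [hsub]
      omega
    · by_contra hcon
      simp only [Finset.mem_union, mX, not_or] at hcon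
      obtain ⟨⟨ha, a2⟩, ⟨hb, b2⟩, ⟨hcc, c2⟩, ⟨hdd, d2⟩⟩ := hcon
      have hs : ∀ x, x ∉ SN → x ∉ L → x ∉ S := fun x h1 h2 h3 => h1 (Finset.mem_filter.2 ⟨h3, h2⟩)
      -- A path that starts in `L` continues to `v`. Replacing its first vertex by `u` gives a path
      -- without the edge `v l₀` that still avoids `S`.
      have hend : ∀ a b c d, P4 G a b c d → a ∈ L → b ∉ X → c ∉ L → d ∉ L → c ∉ S → d ∉ S →
          False := by
        intro a b c d h haL hbX hcL hdL hcS hdS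
        obtain rfl : b = v := (hN a haL b h.1).resolve_right hbX
        have hlc : c ≠ l₀ := fun e => hcL (e ▸ hl₀)
        have hld : d ≠ l₀ := fun e => hdL (e ▸ hl₀)
        rcases hc u b c d ⟨⟨(hL u huL).symm, fun e => hvL (e.1 ▸ huL), fun e => hul e.1⟩,
          ⟨h.2.1, fun e => hlc e.2, fun e => h.2.1.ne e.2.symm⟩,
          ⟨h.2.2.1, fun e => h.2.1.ne e.1.symm, fun e => hlc e.1⟩,
          fun e => hcL (e ▸ huL), fun e => hdL (e ▸ huL), h.2.2.2.2.2⟩ with h | h | h | h <;>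
        contradiction
      -- Outside `X`, a vertex of `L` has `v` as its only neighbour, so it cannot be an inner vertex
      -- of the path.
      have hbL : b ∉ L := fun h' => h.2.2.2.1
        (((hN b h' a h.1.symm).resolve_right a2).trans ((hN b h' c h.2.1).resolve_right c2).symm)
      have hcL : c ∉ L := fun h' => h.2.2.2.2.2
        (((hN c h' b h.2.1.symm).resolve_right b2).trans ((hN c h' d h.2.2.1).resolve_right d2).symm)
      by_cases haL : a ∈ L
      · by_cases hdL : d ∈ L
        · exact h.2.1.ne (((hN a haL b h.1).resolve_right b2).trans
            ((hN d hdL c h.2.2.1.symm).resolve_right c2).symm)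
        · exact hend a b c d h haL b2 hcL hdL (hs c hcc hcL) (hs d hdd hdL)
      · by_cases hdL : d ∈ L
        · exact hend d c b a h.symm hdL c2 hbL haL (hs b hb hbL) (hs a ha haL)
        · rcases hmain a b c d h haL hbL hcL hdL with h | h | h | h
          · exact hs a ha haL h
          · exact hs b hb hbL h
          · exact hs c hcc hcL h
          · exact hs d hdd hdL h

/-! ### Counting the edges of an irreducible graph -/

/-- If a small set meets all paths on four vertices, degrees are small, and no vertex has two
pendant neighbours, then few edges lie on paths on four vertices. -/
theorem card_core_le {G : SimpleGraph V} {S : Finset V} (hS : Cov G S) (nb : V → Finset V)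
    (hnb : ∀ v w, w ∈ nb v ↔ G.Adj v w) (D : ℕ) (hD : ∀ v ∈ S, (nb v).card ≤ D)
    (hpend : ∀ v p q, Pendant G v p → Pendant G v q → p = q)
    (E : Finset (Sym2 V)) (hE : ∀ a b, s(a, b) ∈ E → InP4 G a b) :
    E.card ≤ 7 * (S.card * D) := by
  classical
  set T := S.biUnion nb with hT
  have mT : ∀ x, x ∈ T ↔ ∃ v ∈ S, G.Adj v x := by simp [hT, hnb]
  have hTc : T.card ≤ S.card * D := Finset.card_biUnion_le_card_mul _ _ _ hD
  -- Adjacency in `G - S`, which has no path on four vertices.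
  set RA : V → V → Prop := fun x y => G.Adj x y ∧ x ∉ S ∧ y ∉ S with hRA
  have rsymm : ∀ {x y}, RA x y → RA y x := fun h => ⟨h.1.symm, h.2.2, h.2.1⟩
  have hR : ∀ p q r s, RA p q → RA q r → RA r s → p ≠ r → p ≠ s → q ≠ s → False := by
    intro p q r s h1 h2 h3 h4 h5 h6
    rcases hS p q r s ⟨h1.1, h2.1, h3.1, h4, h5, h6⟩ with h | h | h | h
    exacts [h1.2.1 h, h2.2.1 h, h3.2.1 h, h3.2.2 h]
  -- `fg x` lists the neighbours of `x` in `G - S` when there are at most two; otherwise its value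
  -- is irrelevant.
  have hlow : ∀ x, ∃ fg : V × V, (∃ p q, ∀ z, RA x z → z = p ∨ z = q) →
      ∀ z, RA x z → z = fg.1 ∨ z = fg.2 := by
    intro x
    by_cases h : ∃ p q, ∀ z, RA x z → z = p ∨ z = q
    · obtain ⟨p, q, h⟩ := h
      exact ⟨(p, q), fun _ => h⟩
    · exact ⟨(x, x), fun h' => absurd h' h⟩
  choose fg hfg using hlow
  have hpd : ∀ v, ∃ h : V, ∀ p, Pendant G v p → p = h := by
    intro v
    by_cases h : ∃ p, Pendant G v p
    · obtain ⟨p, hp⟩ := h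
      exact ⟨p, fun q hq => hpend v q p hq hp⟩
    · exact ⟨v, fun p hp => absurd ⟨p, hp⟩ h⟩
  choose pd hpd using hpd
  set A := S.biUnion fun v => (nb v).image fun w => s(v, w) with hA
  have hAc : A.card ≤ S.card * D := Finset.card_biUnion_le_card_mul _ _ _ fun v hv =>
    Finset.card_image_le.trans (hD v hv)
  -- The six edges charged to `t ∈ T`, where `f` and `g` are the entries of `fg t`: `tf`, `tg`, the
  -- pendant edges at `t`, `f` and `g`, and the edge `fg` closing a triangle.
  set F : Finset (Sym2 V) :=
    T.image (fun t => s(t, (fg t).1)) ∪ T.image (fun t => s(t, (fg t).2)) ∪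
    T.image (fun t => s(t, pd t)) ∪ T.image (fun t => s((fg t).1, pd (fg t).1)) ∪
    T.image (fun t => s((fg t).2, pd (fg t).2)) ∪ T.image (fun t => s((fg t).1, (fg t).2)) with hF
  have hFc : F.card ≤ 6 * T.card := by
    refine (Finset.card_union_le _ _).trans ?_
    refine (Nat.add_le_add_right (Finset.card_union_le _ _) _).trans ?_
    refine (Nat.add_le_add_right (Nat.add_le_add_right (Finset.card_union_le _ _) _) _).trans ?_
    refine (Nat.add_le_add_right (Nat.add_le_add_right (Nat.add_le_add_right
      (Finset.card_union_le _ _) _) _) _).trans ?_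
    refine (Nat.add_le_add_right (Nat.add_le_add_right (Nat.add_le_add_right (Nat.add_le_add_right
      (Finset.card_union_le _ _) _) _) _) _).trans ?_
    have := fun f : V → Sym2 V => Finset.card_image_le (s := T) (f := f)
    linarith [this (fun t => s(t, (fg t).1)), this (fun t => s(t, (fg t).2)),
      this (fun t => s(t, pd t)), this (fun t => s((fg t).1, pd (fg t).1)),
      this (fun t => s((fg t).2, pd (fg t).2)), this (fun t => s((fg t).1, (fg t).2))]
  have mF : ∀ e, e ∈ F ↔ ∃ t ∈ T, e = s(t, (fg t).1) ∨ e = s(t, (fg t).2) ∨ e = s(t, pd t) ∨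
      e = s((fg t).1, pd (fg t).1) ∨ e = s((fg t).2, pd (fg t).2) ∨
      e = s((fg t).1, (fg t).2) := by
    intro e
    simp only [hF, Finset.mem_union, Finset.mem_image]
    constructor
    · rintro (((((⟨t, h, rfl⟩ | ⟨t, h, rfl⟩) | ⟨t, h, rfl⟩) | ⟨t, h, rfl⟩) | ⟨t, h, rfl⟩) |
        ⟨t, h, rfl⟩) <;> exact ⟨t, h, by tauto⟩
    · rintro ⟨t, h, e⟩
      rcases e with rfl | rfl | rfl | rfl | rfl | rfl
      · exact .inl (.inl (.inl (.inl (.inl ⟨t, h, rfl⟩))))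
      · exact .inl (.inl (.inl (.inl (.inr ⟨t, h, rfl⟩))))
      · exact .inl (.inl (.inl (.inr ⟨t, h, rfl⟩)))
      · exact .inl (.inl (.inr ⟨t, h, rfl⟩))
      · exact .inl (.inr ⟨t, h, rfl⟩)
      · exact .inr ⟨t, h, rfl⟩
  -- an edge with a low endpoint in `T`
  have hTlow : ∀ a b, RA a b → a ∈ T → (∃ p q, ∀ z, RA a z → z = p ∨ z = q) → s(a, b) ∈ F := by
    intro a b hab haT hl
    rw [mF]
    rcases hfg a hl b hab with h | h
    · exact ⟨a, haT, .inl (by rw [← h])⟩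
    · exact ⟨a, haT, .inr (.inl (by rw [← h]))⟩
  have hnT : ∀ a z, a ∉ T → a ∉ S → G.Adj a z → RA a z := fun a z ha ha' hz =>
    ⟨hz, ha', fun h => ha ((mT a).2 ⟨z, h, hz.symm⟩)⟩
  have hleaf : ∀ a b, RA a b → InP4 G a b → (∀ z, RA a z → z = b) → s(a, b) ∈ F := by
    intro a b hab hP hz
    by_cases haT : a ∈ T
    · exact hTlow a b hab haT ⟨b, b, fun z h => .inl (hz z h)⟩
    have hpa : Pendant G b a := ⟨hab.1.symm, fun x hx => hz x (hnT a x haT hab.2.1 hx)⟩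
    have hpa' := hpd b a hpa
    by_cases hbT : b ∈ T
    · exact (mF _).2 ⟨b, hbT, .inr (.inr (.inl (by rw [← hpa']; exact Sym2.eq_swap)))⟩
    -- Now `a` is pendant at `b` in `G` and neither is in `T`. The path must be `a b c d`; it leaves
    -- `G - S` only after `c`, so `c ∈ T`. Moreover `c` is another leaf of the star at `b`, and `ab`
    -- is charged to `c` as the pendant edge at its neighbour `b`.
    obtain ⟨c, d, h | h | h⟩ := hP
    · have hbc := hnT b c hbT hab.2.2 h.2.1
      have hcT : c ∈ T := by
        by_contra hcT
        exact hR a b c d hab hbc (hnT c d hcT hbc.2.2 h.2.2.1) h.2.2.2.1 h.2.2.2.2.1 h.2.2.2.2.2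
      have hcl : ∀ z, RA c z → z = b ∨ z = b := by
        intro z hcz
        left
        by_contra hzb
        refine hR a b c z hab hbc hcz h.2.2.2.1 ?_ (Ne.symm hzb)
        rintro rfl
        exact h.2.1.ne (hz c (rsymm hcz)).symm
      rcases hfg c ⟨b, b, hcl⟩ b (rsymm hbc) with e | e
      · exact (mF _).2 ⟨c, hcT, .inr (.inr (.inr (.inl (by
          rw [← e, ← hpa']; exact Sym2.eq_swap))))⟩
      · exact (mF _).2 ⟨c, hcT, .inr (.inr (.inr (.inr (.inl (by
          rw [← e, ← hpa']; exact Sym2.eq_swap)))))⟩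
    · exact absurd (hpa.2 c h.2.1).symm h.2.2.2.1
    · exact absurd (hpa.2 c h.1.symm) h.2.2.2.1
  have hsub : E ⊆ A ∪ F := by
    intro e he
    induction e using Sym2.ind with
    | _ a b =>
    have hP := hE a b he
    rw [Finset.mem_union]
    by_cases haS : a ∈ S
    · exact .inl (Finset.mem_biUnion.2 ⟨a, haS, Finset.mem_image.2 ⟨b, (hnb a b).2 hP.adj, rfl⟩⟩)
    by_cases hbS : b ∈ S
    · exact .inl (Finset.mem_biUnion.2 ⟨b, hbS, Finset.mem_image.2
        ⟨a, (hnb b a).2 hP.adj.symm, Sym2.eq_swap⟩⟩)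
    right
    have hab : RA a b := ⟨hP.adj, haS, hbS⟩
    by_cases h1 : ∀ z, RA a z → z = b
    · exact hleaf a b hab hP h1
    by_cases h2 : ∀ z, RA b z → z = a
    · rw [Sym2.eq_swap]; exact hleaf b a (rsymm hab) hP.symm h2
    push Not at h1 h2
    obtain ⟨c, hac, hcb⟩ := h1
    obtain ⟨c', hbc, hca⟩ := h2
    -- Neither end is a leaf of `G - S`. Different further neighbours would give a path `c a b c'`,
    -- so the edge lies in a triangle, and by `la`, `lb`, `lc` this is a whole component of `G - S`.
    obtain rfl : c = c' := by
      by_contra hne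
      exact hR c a b c' (rsymm hac) hab hbc hcb hne hca.symm
    have la : ∀ z, RA a z → z = b ∨ z = c := fun z hz => by
      by_contra hcon
      push Not at hcon
      exact hR z a b c (rsymm hz) hab hbc hcon.1 hcon.2 hac.1.ne
    have lb : ∀ z, RA b z → z = a ∨ z = c := fun z hz => by
      by_contra hcon
      push Not at hcon
      exact hR z b a c (rsymm hz) (rsymm hab) hac hcon.1 hcon.2 hbc.1.ne
    have lc : ∀ z, RA c z → z = a ∨ z = b := fun z hz => by
      by_contra hcon
      push Not at hcon
      exact hR z c a b (rsymm hz) (rsymm hac) hab hcon.1 hcon.2 hcb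
    by_cases haT : a ∈ T
    · exact hTlow a b hab haT ⟨_, _, la⟩
    by_cases hbT : b ∈ T
    · rw [Sym2.eq_swap]; exact hTlow b a (rsymm hab) hbT ⟨_, _, lb⟩
    by_cases hcT : c ∈ T
    · refine (mF _).2 ⟨c, hcT, .inr (.inr (.inr (.inr (.inr ?_))))⟩
      rcases hfg c ⟨_, _, lc⟩ a (rsymm hac) with e | e <;>
        rcases hfg c ⟨_, _, lc⟩ b (rsymm hbc) with e' | e'
      · exact absurd (e.trans e'.symm) hab.1.ne
      · rw [← e, ← e']
      · rw [← e, ← e']; exact Sym2.eq_swap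
      · exact absurd (e.trans e'.symm) hab.1.ne
    -- A triangle without vertices in `T` is a component of `G`, too small for a path on four
    -- vertices.
    · have na : ∀ z, G.Adj a z → z = b ∨ z = c := fun z hz => la z (hnT a z haT haS hz)
      have nb' : ∀ z, G.Adj b z → z = a ∨ z = c := fun z hz => lb z (hnT b z hbT hbS hz)
      have nc : ∀ z, G.Adj c z → z = a ∨ z = b := fun z hz => lc z (hnT c z hcT hac.2.2 hz)
      exfalso
      obtain ⟨x, y, h | h | h⟩ := hP
      · obtain rfl := (nb' x h.2.1).resolve_left h.2.2.2.1.symm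
        rcases nc y h.2.2.1 with e | e
        exacts [h.2.2.2.2.1 e.symm, h.2.2.2.2.2 e.symm]
      · obtain rfl := (na x h.2.1).resolve_left h.2.2.2.1.symm
        rcases nc y h.2.2.1 with e | e
        exacts [h.2.2.2.2.2 e.symm, h.2.2.2.2.1 e.symm]
      · obtain rfl := (na x h.1.symm).resolve_left h.2.2.2.1
        exact h.2.2.2.2.1 ((nb' y h.2.2.1).resolve_left h.2.2.2.2.2.symm).symm
  have := (Finset.card_le_card hsub).trans (Finset.card_union_le _ _)
  omega

end FourPath

namespace FourPath

open PathVertexCover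

/-! ### Assignments by increasing levels -/

/-- A partial assignment of the elements `l` with `L l` to slots `s < m` along `E`, together with
levels: `own s = l + 1` says that `s` is occupied by `l`. -/
structure Auction (L : ℕ → Prop) (E : ℕ → ℕ → Prop) (m B : ℕ) (own lev : ℕ → ℕ) : Prop where
  mem : ∀ s < m, ∀ l, own s = l + 1 → L l ∧ E l s ∧ ∀ s' < m, E l s' → lev s ≤ lev s' + 1
  inj : ∀ s < m, ∀ s' < m, own s = own s' → own s ≠ 0 → s = s'
  occ : ∀ s < m, lev s ≠ 0 → own s ≠ 0
  le : ∀ s < m, lev s ≤ B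

/-- `l` holds a slot, or all its slots have reached the maximal level. -/
def Idle (L : ℕ → Prop) (E : ℕ → ℕ → Prop) (m B : ℕ) (own lev : ℕ → ℕ) (l : ℕ) : Prop :=
  L l → (∃ s < m, own s = l + 1) ∨ ∀ s < m, E l s → B ≤ lev s

theorem Auction.init {L : ℕ → Prop} {E : ℕ → ℕ → Prop} {m B : ℕ} {own lev : ℕ → ℕ}
    (ho : ∀ s < m, own s = 0) (hl : ∀ s < m, lev s = 0) : Auction L E m B own lev where
  mem s hs l h := by simp [ho s hs] at h
  inj s hs s' _ _ h := absurd (ho s hs) h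
  occ s hs h := absurd (hl s hs) h
  le s hs := by simp [hl s hs]

/-- Bidding for a slot of minimal level leaves the new holder at most one level above its
alternatives. All other levels stay, and raising one cannot hurt other holders; a displaced owner
just loses its slot. The sum of the levels is the potential that bounds the number of bids. -/
theorem Auction.bid {L : ℕ → Prop} {E : ℕ → ℕ → Prop} {m B : ℕ} {own lev : ℕ → ℕ}
    (h : Auction L E m B own lev) {l s : ℕ} (hl : L l) (hfree : ∀ s < m, own s ≠ l + 1)
    (hs : s < m) (hE : E l s) (hB : lev s < B) (hmin : ∀ s' < m, E l s' → lev s ≤ lev s') :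
    Auction L E m B (Function.update own s (l + 1)) (Function.update lev s (lev s + 1)) ∧
      ∑ i ∈ Finset.range m, Function.update lev s (lev s + 1) i =
        ∑ i ∈ Finset.range m, lev i + 1 := by
  have hle : ∀ s', lev s' ≤ Function.update lev s (lev s + 1) s' := fun s' => by
    rw [Function.update_apply]; split_ifs with e
    · subst e; omega
    · exact le_rfl
  refine ⟨⟨?_, ?_, ?_, ?_⟩, ?_⟩
  · intro t ht l' h'
    rw [Function.update_apply] at h'
    split_ifs at h' with e
    · obtain rfl : l = l' := by omega
      subst e
      refine ⟨hl, hE, fun s' hs' hE' => ?_⟩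
      have := hmin s' hs' hE'
      have := hle s'
      simp only [Function.update_self]
      omega
    · obtain ⟨h1, h2, h3⟩ := h.mem t ht l' h'
      refine ⟨h1, h2, fun s' hs' hE' => ?_⟩
      have := h3 s' hs' hE'
      have := hle s'
      rw [Function.update_of_ne e]
      omega
  · intro t ht t' ht' h1 h2
    rw [Function.update_apply] at h1 h2
    rw [Function.update_apply] at h1
    split_ifs at h1 h2 with e e'
    · rw [e, e']
    · exact absurd h1.symm (hfree t' ht')
    · exact absurd h1 (hfree t ht)
    · exact h.inj t ht t' ht' h1 h2
  · intro t ht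
    rw [Function.update_apply, Function.update_apply]
    split_ifs
    · simp
    · exact h.occ t ht
  · intro t ht
    rw [Function.update_apply]
    split_ifs
    · omega
    · exact h.le t ht
  · rw [Finset.sum_update_of_mem (Finset.mem_range.2 hs),
      ← Finset.add_sum_erase _ lev (Finset.mem_range.2 hs), Finset.sdiff_singleton_eq_erase]
    ring

/-- The vertex of a slot: every vertex has two slots. -/
def slotVertex (n s : ℕ) : ℕ := if s < n then s else s - n

/-- When the bidding has ended and two neighbours of `v` have no slot, an edge is redundant. -/
theorem Auction.hasCov_delEdge {G : SimpleGraph ℕ} {n v l₀ w K : ℕ} {Y : ℕ → Prop}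
    {own lev : ℕ → ℕ} (hG : ∀ a b, G.Adj a b → a < n)
    (hY : ∀ l, G.Adj v l → ¬ Y l → ∀ x, G.Adj l x → x ≠ v → Y x)
    (h : Auction (fun l => G.Adj v l ∧ ¬ Y l)
      (fun l s => Y (slotVertex n s) ∧ G.Adj l (slotVertex n s)) (n + n) (n + n + 1) own lev)
    (hidle : ∀ l, Idle (fun l => G.Adj v l ∧ ¬ Y l)
      (fun l s => Y (slotVertex n s) ∧ G.Adj l (slotVertex n s)) (n + n) (n + n + 1) own lev l)
    (hl₀ : G.Adj v l₀ ∧ ¬ Y l₀) (hl₀' : ∀ s < n + n, own s ≠ l₀ + 1)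
    (hw : G.Adj v w ∧ ¬ Y w) (hw' : ∀ s < n + n, own s ≠ w + 1) (hne : w ≠ l₀) :
    HasCov G K ↔ HasCov (delEdge G v l₀) K := by
  set L0 : ℕ → Prop := fun l => G.Adj v l ∧ ¬ Y l with hL0
  set E : ℕ → ℕ → Prop := fun l s => Y (slotVertex n s) ∧ G.Adj l (slotVertex n s) with hE
  -- a level that does not occur
  obtain ⟨j, hj1, hj2, hj⟩ : ∃ j, 1 ≤ j ∧ j ≤ n + n + 1 ∧ ∀ s < n + n, lev s ≠ j := by
    by_contra hcon
    push Not at hcon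
    have hsub : Finset.Icc 1 (n + n + 1) ⊆ (Finset.range (n + n)).image lev := by
      intro j hj
      rw [Finset.mem_Icc] at hj
      obtain ⟨s, hs, e⟩ := hcon j hj.1 hj.2
      exact Finset.mem_image.2 ⟨s, Finset.mem_range.2 hs, e⟩
    have h1 := Finset.card_le_card hsub
    have h2 := Finset.card_image_le (s := Finset.range (n + n)) (f := lev)
    simp at h1 h2
    omega
  -- The crown lies above the gap `j`: candidates all of whose slots have levels beyond `j`.
  set L : Set ℕ := {l | L0 l ∧ ∀ s < n + n, E l s → j < lev s} with hL
  have hun : ∀ l, L0 l → (∀ s < n + n, own s ≠ l + 1) → l ∈ L := by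
    intro l hl hl'
    refine ⟨hl, fun s hs hs' => ?_⟩
    rcases hidle l hl with ⟨s, hs, e⟩ | h'
    · exact absurd e (hl' s hs)
    · have := h' s hs hs'
      have := hj s hs
      omega
  -- The owner of a slot above `j` has all its slots at level at least `j`. Level `j` is not taken,
  -- so they are all above `j` and the owner is in `L`.
  have hown : ∀ s < n + n, j < lev s → own s - 1 ∈ L ∧ own s = own s - 1 + 1 := by
    intro s hs hlt
    have h0 : own s ≠ 0 := h.occ s hs (by omega)
    have e : own s = own s - 1 + 1 := by omega
    obtain ⟨h1, -, h3⟩ := h.mem s hs _ e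
    refine ⟨⟨h1, fun s' hs' hE' => ?_⟩, e⟩
    have := h3 s' hs' hE'
    have := hj s' hs'
    omega
  set X : Set ℕ := {x | x ≠ v ∧ ∃ l ∈ L, G.Adj l x} with hX
  have hXn : ∀ x ∈ X, x < n := fun x ⟨_, l, _, hlx⟩ => hG x l hlx.symm
  have hXY : ∀ x ∈ X, Y x := fun x ⟨hxv, l, hl, hlx⟩ => hY l hl.1.1 hl.1.2 x hlx hxv
  have sv1 : ∀ x < n, slotVertex n x = x := fun x hx => if_pos hx
  have sv2 : ∀ x < n, slotVertex n (n + x) = x := fun x hx => by simp [slotVertex]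
  have hslot : ∀ x ∈ X, ∀ s < n + n, slotVertex n s = x → j < lev s := by
    rintro x ⟨hxv, l, hl, hlx⟩ s hs e
    exact hl.2 s hs ⟨e ▸ hY l hl.1.1 hl.1.2 x hlx hxv, by rw [e]; exact hlx⟩
  -- Both slots of `x ∈ X` are above the gap, so their owners are the two private neighbours of `x`.
  -- They differ from `l₀`, which owns nothing.
  have hprop : ∀ x ∈ X, ∀ s < n + n, slotVertex n s = x →
      own s - 1 ∈ L ∧ G.Adj x (own s - 1) ∧ own s - 1 ≠ l₀ := by
    intro x hx s hs e
    obtain ⟨h1, h2⟩ := hown s hs (hslot x hx s hs e)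
    have h3 := (h.mem s hs _ h2).2.1.2
    rw [e] at h3
    exact ⟨h1, h3.symm, fun e' => hl₀' s hs (by rw [h2, e'])⟩
  have hinj : ∀ s < n + n, ∀ s' < n + n, slotVertex n s ∈ X → slotVertex n s' ∈ X →
      own s - 1 = own s' - 1 → s = s' := by
    intro s hs s' hs' hx hx' e
    have h1 := (hown s hs (hslot _ hx s hs rfl)).2
    have h2 := (hown s' hs' (hslot _ hx' s' hs' rfl)).2
    exact h.inj s hs s' hs' (by omega) (by omega)
  refine hasCov_delEdge_of_crown (w := w) L X (fun l hl => hl.1.1) ?_ ?_ (fun h => h.1 rfl)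
    (fun x => own x - 1) (fun x => own (n + x) - 1) ?_ ?_ ?_ ?_ ?_ ?_ (hun l₀ hl₀ hl₀')
    (hun w hw hw') hne
  · intro l hl x hx
    by_cases e : x = v
    · exact .inl e
    · exact .inr ⟨e, l, hl, hx⟩
  · exact fun x hx hxL => hxL.1.2 (hXY x hx)
  · intro x hx
    have := hXn x hx
    exact hprop x hx x (by omega) (sv1 x this)
  · intro x hx
    have := hXn x hx
    exact hprop x hx (n + x) (by omega) (sv2 x this)
  · intro x hx y hy e
    have h1 := hXn x hx
    have h2 := hXn y hy
    exact hinj x (by omega) y (by omega) (by rwa [sv1 x h1]) (by rwa [sv1 y h2]) e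
  · intro x hx y hy e
    have h1 := hXn x hx
    have h2 := hXn y hy
    have := hinj (n + x) (by omega) (n + y) (by omega) (by rwa [sv2 x h1]) (by rwa [sv2 y h2]) e
    omega
  · intro x hx y hy e
    have h1 := hXn x hx
    have h2 := hXn y hy
    have := hinj x (by omega) (n + y) (by omega) (by rwa [sv1 x h1]) (by rwa [sv2 y h2]) e
    omega
  · exact (Set.finite_lt_nat n).subset fun x hx => hXn x hx

/-- The number of neighbours of `v`, in terms of the numbers of marked vertices and of neighbours
without a slot. -/
theorem Auction.card_le {G : SimpleGraph ℕ} {n v : ℕ} {Y : ℕ → Prop} {own lev : ℕ → ℕ}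
    (h : Auction (fun l => G.Adj v l ∧ ¬ Y l)
      (fun l s => Y (slotVertex n s) ∧ G.Adj l (slotVertex n s)) (n + n) (n + n + 1) own lev)
    (N YS U : Finset ℕ) (hN : ∀ l ∈ N, l < n ∧ G.Adj v l) (hYS : ∀ i < n, Y i → i ∈ YS)
    (hU : ∀ l < n, (G.Adj v l ∧ ¬ Y l) → (∀ s < n + n, own s ≠ l + 1) → l ∈ U) :
    N.card ≤ 3 * YS.card + U.card := by
  -- A neighbour of `v` is marked, owns the first or the second slot of a marked vertex, or owns
  -- nothing.
  have hsub : N ⊆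
      YS ∪ YS.image (fun s => own s - 1) ∪ YS.image (fun s => own (n + s) - 1) ∪ U := by
    intro l hl
    obtain ⟨hl, hvl⟩ := hN l hl
    simp only [Finset.mem_union, Finset.mem_image]
    by_cases hYl : Y l
    · exact .inl (.inl (.inl (hYS l hl hYl)))
    by_cases hf : ∀ s < n + n, own s ≠ l + 1
    · exact .inr (hU l hl ⟨hvl, hYl⟩ hf)
    push Not at hf
    obtain ⟨s, hs, e⟩ := hf
    have hE := (h.mem s hs l e).2.1.1
    left
    by_cases hsn : s < n
    · rw [slotVertex, if_pos hsn] at hE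
      exact .inl (.inr ⟨s, hYS s hsn hE, by omega⟩)
    · rw [slotVertex, if_neg hsn] at hE
      refine .inr ⟨s - n, hYS _ (by omega) hE, ?_⟩
      rw [show n + (s - n) = s by omega]; omega
  have h0 := Finset.card_le_card hsub
  have h1 := Finset.card_union_le (YS ∪ YS.image (fun s => own s - 1) ∪
    YS.image (fun s => own (n + s) - 1)) U
  have h2 := Finset.card_union_le (YS ∪ YS.image (fun s => own s - 1))
    (YS.image (fun s => own (n + s) - 1))
  have h3 := Finset.card_union_le YS (YS.image (fun s => own s - 1))
  have h4 := Finset.card_image_le (s := YS) (f := fun s => own s - 1)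
  have h5 := Finset.card_image_le (s := YS) (f := fun s => own (n + s) - 1)
  omega

/-! ### Instances and graphs on the natural numbers -/

/-- A copy of the path graph in `G \ S` amounts to four distinct, consecutively adjacent vertices
outside `S`. -/
theorem isPathVertexCover_iff {V : Type*} (G : SimpleGraph V) (S : Finset V) :
    IsPathVertexCover 4 G S ↔ Cov G S := by
  rw [IsPathVertexCover, SimpleGraph.Free, ← not_iff_not, not_not]
  constructor
  · rintro ⟨f⟩
    have hadj : ∀ i j : Fin 4, i.val + 1 = j.val → G.Adj (f i).1 (f j).1 := fun i j h => by
      have : (SimpleGraph.pathGraph 4).Adj i j := SimpleGraph.pathGraph_adj.2 (.inl h)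
      exact f.toHom.map_adj this
    have hne : ∀ i j : Fin 4, i ≠ j → (f i).1 ≠ (f j).1 := fun i j h e =>
      h (f.injective (Subtype.ext e))
    intro hc
    rcases hc (f 0).1 (f 1).1 (f 2).1 (f 3).1 ⟨hadj 0 1 rfl, hadj 1 2 rfl, hadj 2 3 rfl,
      hne 0 2 (by decide), hne 0 3 (by decide), hne 1 3 (by decide)⟩ with h | h | h | h
    exacts [(f 0).2 h, (f 1).2 h, (f 2).2 h, (f 3).2 h]
  · intro hc
    unfold Cov at hc
    push Not at hc
    obtain ⟨a, b, c, d, h, ha, hb, hcc, hd⟩ := hc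
    have hmem : ∀ i : Fin 4, (![a, b, c, d] i) ∉ S := by
      intro i; fin_cases i <;> assumption
    refine ⟨⟨⟨fun i => ⟨![a, b, c, d] i, hmem i⟩, ?_⟩, ?_⟩⟩
    · intro i j hij
      rw [SimpleGraph.pathGraph_adj] at hij
      have h1 := h.1
      have h2 := h.2.1
      have h3 := h.2.2.1
      have h1' := h1.symm
      have h2' := h2.symm
      have h3' := h3.symm
      fin_cases i <;> fin_cases j <;> simp at hij <;> simpa
    · intro i j hij
      have e : ![a, b, c, d] i = ![a, b, c, d] j := congrArg Subtype.val hij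
      obtain ⟨h1, h2, h3, h4, h5, h6⟩ := h
      have h1 := h1.ne
      have h2 := h2.ne
      have h3 := h3.ne
      have h4' := h4.symm
      have h5' := h5.symm
      have h6' := h6.symm
      fin_cases i <;> fin_cases j <;> simp_all

/-- Vertices outside the image of `e` are isolated in `H` and lie on no path, so covers can be moved
along `e` in both directions. This serves both for reading the input and for the renumbered output.
-/
theorem isYes_iff (I : Inst) (H : SimpleGraph ℕ) (e : Fin I.n → ℕ) (he : Function.Injective e)
    (hadj : ∀ p q, I.graph.Adj p q ↔ H.Adj (e p) (e q))
    (hr : ∀ a b, H.Adj a b → ∃ p, e p = a) : I.IsYes 4 ↔ HasCov H (I.k + 1) := by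
  classical
  simp only [Inst.IsYes, isPathVertexCover_iff]
  have hr' : ∀ a b, H.Adj a b → ∃ p, e p = b := fun a b h => hr b a h.symm
  constructor
  · rintro ⟨S, hS, hc⟩
    refine ⟨S.image e, by have := Finset.card_image_le (s := S) (f := e); omega, ?_⟩
    intro a b c d h
    obtain ⟨a, rfl⟩ := hr _ _ h.1
    obtain ⟨b, rfl⟩ := hr _ _ h.2.1
    obtain ⟨c, rfl⟩ := hr _ _ h.2.2.1
    obtain ⟨d, rfl⟩ := hr' _ _ h.2.2.1
    simp only [P4, ← hadj, ne_eq, he.eq_iff] at h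
    simpa only [Finset.mem_image, he.eq_iff, exists_eq_right] using hc a b c d h
  · rintro ⟨S, hS, hc⟩
    refine ⟨Finset.univ.filter fun p => e p ∈ S, ?_, ?_⟩
    · have : (Finset.univ.filter fun p => e p ∈ S).card ≤ S.card :=
        Finset.card_le_card_of_injOn e (fun p hp => by simpa using hp) he.injOn
      omega
    · intro a b c d h
      have := hc (e a) (e b) (e c) (e d) (by simpa only [P4, ← hadj, ne_eq, he.eq_iff] using h)
      simpa using this

theorem numEdges_le (I : Inst) (H : SimpleGraph ℕ) (e : Fin I.n → ℕ) (he : Function.Injective e)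
    (hadj : ∀ p q, I.graph.Adj p q ↔ H.Adj (e p) (e q)) (hfin : H.edgeSet.Finite) :
    I.numEdges ≤ H.edgeSet.ncard := by
  refine Set.ncard_le_ncard_of_injOn (Sym2.map e) ?_ (Sym2.map.injective he).injOn hfin
  intro x hx
  induction x using Sym2.ind with
  | _ a b =>
    simpa [← hadj] using hx

end FourPath

/-! ### The reduction program

Registers: `1`, `3`, `4` hold `n`, `2n`, `2n + 1`; `2` holds the strict budget; `5` records whether
something has changed. Array `0` holds the adjacency matrix, array `1` the offsets of its rows,
array `2` the vertices of the slots, array `3` marks matched vertices, arrays `4` and `5` hold the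
owners and the levels of the slots. -/

namespace FourPath

open RAM FP PathVertexCover

/-- The entry of the adjacency matrix in row `i` and column `j`. -/
def adjE (i j : Expr) : Expr := .get 0 (.add (.get 1 i) j)

/-- The state `s` represents the graph `G` on the vertices `0, …, n - 1`. -/
structure Rep (n : ℕ) (G : SimpleGraph ℕ) (s : State) : Prop where
  reg1 : s.reg 1 = n
  reg3 : s.reg 3 = n + n
  reg4 : s.reg 4 = n + n + 1
  row : ∀ i < n, s.arr 1 i = 2 + i * n
  vt : ∀ i < n + n, s.arr 2 i = slotVertex n i
  adj : ∀ i < n, ∀ j < n, s.arr 0 (2 + i * n + j) ≠ 0 ↔ G.Adj i j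
  lt : ∀ a b, G.Adj a b → a < n

theorem Rep.lt' {n : ℕ} {G : SimpleGraph ℕ} {s : State} (h : Rep n G s) (a b : ℕ)
    (hab : G.Adj a b) : b < n := h.lt b a hab.symm

theorem Rep.of_eq {n : ℕ} {G : SimpleGraph ℕ} {s t : State} (h : Rep n G s)
    (h1 : t.reg 1 = s.reg 1) (h3 : t.reg 3 = s.reg 3) (h4 : t.reg 4 = s.reg 4)
    (a0 : t.arr 0 = s.arr 0) (a1 : t.arr 1 = s.arr 1) (a2 : t.arr 2 = s.arr 2) : Rep n G t :=
  ⟨by rw [h1, h.reg1], by rw [h3, h.reg3], by rw [h4, h.reg4], by rw [a1]; exact h.row,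
    by rw [a2]; exact h.vt, by rw [a0]; exact h.adj, h.lt⟩

theorem Rep.frame {n : ℕ} {G : SimpleGraph ℕ} {s t : State} (h : Rep n G s) {W A : List ℕ}
    (hF : Frame W A s t) (hW : ∀ x ∈ [1, 3, 4], x ∉ W) (hA : ∀ a ∈ [0, 1, 2], a ∉ A) :
    Rep n G t :=
  h.of_eq (hF.reg _ (hW _ (by simp))) (hF.reg _ (hW _ (by simp))) (hF.reg _ (hW _ (by simp)))
    (hF.arr _ (hA _ (by simp))) (hF.arr _ (hA _ (by simp))) (hF.arr _ (hA _ (by simp)))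

theorem Rep.holds_adjE {n : ℕ} {G : SimpleGraph ℕ} {s : State} (h : Rep n G s) {i j : Expr}
    (hi : i.eval s < n) (hj : j.eval s < n) :
    (adjE i j).Holds s ↔ G.Adj (i.eval s) (j.eval s) := by
  simp only [adjE, Expr.holds_get, Expr.eval, h.row _ hi]
  exact h.adj _ hi _ hj

/-! ### Generic loops for counting, searching and clearing -/

/-- Count in register `k` the values of `x` below the content of register `r` with property `c`. -/
def countLoop (x r k : ℕ) (c : Expr) : FP :=
  seq (asg k (.lit 0)) (forr x r (when c (asg k (.add (.var k) (.lit 1)))))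

/-- Set register `f` to `1` if some value of `x` below the content of register `r` has property `c`,
and to `0` otherwise. -/
def anyLoop (x r f : ℕ) (c : Expr) : FP :=
  seq (asg f (.lit 0)) (forr x r (when c (asg f (.lit 1))))

/-- Fill array `a` with zeros. -/
def clearLoop (x r a : ℕ) : FP := forr x r (sto a (.var x) (.lit 0))

open Classical in
theorem run_countLoop {x r k : ℕ} {c : Expr} {s : State} (P : ℕ → Prop) (hxk : x ≠ k)
    (hrk : r ≠ k)
    (hc : ∀ i t, i < s.reg r → Frame [x, k] [] s t → t.reg x = i → (c.Holds t ↔ P i)) :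
    ((countLoop x r k c).run s).reg k = ((Finset.range (s.reg r)).filter P).card := by
  have hr : (s.setReg k 0).reg r = s.reg r := by simp [hrk]
  have := run_forr (x := x) (r := r) (p := when c (asg k (.add (.var k) (.lit 1))))
    (s := s.setReg k 0) (fun i t => t.reg k = ((Finset.range i).filter P).card)
    (fun i t v h => by simpa [hxk.symm] using h) (by simp) ?_
  · rw [hr] at this; exact this
  intro i t hi hF hx ht
  have hP := hc i t (by rwa [hr] at hi) ⟨fun y hy => by
    simp only [List.mem_cons, not_or, List.not_mem_nil, not_false_eq_true, and_true] at hy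
    rw [hF.reg y (by simp [when, wr, hy.1, hy.2])]; simp [hy.2], fun a _ => by
    rw [hF.arr a (by simp [when, wrA])]; simp⟩ hx
  rw [Finset.range_add_one, Finset.filter_insert]
  simp only [when, run, hP]
  split_ifs <;> simp [ht]

open Classical in
theorem run_anyLoop {x r f : ℕ} {c : Expr} {s : State} (P : ℕ → Prop) (hxf : x ≠ f)
    (hrf : r ≠ f)
    (hc : ∀ i t, i < s.reg r → Frame [x, f] [] s t → t.reg x = i → (c.Holds t ↔ P i)) :
    ((anyLoop x r f c).run s).reg f = if ∃ i < s.reg r, P i then 1 else 0 := by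
  have hr : (s.setReg f 0).reg r = s.reg r := by simp [hrf]
  have := run_forr (x := x) (r := r) (p := when c (asg f (.lit 1)))
    (s := s.setReg f 0) (fun i t => t.reg f = if ∃ j < i, P j then 1 else 0)
    (fun i t v h => by simpa [hxf.symm] using h) (by simp) ?_
  · rw [hr] at this; exact this
  intro i t hi hF hx ht
  have hP := hc i t (by rwa [hr] at hi) ⟨fun y hy => by
    simp only [List.mem_cons, not_or, List.not_mem_nil, not_false_eq_true, and_true] at hy
    rw [hF.reg y (by simp [when, wr, hy.1, hy.2])]; simp [hy.2], fun a _ => by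
    rw [hF.arr a (by simp [when, wrA])]; simp⟩ hx
  simp only [when, run, hP, Nat.lt_succ_iff_lt_or_eq, or_and_right, exists_or, exists_eq_left]
  by_cases h : P i
  · simp [h]
  · simp [h, ht]

theorem run_clearLoop {x r a : ℕ} {s : State} :
    ∀ i < s.reg r, ((clearLoop x r a).run s).arr a i = 0 := by
  refine run_forr (x := x) (r := r) (p := sto a (.var x) (.lit 0)) (s := s)
    (fun i t => ∀ j < i, t.arr a j = 0) (fun i t v h => by simpa using h) (by simp) ?_
  intro i t hi hF hx ht j hj
  simp only [run, Expr.eval, hx, State.setArr_arr, if_true, Function.update_apply]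
  split_ifs with h
  · rfl
  · exact ht j (by omega)

/-! #### Greedy matching -/

/-- `Y` marks the vertices of `c` disjoint edges of `G - v` with an end adjacent to `v`. -/
structure Greedy (n : ℕ) (G : SimpleGraph ℕ) (v : ℕ) (Y : ℕ → ℕ) (c : ℕ) : Prop where
  card : ((Finset.range n).filter fun i => Y i ≠ 0).card = 2 * c
  pair : ∀ S : Finset ℕ, (S ∩ (Finset.range n).filter fun i => Y i ≠ 0).card < c →
    ∃ a b, a ∉ S ∧ b ∉ S ∧ G.Adj v a ∧ G.Adj a b ∧ b ≠ v
  nbr : ∀ i < n, Y i ≠ 0 → i ≠ v ∧ ∃ x, x ≠ v ∧ G.Adj i x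

theorem Greedy.init {n : ℕ} {G : SimpleGraph ℕ} {v : ℕ} {Y : ℕ → ℕ} (h : ∀ i < n, Y i = 0) :
    Greedy n G v Y 0 where
  card := by
    rw [Finset.filter_false_of_mem]
    · rfl
    · intro i hi; simpa using h i (Finset.mem_range.1 hi)
  pair S h := absurd h (Nat.not_lt_zero _)
  nbr i hi h' := absurd (h i hi) h'

/-- A set that meets the new edge spends an element on it, hence meets the older marked vertices in
fewer than `c` elements and induction applies. A set that misses both ends has the new edge itself
as witness. -/
theorem Greedy.add {n : ℕ} {G : SimpleGraph ℕ} {v : ℕ} {Y : ℕ → ℕ} {c : ℕ}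
    (h : Greedy n G v Y c) {a b : ℕ} (ha : a < n) (hb : b < n) (hva : G.Adj v a)
    (hab : G.Adj a b) (hbv : b ≠ v) (hYa : Y a = 0) (hYb : Y b = 0) :
    Greedy n G v (Function.update (Function.update Y a 1) b 1) (c + 1) := by
  have hset : ((Finset.range n).filter fun i =>
      Function.update (Function.update Y a 1) b 1 i ≠ 0) =
      insert a (insert b ((Finset.range n).filter fun i => Y i ≠ 0)) := by
    ext i
    simp only [Finset.mem_filter, Finset.mem_range, Finset.mem_insert, Function.update_apply]
    split_ifs with h1 h2
    · subst h1; simp [hb]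
    · subst h2; simp [ha]
    · simp [h1, h2]
  have hb' : b ∉ (Finset.range n).filter fun i => Y i ≠ 0 := by simp [hYb]
  have ha' : a ∉ insert b ((Finset.range n).filter fun i => Y i ≠ 0) := by simp [hYa, hab.ne]
  refine ⟨?_, ?_, ?_⟩
  · rw [hset, Finset.card_insert_of_notMem ha', Finset.card_insert_of_notMem hb', h.card]; ring
  · intro S hS
    by_cases haS : a ∈ S ∨ b ∈ S
    · refine h.pair S ?_
      rw [hset] at hS
      refine lt_of_lt_of_le (Finset.card_lt_card ⟨?_, ?_⟩) (Nat.lt_succ_iff.1 hS)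
      · exact Finset.inter_subset_inter_left fun x hx =>
          Finset.mem_insert_of_mem (Finset.mem_insert_of_mem hx)
      · intro hsub
        rcases haS with h' | h'
        · have := hsub (Finset.mem_inter.2 ⟨h', Finset.mem_insert_self _ _⟩)
          exact ha' (Finset.mem_insert_of_mem (Finset.mem_inter.1 this).2)
        · have := hsub (Finset.mem_inter.2 ⟨h', Finset.mem_insert_of_mem
            (Finset.mem_insert_self _ _)⟩)
          exact hb' (Finset.mem_inter.1 this).2
    · push Not at haS
      exact ⟨a, b, haS.1, haS.2, hva, hab, hbv⟩
  · intro i hi hY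
    rw [Function.update_apply, Function.update_apply] at hY
    split_ifs at hY with h1 h2
    · subst h1; exact ⟨hbv, a, hva.ne', hab.symm⟩
    · subst h2; exact ⟨hva.ne', b, hbv, hab⟩
    · exact h.nbr i hi hY

/-- Mark the vertices of a maximal matching in the edges of `G - v` with an end adjacent to `v`, and
count its edges. -/
def greedyProg : FP :=
  block [clearLoop 7 1 3, asg 9 (.lit 0),
    forr 7 1 (forr 8 1 (when
      (.and (adjE (.var 6) (.var 7)) (.and (.not (.eq (.var 8) (.var 6)))
        (.and (adjE (.var 7) (.var 8)) (.and (.not (.get 3 (.var 7))) (.not (.get 3 (.var 8)))))))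
      (block [sto 3 (.var 7) (.lit 1), sto 3 (.var 8) (.lit 1),
        asg 9 (.add (.var 9) (.lit 1))])))]

/-- Marks are never erased, so once a pair has been inspected one of its ends remains marked; this
gives maximality. -/
theorem run_greedyProg {n : ℕ} {G : SimpleGraph ℕ} {s : State} (h : Rep n G s)
    (hv : s.reg 6 < n) :
    let t := greedyProg.run s
    Greedy n G (s.reg 6) (t.arr 3) (t.reg 9) ∧
      ∀ a < n, ∀ b < n, G.Adj (s.reg 6) a → b ≠ s.reg 6 → G.Adj a b →
        t.arr 3 a ≠ 0 ∨ t.arr 3 b ≠ 0 := by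
  intro t
  set v := s.reg 6 with hv'
  set s1 := (asg 9 (.lit 0)).run ((clearLoop 7 1 3).run s) with hs1
  have F1 : Frame [7, 9] [3] s s1 := by
    refine ⟨fun x hx => ?_, fun a ha => ?_⟩
    · simp only [List.mem_cons, not_or] at hx
      rw [hs1, run_reg _ _ _ (by simp [wr, hx]), run_reg _ _ _ (by simp [clearLoop, wr, hx])]
    · rw [hs1, run_arr _ _ _ (by simp [wrA]),
        run_arr _ _ _ (by simpa [clearLoop, wrA] using ha)]
  have R1 : Rep n G s1 := h.frame F1 (by decide) (by decide)
  have Y1 : ∀ i < n, s1.arr 3 i = 0 := fun i hi =>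
    run_clearLoop (s := s) (x := 7) i (by rw [h.reg1]; exact hi)
  have v1 : s1.reg 6 = v := F1.reg 6 (by decide)
  have key := run_forr (x := 7) (r := 1) (s := s1) (p := forr 8 1 (when
      (.and (adjE (.var 6) (.var 7)) (.and (.not (.eq (.var 8) (.var 6)))
        (.and (adjE (.var 7) (.var 8)) (.and (.not (.get 3 (.var 7))) (.not (.get 3 (.var 8)))))))
      (block [sto 3 (.var 7) (.lit 1), sto 3 (.var 8) (.lit 1),
        asg 9 (.add (.var 9) (.lit 1))])))
    (fun i t => Greedy n G v (t.arr 3) (t.reg 9) ∧ ∀ a < i, ∀ b < n, G.Adj v a → b ≠ v →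
      G.Adj a b → t.arr 3 a ≠ 0 ∨ t.arr 3 b ≠ 0)
    (fun i t v h => by simpa using h)
    ⟨by simpa [hs1, run] using Greedy.init Y1, by simp⟩ ?_
  · rw [R1.reg1] at key; exact key
  intro i t hi hF hi' ⟨hG, hM⟩
  rw [R1.reg1] at hi
  have Rt : Rep n G t := R1.frame hF (by decide) (by decide)
  have vt : t.reg 6 = v := (hF.reg 6 (by decide)).trans v1
  have key2 := run_forr (x := 8) (r := 1) (s := t) (p := when
      (.and (adjE (.var 6) (.var 7)) (.and (.not (.eq (.var 8) (.var 6)))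
        (.and (adjE (.var 7) (.var 8)) (.and (.not (.get 3 (.var 7))) (.not (.get 3 (.var 8)))))))
      (block [sto 3 (.var 7) (.lit 1), sto 3 (.var 8) (.lit 1),
        asg 9 (.add (.var 9) (.lit 1))]))
    (fun j t => Greedy n G v (t.arr 3) (t.reg 9) ∧ (∀ a < i, ∀ b < n, G.Adj v a → b ≠ v →
      G.Adj a b → t.arr 3 a ≠ 0 ∨ t.arr 3 b ≠ 0) ∧ ∀ b < j, G.Adj v i → b ≠ v → G.Adj i b →
      t.arr 3 i ≠ 0 ∨ t.arr 3 b ≠ 0)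
    (fun i t v h => by simpa using h) ⟨hG, hM, by simp⟩ ?_
  · rw [Rt.reg1] at key2
    obtain ⟨k1, k2, k3⟩ := key2
    refine ⟨k1, fun a ha b hb => ?_⟩
    rcases Nat.lt_succ_iff_lt_or_eq.1 ha with h' | rfl
    · exact k2 a h' b hb
    · exact k3 b hb
  intro j u hj hF' hj' ⟨gG, gM, gM'⟩
  rw [Rt.reg1] at hj
  have Ru : Rep n G u := Rt.frame hF' (by decide) (by decide)
  have vu : u.reg 6 = v := (hF'.reg 6 (by decide)).trans vt
  have iu : u.reg 7 = i := (hF'.reg 7 (by decide)).trans hi'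
  simp only [when, run, block]
  have hcond : (Expr.and (adjE (.var 6) (.var 7)) (.and (.not (.eq (.var 8) (.var 6)))
        (.and (adjE (.var 7) (.var 8)) (.and (.not (.get 3 (.var 7))) (.not (.get 3 (.var 8))))))).Holds u
      ↔ G.Adj v i ∧ j ≠ v ∧ G.Adj i j ∧ u.arr 3 i = 0 ∧ u.arr 3 j = 0 := by
    simp only [Expr.holds_and, Expr.holds_not, Expr.holds_eq]
    rw [Ru.holds_adjE (by simpa [vu]) (by simpa [iu]), Ru.holds_adjE (by simpa [iu]) (by simpa [hj'])]
    simp [vu, iu, hj']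
  split_ifs with hc
  · rw [hcond] at hc
    obtain ⟨c1, c2, c3, c4, c5⟩ := hc
    simp only [Expr.eval, State.setArr_reg, State.setReg_arr, State.setArr_arr, if_true, iu, hj',
      State.setReg_reg]
    have hm : ∀ x, u.arr 3 x ≠ 0 →
        Function.update (Function.update (u.arr 3) i 1) j 1 x ≠ 0 := by
      intro x hx
      rw [Function.update_apply, Function.update_apply]
      split_ifs <;> simp [hx]
    refine ⟨gG.add hi hj c1 c3 c2 c4 c5, fun a ha b hb x1 x2 x3 =>
      (gM a ha b hb x1 x2 x3).imp (hm _) (hm _), fun b hb x1 x2 x3 => ?_⟩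
    rcases Nat.lt_succ_iff_lt_or_eq.1 hb with h' | rfl
    · exact (gM' b h' x1 x2 x3).imp (hm _) (hm _)
    · right; simp
  · refine ⟨gG, gM, fun b hb x1 x2 x3 => ?_⟩
    rcases Nat.lt_succ_iff_lt_or_eq.1 hb with h' | rfl
    · exact gM' b h' x1 x2 x3
    · rw [hcond] at hc
      by_contra hcon
      push Not at hcon
      exact hc ⟨x1, x2, x3, hcon⟩

/-! #### Assignment of slots -/

/-- The unmarked neighbours of `v`. -/
abbrev Cand (G : SimpleGraph ℕ) (v : ℕ) (Y : ℕ → Prop) (l : ℕ) : Prop := G.Adj v l ∧ ¬ Y l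

/-- The slots of the marked neighbours of `l`. -/
abbrev Slot (n : ℕ) (G : SimpleGraph ℕ) (Y : ℕ → Prop) (l s : ℕ) : Prop :=
  Y (slotVertex n s) ∧ G.Adj l (slotVertex n s)

theorem slotVertex_lt {n s : ℕ} (hs : s < n + n) : slotVertex n s < n := by
  unfold slotVertex; split_ifs <;> omega

/-- Test whether the vertex in register `14` is an unmarked neighbour of the one in register `6`. -/
def candE : Expr := .and (adjE (.var 6) (.var 14)) (.not (.get 3 (.var 14)))

/-- Decide whether the vertex in register `14` holds a slot. -/
def heldProg : FP := anyLoop 15 3 11 (.eq (.get 4 (.var 15)) (.add (.var 14) (.lit 1)))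

/-- Find a slot of minimal level for the vertex in register `14`. -/
def minProg : FP :=
  block [asg 12 (.var 4), asg 13 (.lit 0),
    forr 15 3 (when (.and (.get 3 (.get 2 (.var 15))) (.and (adjE (.var 14) (.get 2 (.var 15)))
      (.lt (.get 5 (.var 15)) (.var 12)))) (block [asg 12 (.get 5 (.var 15)), asg 13 (.var 15)]))]

/-- Let the vertex in register `14` bid for a slot. -/
def bidProg : FP :=
  when candE (block [heldProg, when (.not (.var 11)) (block [minProg,
    when (.lt (.var 12) (.var 4)) (block [sto 4 (.var 13) (.add (.var 14) (.lit 1)),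
      sto 5 (.var 13) (.add (.var 12) (.lit 1))])])])

/-- The whole auction. -/
def auctionProg : FP :=
  block [clearLoop 15 3 4, clearLoop 15 3 5, forr 16 4 (forr 17 4 (forr 14 1 bidProg))]

theorem holds_candE {n : ℕ} {G : SimpleGraph ℕ} {s : State} {Y : ℕ → Prop} (h : Rep n G s)
    (hY : ∀ i, Y i ↔ s.arr 3 i ≠ 0) (hv : s.reg 6 < n) (hl : s.reg 14 < n) :
    candE.Holds s ↔ Cand G (s.reg 6) Y (s.reg 14) := by
  simp only [candE, Expr.holds_and, Expr.holds_not, Expr.holds_get, Expr.eval, hY, Cand]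
  rw [h.holds_adjE (by simpa) (by simpa)]
  rfl

theorem run_heldProg {n : ℕ} {G : SimpleGraph ℕ} {s : State} (h : Rep n G s) :
    (heldProg.run s).reg 11 ≠ 0 ↔ ∃ i < n + n, s.arr 4 i = s.reg 14 + 1 := by
  have := run_anyLoop (x := 15) (r := 3) (f := 11) (s := s)
    (c := .eq (.get 4 (.var 15)) (.add (.var 14) (.lit 1)))
    (fun i => s.arr 4 i = s.reg 14 + 1) (by decide) (by decide) (fun i t hi hF hx => by
      simp [hx, hF.reg 14 (by decide), hF.arr 4 (by decide)])
  rw [heldProg, this, h.reg3]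
  simp

/-- Register `12` starts at the ceiling `2n + 1`. A smaller final value comes with a slot that
attains it; the ceiling itself means that no available slot is below it. The `min` records that the
ceiling is never exceeded together with minimality. -/
theorem run_minProg {n : ℕ} {G : SimpleGraph ℕ} {s : State} {Y : ℕ → Prop} (h : Rep n G s)
    (hY : ∀ i, Y i ↔ s.arr 3 i ≠ 0) (hl : s.reg 14 < n) :
    let t := minProg.run s
    (t.reg 12 < n + n + 1 → t.reg 13 < n + n ∧ Slot n G Y (s.reg 14) (t.reg 13) ∧
      s.arr 5 (t.reg 13) = t.reg 12) ∧
    ∀ i < n + n, Slot n G Y (s.reg 14) i → min (n + n + 1) (s.arr 5 i) ≥ t.reg 12 := by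
  intro t
  set s1 := (asg 13 (.lit 0)).run ((asg 12 (.var 4)).run s) with hs1
  have R1 : Rep n G s1 := by
    refine h.of_eq ?_ ?_ ?_ ?_ ?_ ?_ <;> simp [hs1, run]
  have key := run_forr (x := 15) (r := 3) (s := s1)
    (p := when (.and (.get 3 (.get 2 (.var 15))) (.and (adjE (.var 14) (.get 2 (.var 15)))
      (.lt (.get 5 (.var 15)) (.var 12)))) (block [asg 12 (.get 5 (.var 15)), asg 13 (.var 15)]))
    (fun i t => t.reg 12 ≤ n + n + 1 ∧
      (t.reg 12 < n + n + 1 → t.reg 13 < n + n ∧ Slot n G Y (s.reg 14) (t.reg 13) ∧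
        s.arr 5 (t.reg 13) = t.reg 12) ∧
      ∀ j < i, Slot n G Y (s.reg 14) j → s.arr 5 j ≥ t.reg 12)
    (fun i t v h => by simpa using h) ⟨by simp [hs1, run, h.reg4], by simp [hs1, run, h.reg4],
      by simp⟩ ?_
  · rw [R1.reg3] at key
    exact ⟨key.2.1, fun i hi hE => le_min key.1 (key.2.2 i hi hE)⟩
  intro i u hi hF hi' ⟨k0, k1, k2⟩
  rw [R1.reg3] at hi
  have Ru : Rep n G u := R1.frame hF (by decide) (by decide)
  have lu : u.reg 14 = s.reg 14 := (hF.reg 14 (by decide)).trans (by simp [hs1, run])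
  have Yu : u.arr 3 = s.arr 3 := (hF.arr 3 (by decide)).trans (by simp [hs1, run])
  have Lu : u.arr 5 = s.arr 5 := (hF.arr 5 (by decide)).trans (by simp [hs1, run])
  have hcond : (Expr.and (.get 3 (.get 2 (.var 15))) (.and (adjE (.var 14) (.get 2 (.var 15)))
      (.lt (.get 5 (.var 15)) (.var 12)))).Holds u ↔
      Slot n G Y (s.reg 14) i ∧ s.arr 5 i < u.reg 12 := by
    have hsv := slotVertex_lt hi
    have e : (Expr.get 2 (.var 15)).eval u = slotVertex n i := by simp [hi', Ru.vt i hi]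
    simp only [Expr.holds_and]
    rw [Ru.holds_adjE (by simpa [lu]) (by rw [e]; exact hsv)]
    rw [Expr.holds_get, e]
    simp [lu, Yu, Lu, hi', Slot, hY, and_assoc]
  simp only [when, run, block, Expr.eval]
  split_ifs with hc
  · rw [hcond] at hc
    simp only [State.setReg_reg, hi', Lu, if_true, Nat.reduceEqDiff, if_false]
    refine ⟨by omega, fun _ => ⟨hi, hc.1, trivial⟩, fun j hj hE => ?_⟩
    rcases Nat.lt_succ_iff_lt_or_eq.1 hj with h' | rfl
    · have := k2 j h' hE; omega
    · exact le_rfl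
  · refine ⟨k0, k1, fun j hj hE => ?_⟩
    rcases Nat.lt_succ_iff_lt_or_eq.1 hj with h' | rfl
    · exact k2 j h' hE
    · rw [hcond] at hc
      by_contra hcon
      exact hc ⟨hE, by omega⟩

theorem run_bidProg {n : ℕ} {G : SimpleGraph ℕ} {s : State} {Y : ℕ → Prop} (h : Rep n G s)
    (hY : ∀ i, Y i ↔ s.arr 3 i ≠ 0) (hv : s.reg 6 < n) (hl : s.reg 14 < n)
    (hA : Auction (Cand G (s.reg 6) Y) (Slot n G Y) (n + n) (n + n + 1) (s.arr 4) (s.arr 5)) :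
    let t := bidProg.run s
    Auction (Cand G (s.reg 6) Y) (Slot n G Y) (n + n) (n + n + 1) (t.arr 4) (t.arr 5) ∧
    ((t.arr 4 = s.arr 4 ∧ t.arr 5 = s.arr 5 ∧ Idle (Cand G (s.reg 6) Y) (Slot n G Y) (n + n)
      (n + n + 1) (s.arr 4) (s.arr 5) (s.reg 14)) ∨
    (¬ Idle (Cand G (s.reg 6) Y) (Slot n G Y) (n + n) (n + n + 1) (s.arr 4) (s.arr 5) (s.reg 14) ∧
      ∑ i ∈ Finset.range (n + n), t.arr 5 i = ∑ i ∈ Finset.range (n + n), s.arr 5 i + 1)) := by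
  intro t
  have ht : t = bidProg.run s := rfl
  simp only [bidProg, when, run, block] at ht
  by_cases hc : candE.Holds s
  swap
  · rw [if_neg hc] at ht
    rw [ht]
    exact ⟨hA, .inl ⟨rfl, rfl, fun hL => absurd ((holds_candE h hY hv hl).2 hL) hc⟩⟩
  rw [if_pos hc] at ht
  rw [holds_candE h hY hv hl] at hc
  set s1 := heldProg.run s with hs1
  have F1 : Frame heldProg.wr heldProg.wrA s s1 := frame _ _
  have hh := run_heldProg h
  rw [← hs1] at hh
  by_cases hheld : (Expr.not (.var 11)).Holds s1
  swap
  · rw [if_neg hheld] at ht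
    rw [Expr.holds_not, not_not, Expr.holds_var, hh] at hheld
    rw [ht, F1.arr 4 (by decide), F1.arr 5 (by decide)]
    exact ⟨hA, .inl ⟨rfl, rfl, fun _ => .inl hheld⟩⟩
  rw [if_pos hheld] at ht
  rw [Expr.holds_not, Expr.holds_var, hh] at hheld
  push Not at hheld
  have R1 : Rep n G s1 := h.frame F1 (by decide) (by decide)
  have l1 : s1.reg 14 = s.reg 14 := F1.reg 14 (by decide)
  set s2 := minProg.run s1 with hs2
  have F2 : Frame minProg.wr minProg.wrA s1 s2 := frame _ _
  have R2 : Rep n G s2 := R1.frame F2 (by decide) (by decide)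
  have hm := run_minProg R1 (Y := Y) (by rw [F1.arr 3 (by decide)]; exact hY) (by rwa [l1])
  rw [← hs2, l1, F1.arr 5 (by decide)] at hm
  obtain ⟨m1, m2⟩ := hm
  have o2 : s2.arr 4 = s.arr 4 := (F2.arr 4 (by decide)).trans (F1.arr 4 (by decide))
  have l2 : s2.arr 5 = s.arr 5 := (F2.arr 5 (by decide)).trans (F1.arr 5 (by decide))
  have r2 : s2.reg 14 = s.reg 14 := (F2.reg 14 (by decide)).trans l1
  by_cases hlt : (Expr.lt (.var 12) (.var 4)).Holds s2
  · rw [if_pos hlt] at ht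
    simp only [Expr.holds_lt, Expr.eval, R2.reg4] at hlt
    obtain ⟨a1, a2, a3⟩ := m1 hlt
    have e4 : t.arr 4 = Function.update (s.arr 4) (s2.reg 13) (s.reg 14 + 1) := by
      rw [ht]; simp [o2, r2]
    have e5 : t.arr 5 = Function.update (s.arr 5) (s2.reg 13) (s.arr 5 (s2.reg 13) + 1) := by
      rw [ht]; simp [l2, a3]
    obtain ⟨b1, b2⟩ := hA.bid (l := s.reg 14) (s := s2.reg 13) hc hheld a1 a2 (by rw [a3]; exact hlt)
      (fun s' hs' hE => by
        have := m2 s' hs' hE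
        rw [a3]
        exact this.le.trans (min_le_right _ _))
    rw [e4, e5]
    refine ⟨b1, .inr ⟨fun hid => ?_, b2⟩⟩
    rcases hid hc with ⟨x, hx, e⟩ | h'
    · exact hheld x hx e
    · have := h' _ a1 a2
      omega
  · rw [if_neg hlt] at ht
    simp only [Expr.holds_lt, Expr.eval, R2.reg4] at hlt
    rw [ht, o2, l2]
    refine ⟨hA, .inl ⟨rfl, rfl, fun _ => .inr fun i hi hE => ?_⟩⟩
    have := m2 i hi hE
    have := min_le_right (n + n + 1) (s.arr 5 i)
    omega

/-- Until the first successful bid of a sweep the assignment is unchanged. Hence a sweep without a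
bid shows that all candidates are idle at once, and any other sweep raises the potential. -/
theorem run_bidLoop {n : ℕ} {G : SimpleGraph ℕ} {s : State} {Y : ℕ → Prop} (h : Rep n G s)
    (hY : ∀ i, Y i ↔ s.arr 3 i ≠ 0) (hv : s.reg 6 < n)
    (hA : Auction (Cand G (s.reg 6) Y) (Slot n G Y) (n + n) (n + n + 1) (s.arr 4) (s.arr 5)) :
    let t := (forr 14 1 bidProg).run s
    Auction (Cand G (s.reg 6) Y) (Slot n G Y) (n + n) (n + n + 1) (t.arr 4) (t.arr 5) ∧
    ((∀ l < n, Idle (Cand G (s.reg 6) Y) (Slot n G Y) (n + n) (n + n + 1) (t.arr 4) (t.arr 5) l) ∨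
    (¬ (∀ l < n, Idle (Cand G (s.reg 6) Y) (Slot n G Y) (n + n) (n + n + 1) (s.arr 4) (s.arr 5) l) ∧
      ∑ i ∈ Finset.range (n + n), s.arr 5 i + 1 ≤ ∑ i ∈ Finset.range (n + n), t.arr 5 i)) := by
  intro t
  set v := s.reg 6
  have key := run_forr (x := 14) (r := 1) (s := s) (p := bidProg)
    (fun i t => Auction (Cand G v Y) (Slot n G Y) (n + n) (n + n + 1) (t.arr 4) (t.arr 5) ∧
      ((t.arr 4 = s.arr 4 ∧ t.arr 5 = s.arr 5 ∧ ∀ l < i, Idle (Cand G v Y) (Slot n G Y) (n + n)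
        (n + n + 1) (s.arr 4) (s.arr 5) l) ∨
      (¬ (∀ l < n, Idle (Cand G v Y) (Slot n G Y) (n + n) (n + n + 1) (s.arr 4) (s.arr 5) l) ∧
        ∑ i ∈ Finset.range (n + n), s.arr 5 i + 1 ≤ ∑ i ∈ Finset.range (n + n), t.arr 5 i)))
    (fun i t v h => by simpa using h) ⟨hA, .inl ⟨rfl, rfl, by simp⟩⟩ ?_
  · rw [h.reg1] at key
    refine ⟨key.1, key.2.imp (fun h => ?_) id⟩
    change ∀ l < n, Idle _ _ _ _ (((forr 14 1 bidProg).run s).arr 4)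
      (((forr 14 1 bidProg).run s).arr 5) l
    rw [h.1, h.2.1]; exact h.2.2
  intro i u hi hF hi' ⟨k1, k2⟩
  rw [h.reg1] at hi
  have Ru : Rep n G u := h.frame hF (by decide) (by decide)
  have vu : u.reg 6 = v := hF.reg 6 (by decide)
  have Yu : u.arr 3 = s.arr 3 := hF.arr 3 (by decide)
  have hb := run_bidProg Ru (Y := Y) (by rw [Yu]; exact hY) (by rwa [vu]) (by rwa [hi'])
    (by rwa [vu])
  rw [vu, hi'] at hb
  obtain ⟨b1, b2⟩ := hb
  refine ⟨b1, ?_⟩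
  rcases k2 with ⟨c1, c2, c3⟩ | ⟨c1, c2⟩
  · rcases b2 with ⟨d1, d2, d3⟩ | ⟨d1, d2⟩
    · refine .inl ⟨d1.trans c1, d2.trans c2, fun l hl => ?_⟩
      rcases Nat.lt_succ_iff_lt_or_eq.1 hl with h' | rfl
      · exact c3 l h'
      · rwa [c1, c2] at d3
    · refine .inr ⟨fun hall => d1 ?_, ?_⟩
      · rw [c1, c2]; exact hall i hi
      · rw [d2, c2]
  · refine .inr ⟨c1, ?_⟩
    rcases b2 with ⟨d1, d2, d3⟩ | ⟨d1, d2⟩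
    · rw [d2]; exact c2
    · omega

theorem run_auctionProg {n : ℕ} {G : SimpleGraph ℕ} {s : State} {Y : ℕ → Prop} (h : Rep n G s)
    (hY : ∀ i, Y i ↔ s.arr 3 i ≠ 0) (hv : s.reg 6 < n) :
    let t := auctionProg.run s
    Auction (Cand G (s.reg 6) Y) (Slot n G Y) (n + n) (n + n + 1) (t.arr 4) (t.arr 5) ∧
    ∀ l, Idle (Cand G (s.reg 6) Y) (Slot n G Y) (n + n) (n + n + 1) (t.arr 4) (t.arr 5) l := by
  intro t
  set v := s.reg 6 with hv'
  set s1 := (clearLoop 15 3 4).run s with hs1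
  set s2 := (clearLoop 15 3 5).run s1 with hs2
  have F1 : Frame (clearLoop 15 3 4).wr (clearLoop 15 3 4).wrA s s1 := frame _ _
  have F2 : Frame (clearLoop 15 3 5).wr (clearLoop 15 3 5).wrA s1 s2 := frame _ _
  have R1 : Rep n G s1 := h.frame F1 (by decide) (by decide)
  have R2 : Rep n G s2 := R1.frame F2 (by decide) (by decide)
  have v2 : s2.reg 6 = v := (F2.reg 6 (by decide)).trans (F1.reg 6 (by decide))
  have Y2 : s2.arr 3 = s.arr 3 := (F2.arr 3 (by decide)).trans (F1.arr 3 (by decide))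
  have o1 : ∀ i < n + n, s2.arr 4 i = 0 := fun i hi => by
    rw [F2.arr 4 (by decide)]
    exact run_clearLoop i (by rw [h.reg3]; exact hi)
  have o2 : ∀ i < n + n, s2.arr 5 i = 0 := fun i hi =>
    run_clearLoop i (by rw [R1.reg3]; exact hi)
  let I : ℕ → State → Prop := fun m t =>
    Auction (Cand G v Y) (Slot n G Y) (n + n) (n + n + 1) (t.arr 4) (t.arr 5) ∧
      ((∀ l < n, Idle (Cand G v Y) (Slot n G Y) (n + n) (n + n + 1) (t.arr 4) (t.arr 5) l) ∨
        m ≤ ∑ i ∈ Finset.range (n + n), t.arr 5 i)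
  have hround : ∀ m u, Rep n G u → u.reg 6 = v → u.arr 3 = s.arr 3 → I m u →
      I (m + 1) ((forr 14 1 bidProg).run u) := by
    rintro m u Ru vu Yu ⟨k1, k2⟩
    have hb := run_bidLoop Ru (Y := Y) (by rw [Yu]; exact hY) (by rwa [vu]) (by rwa [vu])
    rw [vu] at hb
    refine ⟨hb.1, hb.2.imp id fun ⟨b1, b2⟩ => ?_⟩
    rcases k2 with k2 | k2
    · exact absurd k2 b1
    · omega
  have key := run_forr (x := 16) (r := 4) (s := s2) (p := forr 17 4 (forr 14 1 bidProg))
    (fun i t => I (i * (n + n + 1)) t) (fun i t v h => by simpa [I] using h)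
    ⟨Auction.init o1 o2, .inr (by simp)⟩ ?_
  · rw [R2.reg4] at key
    change I _ t at key
    obtain ⟨k1, k2⟩ := key
    refine ⟨k1, fun l hL => ?_⟩
    have hln : l < n := h.lt' _ _ hL.1
    rcases k2 with k2 | k2
    · exact k2 l hln hL
    -- The levels sum to at most `2n(2n + 1)`, which is less than the number `(2n + 1)²` of sweeps.
    · exfalso
      have : ∑ i ∈ Finset.range (n + n), t.arr 5 i ≤ (Finset.range (n + n)).card • (n + n + 1) :=
        Finset.sum_le_card_nsmul _ _ _ fun i hi => k1.le i (Finset.mem_range.1 hi)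
      simp only [Finset.card_range, smul_eq_mul] at this
      nlinarith
  intro i u hi hF hi' hI
  have Ru : Rep n G u := R2.frame hF (by decide) (by decide)
  have vu : u.reg 6 = v := (hF.reg 6 (by decide)).trans v2
  have Yu : u.arr 3 = s.arr 3 := (hF.arr 3 (by decide)).trans Y2
  have key2 := run_forr (x := 17) (r := 4) (s := u) (p := forr 14 1 bidProg)
    (fun j t => I (i * (n + n + 1) + j) t) (fun i t v h => by simpa [I] using h) hI ?_
  · rw [Ru.reg4] at key2
    rw [Nat.succ_mul]
    exact key2
  intro j w hj hF' hj' hI'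
  exact hround _ w (Ru.frame hF' (by decide) (by decide)) ((hF'.reg 6 (by decide)).trans vu)
    ((hF'.arr 3 (by decide)).trans Yu) hI'

/-! #### One reduction step -/

theorem index_inj {n i j a b : ℕ} (hj : j < n) (hb : b < n) :
    2 + i * n + j = 2 + a * n + b ↔ i = a ∧ j = b := by
  constructor
  · intro h
    have h1 : j = b := by
      have := congrArg (· % n) (show j + i * n = b + a * n by omega)
      simpa [Nat.mod_eq_of_lt hj, Nat.mod_eq_of_lt hb] using this
    refine ⟨Nat.eq_of_mul_eq_mul_right (show 0 < n by omega) (by omega), h1⟩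
  · rintro ⟨rfl, rfl⟩; rfl

open Classical in
/-- The number of ordered pairs of adjacent vertices. -/
noncomputable def pairs (n : ℕ) (G : SimpleGraph ℕ) : ℕ :=
  ((Finset.range n ×ˢ Finset.range n).filter fun p => G.Adj p.1 p.2).card

theorem pairs_lt {n : ℕ} {G H : SimpleGraph ℕ} (hle : H ≤ G) {a b : ℕ} (ha : a < n) (hb : b < n)
    (hG : G.Adj a b) (hH : ¬ H.Adj a b) : pairs n H < pairs n G := by
  classical
  refine Finset.card_lt_card ⟨Finset.monotone_filter_right _ fun p _ h => hle h, fun h => ?_⟩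
  have := h (Finset.mem_filter.2 ⟨Finset.mk_mem_product (Finset.mem_range.2 ha)
    (Finset.mem_range.2 hb), hG⟩)
  exact hH (Finset.mem_filter.1 this).2

open Classical in
/-- The degree of `v` is small, and `v` has at most one pendant neighbour. -/
def Irr (n : ℕ) (G : SimpleGraph ℕ) (v K : ℕ) : Prop :=
  ((Finset.range n).filter fun l => G.Adj v l).card ≤ 6 * (K - 1) + 2 ∧
    ∀ p q, Pendant G v p → Pendant G v q → p = q

/-- Count the unmarked neighbours of `v` without a slot, and record the last one. -/
def scanProg : FP :=
  block [asg 18 (.lit 0), asg 19 (.lit 0), forr 14 1 (when candE (block [heldProg,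
    when (.not (.var 11)) (block [asg 18 (.add (.var 18) (.lit 1)), asg 19 (.var 14)])]))]

/-- Remove the vertex in register `6` from the graph. -/
def isolateProg : FP :=
  forr 7 1 (block [sto 0 (.add (.get 1 (.var 6)) (.var 7)) (.lit 0),
    sto 0 (.add (.get 1 (.var 7)) (.var 6)) (.lit 0)])

/-- Try to reduce at the vertex in register `6`. -/
def stepProg : FP :=
  block [greedyProg, countLoop 7 1 10 (adjE (.var 6) (.var 7)),
    ite (.and (.not (.lt (.var 9) (.var 2))) (.not (.lt (.var 10) (.add (.var 2) (.lit 2)))))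
      (block [isolateProg, asg 2 (.sub (.var 2) (.lit 1)), asg 5 (.lit 1)])
      (block [auctionProg, scanProg, when (.lt (.lit 1) (.var 18))
        (block [sto 0 (.add (.get 1 (.var 6)) (.var 19)) (.lit 0),
          sto 0 (.add (.get 1 (.var 19)) (.var 6)) (.lit 0), asg 5 (.lit 1)])])]

theorem run_isolateProg {n : ℕ} {G : SimpleGraph ℕ} {s : State} (h : Rep n G s)
    (hv : s.reg 6 < n) : Rep n (isolate G (s.reg 6)) (isolateProg.run s) := by
  set v := s.reg 6 with hv'
  have F : Frame isolateProg.wr isolateProg.wrA s (isolateProg.run s) := frame _ _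
  have key := run_forr (x := 7) (r := 1) (s := s)
    (p := block [sto 0 (.add (.get 1 (.var 6)) (.var 7)) (.lit 0),
      sto 0 (.add (.get 1 (.var 7)) (.var 6)) (.lit 0)])
    -- After `i` iterations the entries of row `v` and of column `v` with index below `i` have been
    -- cleared.
    (fun i t => ∀ a < n, ∀ b < n, t.arr 0 (2 + a * n + b) ≠ 0 ↔
      G.Adj a b ∧ ¬ (a = v ∧ b < i) ∧ ¬ (b = v ∧ a < i))
    (fun i t v h => by simpa using h) (fun a ha b hb => by simpa using h.adj a ha b hb) ?_
  · rw [h.reg1] at key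
    refine ⟨(F.reg 1 (by decide)).trans h.reg1, (F.reg 3 (by decide)).trans h.reg3,
      (F.reg 4 (by decide)).trans h.reg4, ?_, ?_, ?_, fun a b hab => h.lt a b hab.1⟩
    · rw [F.arr 1 (by decide)]; exact h.row
    · rw [F.arr 2 (by decide)]; exact h.vt
    · intro a ha b hb
      refine (key a ha b hb).trans ?_
      simp only [isolate, ha, hb, and_true]
  intro i u hi hF hi' hI a ha b hb
  rw [h.reg1] at hi
  have r1 : u.arr 1 = s.arr 1 := hF.arr 1 (by decide)
  have r6 : u.reg 6 = v := hF.reg 6 (by decide)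
  have := hI a ha b hb
  simp only [run, block, Expr.eval, State.setArr_arr, State.setArr_reg, hi', r6, r1, h.row v hv,
    h.row i hi, if_true, if_false, one_ne_zero,
    Function.update_apply, index_inj hb hv, index_inj hb hi]
  split_ifs with h1 h2
  · simp [h1]
  · simp [h2]
  · rw [this]
    have e1 : (a = v ∧ b < i + 1) ↔ (a = v ∧ b < i) := by omega
    have e2 : (b = v ∧ a < i + 1) ↔ (b = v ∧ a < i) := by omega
    rw [e1, e2]

theorem Rep.delEdge {n : ℕ} {G : SimpleGraph ℕ} {s t : State} (h : Rep n G s) {v w : ℕ}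
    (hv : v < n) (hw : w < n) (r1 : t.reg 1 = s.reg 1) (r3 : t.reg 3 = s.reg 3)
    (r4 : t.reg 4 = s.reg 4) (a1 : t.arr 1 = s.arr 1) (a2 : t.arr 2 = s.arr 2)
    (a0 : t.arr 0 = Function.update (Function.update (s.arr 0) (2 + v * n + w) 0)
      (2 + w * n + v) 0) : Rep n (delEdge G v w) t := by
  refine ⟨r1.trans h.reg1, r3.trans h.reg3, r4.trans h.reg4, by rw [a1]; exact h.row,
    by rw [a2]; exact h.vt, fun a ha b hb => ?_, fun a b hab => h.lt a b hab.1⟩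
  simp only [a0, Function.update_apply, index_inj hb hv, index_inj hb hw, FourPath.delEdge]
  have := h.adj a ha b hb
  split_ifs <;> tauto

theorem run_scanProg {n : ℕ} {G : SimpleGraph ℕ} {s : State} {Y : ℕ → Prop} (h : Rep n G s)
    (hY : ∀ i, Y i ↔ s.arr 3 i ≠ 0) (hv : s.reg 6 < n) :
    let t := scanProg.run s
    ∃ U : Finset ℕ,
      (∀ l, l ∈ U ↔ l < n ∧ Cand G (s.reg 6) Y l ∧ ∀ i < n + n, s.arr 4 i ≠ l + 1) ∧
      t.reg 18 = U.card ∧ (U.Nonempty → t.reg 19 ∈ U) := by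
  classical
  intro t
  set v := s.reg 6 with hv'
  set s1 := (asg 19 (.lit 0)).run ((asg 18 (.lit 0)).run s) with hs1
  have R1 : Rep n G s1 := by
    refine h.of_eq ?_ ?_ ?_ ?_ ?_ ?_ <;> simp [hs1, run]
  set P : ℕ → Prop := fun l => Cand G v Y l ∧ ∀ i < n + n, s.arr 4 i ≠ l + 1 with hP
  have key := run_forr (x := 14) (r := 1) (s := s1) (p := when candE (block [heldProg,
    when (.not (.var 11)) (block [asg 18 (.add (.var 18) (.lit 1)), asg 19 (.var 14)])]))
    (fun i t => t.reg 18 = ((Finset.range i).filter P).card ∧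
      (((Finset.range i).filter P).Nonempty → t.reg 19 ∈ (Finset.range i).filter P))
    (fun i t v h => by simpa using h) ⟨by simp [hs1, run], by simp⟩ ?_
  · rw [R1.reg1] at key; exact ⟨(Finset.range n).filter P, by simp [hP], key⟩
  rintro i u hi hF hi' ⟨k1, k2⟩
  rw [R1.reg1] at hi
  have Ru : Rep n G u := R1.frame hF (by decide) (by decide)
  have vu : u.reg 6 = v := (hF.reg 6 (by decide)).trans (by simp [hs1, run, hv'])
  have Yu : u.arr 3 = s.arr 3 := (hF.arr 3 (by decide)).trans (by simp [hs1, run])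
  have Ou : u.arr 4 = s.arr 4 := (hF.arr 4 (by decide)).trans (by simp [hs1, run])
  have hc := holds_candE Ru (Y := Y) (by rw [Yu]; exact hY) (by rwa [vu]) (by rwa [hi'])
  rw [vu, hi'] at hc
  have hh := run_heldProg Ru
  rw [hi', Ou] at hh
  have F2 : Frame heldProg.wr heldProg.wrA u (heldProg.run u) := frame _ _
  have e18 : (heldProg.run u).reg 18 = u.reg 18 := F2.reg 18 (by decide)
  have e19 : (heldProg.run u).reg 19 = u.reg 19 := F2.reg 19 (by decide)
  have e14 : (heldProg.run u).reg 14 = i := (F2.reg 14 (by decide)).trans hi'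
  have hneg : ∀ w : State, w.reg 18 = u.reg 18 → w.reg 19 = u.reg 19 → ¬ P i →
      (w.reg 18 = ((Finset.range (i + 1)).filter P).card ∧
      (((Finset.range (i + 1)).filter P).Nonempty → w.reg 19 ∈ (Finset.range (i + 1)).filter P)) := by
    intro w w1 w2 hPi
    rw [Finset.range_add_one, Finset.filter_insert, if_neg hPi, w1, w2]
    exact ⟨k1, k2⟩
  simp only [when, run, block]
  split_ifs with h1 h2
  · rw [hc] at h1
    rw [Expr.holds_not, Expr.holds_var, hh] at h2
    push Not at h2
    have hPi : P i := ⟨h1, h2⟩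
    simp only [State.setReg_reg, Expr.eval, e18, e14, k1]
    rw [Finset.range_add_one, Finset.filter_insert, if_pos hPi,
      Finset.card_insert_of_notMem (by simp)]
    simp
  · rw [Expr.holds_not, not_not, Expr.holds_var, hh] at h2
    obtain ⟨x, hx, e⟩ := h2
    exact hneg _ e18 e19 fun hPi => hPi.2 x hx e
  · rw [hc] at h1
    exact hneg _ rfl rfl fun hPi => h1 hPi.1

/-- One of three things happens: `v` is forced and removed, a crown edge at `v` is deleted, or
nothing changes and the failed tests give irreducibility at `v`. -/
theorem run_stepProg {n : ℕ} {G : SimpleGraph ℕ} {s : State} (h : Rep n G s) (hv : s.reg 6 < n) :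
    let t := stepProg.run s
    ∃ G', Rep n G' t ∧ (HasCov G (s.reg 2) ↔ HasCov G' (t.reg 2)) ∧ t.reg 2 ≤ s.reg 2 ∧
      ((t.reg 5 = s.reg 5 ∧ G' = G ∧ t.reg 2 = s.reg 2 ∧ Irr n G (s.reg 6) (s.reg 2)) ∨
        (t.reg 5 = 1 ∧ pairs n G' < pairs n G)) := by
  classical
  intro t
  have ht : t = stepProg.run s := rfl
  simp only [stepProg, run, block] at ht
  set v := s.reg 6 with hv'
  set K := s.reg 2 with hK
  set s1 := greedyProg.run s with hs1
  have F1 : Frame greedyProg.wr greedyProg.wrA s s1 := frame _ _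
  have R1 : Rep n G s1 := h.frame F1 (by decide) (by decide)
  obtain ⟨g1, g2⟩ := run_greedyProg h hv
  rw [← hs1] at g1 g2
  set s2 := (countLoop 7 1 10 (adjE (.var 6) (.var 7))).run s1 with hs2
  have F2 : Frame _ _ s1 s2 := frame _ _
  have R2 : Rep n G s2 := R1.frame F2 (by decide) (by decide)
  have v1 : s1.reg 6 = v := F1.reg 6 (by decide)
  have v2 : s2.reg 6 = v := (F2.reg 6 (by decide)).trans v1
  have K2 : s2.reg 2 = K := (F2.reg 2 (by decide)).trans (F1.reg 2 (by decide))
  have c2 : s2.reg 5 = s.reg 5 := (F2.reg 5 (by decide)).trans (F1.reg 5 (by decide))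
  have m2 : s2.reg 9 = s1.reg 9 := F2.reg 9 (by decide)
  have Y2 : s2.arr 3 = s1.arr 3 := F2.arr 3 (by decide)
  have d2 : s2.reg 10 = ((Finset.range n).filter fun l => G.Adj v l).card := by
    have := run_countLoop (x := 7) (r := 1) (k := 10) (s := s1) (c := adjE (.var 6) (.var 7))
      (fun l => G.Adj v l) (by decide) (by decide) (fun i u hi hF hi' => by
        rw [R1.reg1] at hi
        have Ru : Rep n G u := R1.frame hF (by decide) (by decide)
        have e : u.reg 6 = v := (hF.reg 6 (by decide)).trans v1
        rw [Ru.holds_adjE (by simpa [e]) (by simpa [hi'])]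
        simp [e, hi'])
    rw [hs2, this, R1.reg1]
  set Y : ℕ → Prop := fun i => s1.arr 3 i ≠ 0 with hYdef
  split_ifs at ht with hc
  · -- the vertex is forced
    simp only [Expr.holds_and, Expr.holds_not, Expr.holds_lt, Expr.eval, K2, m2, d2] at hc
    set s3 := isolateProg.run s2 with hs3
    have F3 : Frame isolateProg.wr isolateProg.wrA s2 s3 := frame _ _
    have R3 := run_isolateProg R2 (by rwa [v2])
    rw [← hs3, v2] at R3
    have tK : t.reg 2 = K - 1 := by
      rw [ht]; simp [F3.reg 2 (by decide), K2]
    have hdeg : ∀ S : Finset ℕ, S.card < K + 2 → ∃ z, G.Adj v z ∧ z ∉ S := by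
      intro S hS
      by_contra hcon
      push Not at hcon
      have : (Finset.range n).filter (fun l => G.Adj v l) ⊆ S := fun z hz =>
        hcon z (Finset.mem_filter.1 hz).2
      have := Finset.card_le_card this
      omega
    refine ⟨isolate G v, ?_, ?_, by omega, .inr ⟨by rw [ht]; simp, ?_⟩⟩
    · refine R3.of_eq ?_ ?_ ?_ ?_ ?_ ?_ <;> rw [ht] <;> simp
    · rw [tK]
      refine hasCov_isolate (fun S hS => g1.pair S ?_) hdeg
      have := Finset.card_le_card (Finset.inter_subset_left (s₁ := S)
        (s₂ := (Finset.range n).filter fun i => s1.arr 3 i ≠ 0))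
      omega
    · obtain ⟨z, hz, -⟩ := hdeg ∅ (by simp)
      exact pairs_lt (isolate_le G v) hv (h.lt' _ _ hz) hz fun h => h.2.1 rfl
  · simp only [Expr.holds_and, Expr.holds_not, Expr.holds_lt, Expr.eval, K2, m2, d2] at hc
    have hY2 : ∀ i, Y i ↔ s2.arr 3 i ≠ 0 := fun i => by rw [Y2]
    set s3 := auctionProg.run s2 with hs3
    have F3 : Frame auctionProg.wr auctionProg.wrA s2 s3 := frame _ _
    have R3 : Rep n G s3 := R2.frame F3 (by decide) (by decide)
    obtain ⟨A1, A2⟩ := run_auctionProg R2 hY2 (by rwa [v2])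
    rw [← hs3, v2] at A1 A2
    set s4 := scanProg.run s3 with hs4
    have F4 : Frame scanProg.wr scanProg.wrA s3 s4 := frame _ _
    have R4 : Rep n G s4 := R3.frame F4 (by decide) (by decide)
    have v3 : s3.reg 6 = v := (F3.reg 6 (by decide)).trans v2
    have v4 : s4.reg 6 = v := (F4.reg 6 (by decide)).trans v3
    have K4 : s4.reg 2 = K :=
      (F4.reg 2 (by decide)).trans ((F3.reg 2 (by decide)).trans K2)
    have c4 : s4.reg 5 = s.reg 5 :=
      (F4.reg 5 (by decide)).trans ((F3.reg 5 (by decide)).trans c2)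
    obtain ⟨U, hU, u1, u2⟩ := run_scanProg R3 (Y := Y)
      (by rw [F3.arr 3 (by decide)]; exact hY2) (by rwa [v3])
    rw [← hs4] at u1 u2
    rw [v3] at hU
    by_cases hlt : 1 < U.card
    · have hmem : s4.reg 19 ∈ U := u2 (Finset.card_pos.1 (by omega))
      obtain ⟨w, hw, hne⟩ := Finset.exists_mem_ne hlt (s4.reg 19)
      rw [hU] at hmem hw
      rw [when, run, if_pos (by simpa [u1] using hlt)] at ht
      have tK : t.reg 2 = K := by rw [ht]; simp [run, K4]
      refine ⟨delEdge G v (s4.reg 19), ?_, ?_, by omega, .inr ⟨by rw [ht]; simp [run], ?_⟩⟩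
      · refine R4.delEdge hv hmem.1 ?_ ?_ ?_ ?_ ?_ ?_ <;> rw [ht]
        all_goals simp [run, v4, R4.row _ hv, R4.row _ hmem.1]
      · rw [tK]
        -- Maximality of the matching puts every other neighbour of an unmarked neighbour of `v`
        -- among the marked vertices, as the crown requires.
        refine A1.hasCov_delEdge h.lt (fun l hl hYl x hlx hxv => ?_) A2 hmem.2.1 hmem.2.2 hw.2.1
          hw.2.2 hne
        exact (g2 l (h.lt' _ _ hl) x (h.lt' _ _ hlx) hl hxv hlx).resolve_left hYl
      · exact pairs_lt (delEdge_le _ _ _) hv hmem.1 hmem.2.1.1 fun h => h.2.1 ⟨rfl, rfl⟩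
    · rw [when, run, if_neg (by simpa [u1] using hlt)] at ht
      have tt : t = s4 := by rw [ht]; rfl
      rw [tt, K4]
      refine ⟨G, R4, Iff.rfl, le_rfl, .inl ⟨c4, rfl, rfl, ?_, ?_⟩⟩
      -- With fewer than `K` matching edges the degree is at most `3 · 2(K - 1) + 1`. Otherwise the
      -- forcing test failed on the degree, which is then at most `K + 1`; for `K = 0` the failed
      -- test even gives a degree below `2`.
      · have hb := A1.card_le ((Finset.range n).filter fun l => G.Adj v l)
          ((Finset.range n).filter fun i => s1.arr 3 i ≠ 0) U (by simp)
          (fun i hi hYi => Finset.mem_filter.2 ⟨Finset.mem_range.2 hi, hYi⟩)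
          fun l hl h1 h2 => (hU l).2 ⟨hl, h1, h2⟩
        rw [g1.card] at hb
        omega
      -- A pendant neighbour of `v` is on no edge of `G - v`, so it is unmarked and adjacent to no
      -- slot.
      · have hpU : ∀ p, Pendant G v p → p ∈ U := by
          intro p hp
          have hpn := h.lt' _ _ hp.1
          refine (hU p).2 ⟨hpn, ⟨hp.1, fun hYp => ?_⟩,
            fun i hi e => ?_⟩
          · obtain ⟨-, x, hx, hpx⟩ := g1.nbr p hpn hYp
            exact hx (hp.2 x hpx)
          · obtain ⟨-, ⟨hYs, hps⟩, -⟩ := A1.mem i hi p e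
            have := g1.nbr _ (slotVertex_lt hi) hYs
            exact this.1 (hp.2 _ hps)
        intro p q hp hq
        exact Finset.card_le_one.1 (by omega) p (hpU p hp) q (hpU q hq)

/-! #### Exhaustive reduction -/

/-- Reduce at all vertices until nothing changes. -/
def roundsProg : FP :=
  block [asg 5 (.lit 1),
    forr 20 4 (forr 21 4 (when (.var 5) (block [asg 5 (.lit 0), forr 6 1 stepProg])))]

/-- If the flag stays `0`, graph and budget were constant during the pass, so the irreducibility
found at the individual vertices refers to one and the same graph. -/
theorem run_stepLoop {n : ℕ} {G : SimpleGraph ℕ} {s : State} (h : Rep n G s) (h5 : s.reg 5 = 0) :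
    let t := (forr 6 1 stepProg).run s
    ∃ G', Rep n G' t ∧ (HasCov G (s.reg 2) ↔ HasCov G' (t.reg 2)) ∧ t.reg 2 ≤ s.reg 2 ∧
      ((t.reg 5 = 0 ∧ ∀ v < n, Irr n G' v (t.reg 2)) ∨
        (t.reg 5 = 1 ∧ pairs n G' < pairs n G)) := by
  intro t
  have key := run_forr (x := 6) (r := 1) (s := s) (p := stepProg)
    (fun i t => ∃ G', Rep n G' t ∧ (HasCov G (s.reg 2) ↔ HasCov G' (t.reg 2)) ∧
      t.reg 2 ≤ s.reg 2 ∧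
      ((t.reg 5 = 0 ∧ G' = G ∧ t.reg 2 = s.reg 2 ∧ ∀ v < i, Irr n G v (s.reg 2)) ∨
        (t.reg 5 = 1 ∧ pairs n G' < pairs n G)))
    (fun i t v => by
      rintro ⟨G', R, h⟩
      exact ⟨G', R.of_eq (by simp) (by simp) (by simp) rfl rfl rfl, by simpa using h⟩)
    ⟨G, h, Iff.rfl, le_rfl, .inl ⟨h5, rfl, rfl, by simp⟩⟩ ?_
  · obtain ⟨G', R, e, hle, hh⟩ := key
    rw [h.reg1] at hh
    refine ⟨G', R, e, hle, hh.imp ?_ id⟩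
    rintro ⟨a, rfl, c, d⟩
    exact ⟨a, fun v hv => by rw [c]; exact d v hv⟩
  rintro i u hi hF hi' ⟨G1, R, e, hle, hh⟩
  rw [h.reg1] at hi
  obtain ⟨G2, R2, e2, hle2, hh2⟩ := run_stepProg R (by rwa [hi'])
  refine ⟨G2, R2, e.trans e2, hle2.trans hle, ?_⟩
  rcases hh with ⟨a, rfl, c, d⟩ | ⟨a, b⟩
  · rcases hh2 with ⟨a2, rfl, c2, d2⟩ | ⟨a2, b2⟩
    · refine .inl ⟨a2.trans a, rfl, c2.trans c, fun v hv => ?_⟩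
      rcases Nat.lt_succ_iff_lt_or_eq.1 hv with h' | rfl
      · exact d v h'
      · rwa [hi', c] at d2
    · exact .inr ⟨a2, b2⟩
  · rcases hh2 with ⟨a2, rfl, c2, d2⟩ | ⟨a2, b2⟩
    · exact .inr ⟨a2.trans a, b⟩
    · exact .inr ⟨a2, b2.trans b⟩

theorem pairs_le (n : ℕ) (G : SimpleGraph ℕ) : pairs n G ≤ n * n := by
  classical
  exact (Finset.card_filter_le _ _).trans (by simp)

/-- Each round with a change removes an adjacent ordered pair. There are at most `n²` of them and
`(2n + 1)²` rounds, so some round changes nothing and the later ones are skipped. -/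
theorem run_roundsProg {n : ℕ} {G : SimpleGraph ℕ} {s : State} (h : Rep n G s) :
    let t := roundsProg.run s
    ∃ G', Rep n G' t ∧ (HasCov G (s.reg 2) ↔ HasCov G' (t.reg 2)) ∧ t.reg 2 ≤ s.reg 2 ∧
      ∀ v < n, Irr n G' v (t.reg 2) := by
  intro t
  let I : ℕ → State → Prop := fun m t =>
    ∃ G', Rep n G' t ∧ (HasCov G (s.reg 2) ↔ HasCov G' (t.reg 2)) ∧ t.reg 2 ≤ s.reg 2 ∧
      ((t.reg 5 = 0 ∧ ∀ v < n, Irr n G' v (t.reg 2)) ∨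
        (t.reg 5 ≠ 0 ∧ pairs n G' + m ≤ pairs n G))
  have hI : ∀ m u x v, x ≠ 1 → x ≠ 2 → x ≠ 3 → x ≠ 4 → x ≠ 5 → I m u → I m (u.setReg x v) := by
    rintro m u x v h1 h2 h3 h4 h5 ⟨G', R, h⟩
    exact ⟨G', R.of_eq (by simp [h1.symm]) (by simp [h3.symm]) (by simp [h4.symm]) rfl rfl rfl,
      by simpa [h2.symm, h5.symm] using h⟩
  have hround : ∀ m u, I m u →
      I (m + 1) ((when (.var 5) (block [asg 5 (.lit 0), forr 6 1 stepProg])).run u) := by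
    rintro m u ⟨G1, R, e, hle, hh⟩
    simp only [when, run, block, Expr.holds_var]
    split_ifs with h5
    · have R' : Rep n G1 ((asg 5 (.lit 0)).run u) := R.of_eq (by simp [run]) (by simp [run])
        (by simp [run]) rfl rfl rfl
      obtain ⟨G2, R2, e2, hle2, hh2⟩ := run_stepLoop R' (by simp [run])
      have k2 : ((asg 5 (.lit 0)).run u).reg 2 = u.reg 2 := by simp [run]
      rw [k2] at e2 hle2
      refine ⟨G2, R2, e.trans e2, hle2.trans hle, hh2.imp id fun ⟨a, b⟩ => ⟨fun hz => ?_, ?_⟩⟩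
      · exact Nat.one_ne_zero (a.symm.trans hz)
      · have := (hh.resolve_left fun h => h5 h.1).2
        omega
    · exact ⟨G1, R, e, hle, .inl (hh.resolve_right fun h => h5 h.1)⟩
  have h0 : I 0 ((asg 5 (.lit 1)).run s) :=
    ⟨G, h.of_eq (by simp [run]) (by simp [run]) (by simp [run]) rfl rfl rfl, by simp [run],
      by simp [run], .inr (by simp [run])⟩
  have key := run_forr (x := 20) (r := 4) (s := (asg 5 (.lit 1)).run s)
    (p := forr 21 4 (when (.var 5) (block [asg 5 (.lit 0), forr 6 1 stepProg])))
    (fun i t => I (i * (n + n + 1)) t)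
    (fun i t v => hI _ _ _ _ (by decide) (by decide) (by decide) (by decide) (by decide))
    (by simpa using h0) ?_
  · obtain ⟨G', R, e, hle, hh⟩ := key
    refine ⟨G', R, e, hle, ?_⟩
    rcases hh with hh | ⟨-, hh⟩
    · exact hh.2
    · exfalso
      have := pairs_le n G
      have e4 : ((asg 5 (.lit 1)).run s).reg 4 = n + n + 1 := by simp [run, h.reg4]
      rw [e4] at hh
      nlinarith
  intro i u hi hF hi' hIu
  have hu4 : u.reg 4 = n + n + 1 := by
    obtain ⟨G', R, -⟩ := hIu
    exact R.reg4
  have key2 := run_forr (x := 21) (r := 4) (s := u)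
    (p := when (.var 5) (block [asg 5 (.lit 0), forr 6 1 stepProg]))
    (fun j t => I (i * (n + n + 1) + j) t)
    (fun i t v => hI _ _ _ _ (by decide) (by decide) (by decide) (by decide) (by decide)) hIu
    fun j w hj hF' hj' hIw => hround _ w hIw
  rw [hu4] at key2
  rw [Nat.succ_mul]
  exact key2

/-! #### The edges on paths, and the size test -/

/-- The test that four vertices form a path. -/
def p4E (a b c d : Expr) : Expr :=
  .and (adjE a b) (.and (adjE b c) (.and (adjE c d)
    (.and (.not (.eq a c)) (.and (.not (.eq a d)) (.not (.eq b d))))))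

/-- The entry of the reduced adjacency matrix. -/
def coreE (i j : Expr) : Expr := .get 6 (.add (.get 1 i) j)

/-- The test that `c` and `d` witness that `ab` lies on a path. -/
def witnessE : Expr :=
  .add (p4E (.var 7) (.var 8) (.var 22) (.var 23)) (.add
    (p4E (.var 8) (.var 7) (.var 22) (.var 23)) (p4E (.var 22) (.var 7) (.var 8) (.var 23)))

/-- Decide whether an edge lies on a path on four vertices. -/
def inP4Prog : FP :=
  block [asg 11 (.lit 0), forr 22 1 (forr 23 1 (when witnessE (asg 11 (.lit 1))))]

/-- Compute the matrix of the edges on paths in array `6`. -/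
def coreProg : FP :=
  forr 7 1 (forr 8 1 (block [inP4Prog, sto 6 (.add (.get 1 (.var 7)) (.var 8)) (.var 11)]))

theorem Rep.holds_p4E {n : ℕ} {G : SimpleGraph ℕ} {s : State} (h : Rep n G s) {a b c d : Expr}
    (ha : a.eval s < n) (hb : b.eval s < n) (hc : c.eval s < n) (hd : d.eval s < n) :
    (p4E a b c d).Holds s ↔ P4 G (a.eval s) (b.eval s) (c.eval s) (d.eval s) := by
  simp only [p4E, Expr.holds_and, Expr.holds_not, Expr.holds_eq, h.holds_adjE ha hb,
    h.holds_adjE hb hc, h.holds_adjE hc hd, P4, ne_eq]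

open Classical in
theorem run_inP4Prog {n : ℕ} {G : SimpleGraph ℕ} {s : State} (h : Rep n G s)
    (ha : s.reg 7 < n) (hb : s.reg 8 < n) :
    (inP4Prog.run s).reg 11 = if InP4 G (s.reg 7) (s.reg 8) then 1 else 0 := by
  set a := s.reg 7 with ha'
  set b := s.reg 8 with hb'
  let W : ℕ → ℕ → Prop := fun c d => P4 G a b c d ∨ P4 G b a c d ∨ P4 G c a b d
  set s1 := (asg 11 (.lit 0)).run s with hs1
  have R1 : Rep n G s1 := h.of_eq (by simp [hs1, run]) (by simp [hs1, run]) (by simp [hs1, run])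
    rfl rfl rfl
  have key := run_forr (x := 22) (r := 1) (s := s1)
    (p := forr 23 1 (when witnessE (asg 11 (.lit 1))))
    (fun i t => t.reg 11 = if ∃ c < i, ∃ d < n, W c d then 1 else 0)
    (fun i t v h => by simpa using h) (by simp [hs1, run]) ?_
  · rw [R1.reg1] at key
    change (inP4Prog.run s).reg 11 = _ at key
    rw [key]
    congr 1
    refine propext ⟨fun ⟨c, _, d, _, hw⟩ => ⟨c, d, hw⟩, fun ⟨c, d, hw⟩ => ?_⟩
    refine ⟨c, ?_, d, ?_, hw⟩
    · rcases hw with hw | hw | hw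
      exacts [h.lt _ _ hw.2.2.1, h.lt _ _ hw.2.2.1, h.lt _ _ hw.1]
    · rcases hw with hw | hw | hw
      exacts [h.lt' _ _ hw.2.2.1, h.lt' _ _ hw.2.2.1, h.lt' _ _ hw.2.2.1]
  intro i u hi hF hi' hu
  rw [R1.reg1] at hi
  have Ru : Rep n G u := R1.frame hF (by decide) (by decide)
  have u7 : u.reg 7 = a := (hF.reg 7 (by decide)).trans (by simp [hs1, run, ha'])
  have u8 : u.reg 8 = b := (hF.reg 8 (by decide)).trans (by simp [hs1, run, hb'])
  have key2 := run_forr (x := 23) (r := 1) (s := u) (p := when witnessE (asg 11 (.lit 1)))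
    (fun j t => t.reg 11 = if (∃ c < i, ∃ d < n, W c d) ∨ ∃ d < j, W i d then 1 else 0)
    (fun i t v h => by simpa using h) (by simpa using hu) ?_
  · rw [Ru.reg1] at key2
    rw [key2]
    simp only [Nat.lt_succ_iff_lt_or_eq, or_and_right, exists_or, exists_eq_left]
  intro j w hj hF' hj' hw
  rw [Ru.reg1] at hj
  have Rw : Rep n G w := Ru.frame hF' (by decide) (by decide)
  have w7 : w.reg 7 = a := (hF'.reg 7 (by decide)).trans u7
  have w8 : w.reg 8 = b := (hF'.reg 8 (by decide)).trans u8
  have w22 : w.reg 22 = i := (hF'.reg 22 (by decide)).trans hi'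
  have hcond : witnessE.Holds w ↔ W i j := by
    rw [witnessE, Expr.holds_or, Expr.holds_or,
      Rw.holds_p4E (by simpa [w7]) (by simpa [w8]) (by simpa [w22]) (by simpa [hj']),
      Rw.holds_p4E (by simpa [w8]) (by simpa [w7]) (by simpa [w22]) (by simpa [hj']),
      Rw.holds_p4E (by simpa [w22]) (by simpa [w7]) (by simpa [w8]) (by simpa [hj'])]
    simp only [Expr.eval, w7, w8, w22, hj', W]
  simp only [when, run, hcond, Nat.lt_succ_iff_lt_or_eq, or_and_right, exists_or, exists_eq_left]
  by_cases hWij : W i j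
  · simp [hWij]
  · simp [hWij, hw]

open Classical in
theorem run_coreProg {n : ℕ} {G : SimpleGraph ℕ} {s : State} (h : Rep n G s) :
    ∀ i < n, ∀ j < n, (coreProg.run s).arr 6 (2 + i * n + j) = if InP4 G i j then 1 else 0 := by
  have key := run_forr (x := 7) (r := 1) (s := s)
    (p := forr 8 1 (block [inP4Prog, sto 6 (.add (.get 1 (.var 7)) (.var 8)) (.var 11)]))
    (fun m t => ∀ i < m, ∀ j < n, t.arr 6 (2 + i * n + j) = if InP4 G i j then 1 else 0)
    (fun i t v h => by simpa using h) (by simp) ?_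
  · rw [h.reg1] at key; exact key
  intro a u ha hF ha' hu
  rw [h.reg1] at ha
  have Ru : Rep n G u := h.frame hF (by decide) (by decide)
  have key2 := run_forr (x := 8) (r := 1) (s := u)
    (p := block [inP4Prog, sto 6 (.add (.get 1 (.var 7)) (.var 8)) (.var 11)])
    (fun m t => ∀ i < n, ∀ j < n, (i < a ∨ (i = a ∧ j < m)) →
      t.arr 6 (2 + i * n + j) = if InP4 G i j then 1 else 0)
    (fun i t v h => by simpa using h)
    (fun i hi j hj hh => hu i (by omega) j hj) ?_
  · rw [Ru.reg1] at key2
    intro i hi j hj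
    exact key2 i (by omega) j hj (by omega)
  intro b w hb hF' hb' hw i hi j hj hh
  rw [Ru.reg1] at hb
  have Rw : Rep n G w := Ru.frame hF' (by decide) (by decide)
  have w7 : w.reg 7 = a := (hF'.reg 7 (by decide)).trans ha'
  have hP := run_inP4Prog Rw (by rwa [w7]) (by rwa [hb'])
  have F3 : Frame inP4Prog.wr inP4Prog.wrA w (inP4Prog.run w) := frame _ _
  have e1 : (inP4Prog.run w).arr 1 = w.arr 1 := F3.arr 1 (by decide)
  have e6 : (inP4Prog.run w).arr 6 = w.arr 6 := F3.arr 6 (by decide)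
  have e7 : (inP4Prog.run w).reg 7 = a := (F3.reg 7 (by decide)).trans w7
  have e8 : (inP4Prog.run w).reg 8 = b := (F3.reg 8 (by decide)).trans hb'
  rw [w7, hb'] at hP
  simp only [block, run, Expr.eval, State.setArr_arr, if_true, Function.update_apply, e1, e6, e7,
    e8, Rw.row a ha, index_inj hj hb, hP]
  by_cases hij : i = a ∧ j = b
  · rw [if_pos hij, hij.1, hij.2]
  · rw [if_neg hij]
    exact hw i hi j hj (by omega)

/-! ### Edge count, edge limit and the remaining vertices -/

/-- Count the edges of the reduced graph. -/
def edgeProg : FP :=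
  block [asg 24 (.lit 0), forr 7 1 (block [
    countLoop 8 1 10 (.and (.lt (.var 7) (.var 8)) (coreE (.var 7) (.var 8))),
    asg 24 (.add (.var 24) (.var 10))])]

/-- Compute the largest admissible number of edges. -/
def limitProg : FP :=
  block [asg 25 (.lit 0),
    forr 7 1 (when (.lt (.var 7) (.sub (.var 2) (.lit 1)))
      (asg 25 (.add (.var 25) (.sub (.var 2) (.lit 1))))),
    asg 25 (.add (.var 25) (.sub (.var 2) (.lit 1))),
    asg 25 (.add (.var 25) (.var 25)), asg 25 (.add (.var 25) (.var 25)),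
    asg 25 (.add (.var 25) (.var 25)), asg 25 (.add (.var 25) (.var 25)),
    asg 25 (.add (.var 25) (.var 25)), asg 25 (.add (.var 25) (.var 25))]

/-- List the vertices that are not isolated in array `7`. -/
def vertexProg : FP :=
  block [asg 26 (.lit 0), forr 7 1 (block [anyLoop 8 1 11 (coreE (.var 7) (.var 8)),
    when (.var 11) (block [sto 7 (.var 26) (.var 7), asg 26 (.add (.var 26) (.lit 1))])])]

/-- Array `6` holds the adjacency matrix of `H`. -/
structure Mat (n : ℕ) (H : SimpleGraph ℕ) (s : State) : Prop where
  reg1 : s.reg 1 = n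
  row : ∀ i < n, s.arr 1 i = 2 + i * n
  adj : ∀ i < n, ∀ j < n, (H.Adj i j → s.arr 6 (2 + i * n + j) = 1) ∧
    (¬ H.Adj i j → s.arr 6 (2 + i * n + j) = 0)
  lt : ∀ a b, H.Adj a b → a < n

theorem Mat.frame {n : ℕ} {H : SimpleGraph ℕ} {s t : State} (h : Mat n H s) {W A : List ℕ}
    (hF : Frame W A s t) (hW : 1 ∉ W) (hA : 1 ∉ A) (hA' : 6 ∉ A) : Mat n H t :=
  ⟨(hF.reg 1 hW).trans h.reg1, by rw [hF.arr 1 hA]; exact h.row,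
    by rw [hF.arr 6 hA']; exact h.adj, h.lt⟩

theorem Mat.holds_coreE {n : ℕ} {H : SimpleGraph ℕ} {s : State} (h : Mat n H s) {i j : Expr}
    (hi : i.eval s < n) (hj : j.eval s < n) :
    (coreE i j).Holds s ↔ H.Adj (i.eval s) (j.eval s) := by
  simp only [coreE, Expr.holds_get, Expr.eval, h.row _ hi]
  have := h.adj _ hi _ hj
  by_cases hA : H.Adj (i.eval s) (j.eval s)
  · simp [hA, this.1 hA]
  · simp [hA, this.2 hA]

theorem edgeSet_finite {n : ℕ} {H : SimpleGraph ℕ} (hlt : ∀ a b, H.Adj a b → a < n) :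
    H.edgeSet.Finite := by
  refine ((Finset.range n ×ˢ Finset.range n).image fun p => s(p.1, p.2)).finite_toSet.subset ?_
  intro e he
  induction e using Sym2.ind with
  | _ a b =>
    exact Finset.mem_coe.2 (Finset.mem_image.2 ⟨(a, b), Finset.mk_mem_product
      (Finset.mem_range.2 (hlt a b he)) (Finset.mem_range.2 (hlt b a he.symm)), rfl⟩)

open Classical in
theorem ncard_edgeSet {n : ℕ} {H : SimpleGraph ℕ} (hlt : ∀ a b, H.Adj a b → a < n) :
    H.edgeSet.ncard =
      ∑ i ∈ Finset.range n, ((Finset.range n).filter fun j => i < j ∧ H.Adj i j).card := by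
  set F := (Finset.range n ×ˢ Finset.range n).filter fun p => p.1 < p.2 ∧ H.Adj p.1 p.2 with hF
  have h1 : H.edgeSet = ↑(F.image fun p => s(p.1, p.2)) := by
    ext e
    induction e using Sym2.ind with
    | _ a b =>
      simp only [SimpleGraph.mem_edgeSet, Finset.coe_image, Set.mem_image, Finset.mem_coe, hF,
        Finset.mem_filter, Finset.mem_product, Finset.mem_range, Prod.exists]
      constructor
      · intro hab
        have ha := hlt a b hab
        have hb := hlt b a hab.symm
        rcases Nat.lt_or_gt_of_ne hab.ne with h | h
        · exact ⟨a, b, ⟨⟨ha, hb⟩, h, hab⟩, rfl⟩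
        · exact ⟨b, a, ⟨⟨hb, ha⟩, h, hab.symm⟩, Sym2.eq_swap⟩
      · rintro ⟨c, d, ⟨-, -, h⟩, e⟩
        rw [← SimpleGraph.mem_edgeSet, ← e]
        exact h
  have h2 : Set.InjOn (fun p : ℕ × ℕ => s(p.1, p.2)) F := by
    rintro ⟨a, b⟩ hp ⟨c, d⟩ hq e
    simp only [hF, Finset.mem_coe, Finset.mem_filter] at hp hq
    rcases Sym2.eq_iff.1 e with ⟨rfl, rfl⟩ | ⟨rfl, rfl⟩
    · rfl
    · exact absurd hp.2.1 (by have := hq.2.1; simp only at this ⊢; omega)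
  rw [h1, Set.ncard_coe_finset, Finset.card_image_of_injOn h2, hF, Finset.card_filter,
    Finset.sum_product]
  simp only [Finset.card_filter]

theorem run_edgeProg {n : ℕ} {H : SimpleGraph ℕ} {s : State} (h : Mat n H s) :
    (edgeProg.run s).reg 24 = H.edgeSet.ncard := by
  classical
  set s1 := (asg 24 (.lit 0)).run s with hs1
  have M1 : Mat n H s1 := ⟨by simp [hs1, run, h.reg1], h.row, h.adj, h.lt⟩
  have key := run_forr (x := 7) (r := 1) (s := s1) (p := block [
    countLoop 8 1 10 (.and (.lt (.var 7) (.var 8)) (coreE (.var 7) (.var 8))),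
    asg 24 (.add (.var 24) (.var 10))])
    (fun m t => t.reg 24 =
      ∑ i ∈ Finset.range m, ((Finset.range n).filter fun j => i < j ∧ H.Adj i j).card)
    (fun i t v h => by simpa using h) (by simp [hs1, run]) ?_
  · rw [M1.reg1, ← ncard_edgeSet h.lt] at key
    exact key
  intro i u hi hF hi' hu
  rw [M1.reg1] at hi
  have Mu : Mat n H u := M1.frame hF (by decide) (by decide) (by decide)
  have hcount := run_countLoop (x := 8) (r := 1) (k := 10) (s := u)
    (c := .and (.lt (.var 7) (.var 8)) (coreE (.var 7) (.var 8)))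
    (fun j => i < j ∧ H.Adj i j) (by decide) (by decide) (fun j w hj hF' hj' => by
      rw [Mu.reg1] at hj
      have Mw : Mat n H w := Mu.frame hF' (by decide) (by decide) (by decide)
      have e : w.reg 7 = i := (hF'.reg 7 (by decide)).trans hi'
      rw [Expr.holds_and, Expr.holds_lt, Mw.holds_coreE (by simpa [e]) (by simpa [hj'])]
      simp [e, hj'])
  have e24 : ((countLoop 8 1 10 (.and (.lt (.var 7) (.var 8)) (coreE (.var 7) (.var 8)))).run
      u).reg 24 = u.reg 24 := run_reg _ _ _ (by decide)
  simp only [block, run, Expr.eval, State.setReg_reg, if_true, hcount, e24, hu, Mu.reg1]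
  rw [Finset.sum_range_succ]
  congr!

/-- The square comes from repeated addition in a loop of length `n`, since `k` is given in binary
and a loop of length `k` need not be polynomial; hence the minimum with `n`. Six doublings give the
factor `64`. -/
theorem run_limitProg {s : State} :
    (limitProg.run s).reg 25 =
      64 * (min (s.reg 1) (s.reg 2 - 1) * (s.reg 2 - 1) + (s.reg 2 - 1)) := by
  set s1 := (asg 25 (.lit 0)).run s with hs1
  have key := run_forr (x := 7) (r := 1) (s := s1)
    (p := when (.lt (.var 7) (.sub (.var 2) (.lit 1)))
      (asg 25 (.add (.var 25) (.sub (.var 2) (.lit 1)))))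
    (fun m t => t.reg 25 = min m (s.reg 2 - 1) * (s.reg 2 - 1))
    (fun i t v h => by simpa using h) (by simp [hs1, run]) ?_
  · set s2 := (forr 7 1 (when (.lt (.var 7) (.sub (.var 2) (.lit 1)))
      (asg 25 (.add (.var 25) (.sub (.var 2) (.lit 1)))))).run s1 with hs2
    have e2 : s2.reg 2 = s.reg 2 := by
      rw [hs2, run_reg _ _ _ (by decide)]; simp [hs1, run]
    have e1 : s1.reg 1 = s.reg 1 := by simp [hs1, run]
    rw [e1] at key
    have : limitProg.run s = (block [asg 25 (.add (.var 25) (.sub (.var 2) (.lit 1))),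
      asg 25 (.add (.var 25) (.var 25)), asg 25 (.add (.var 25) (.var 25)),
      asg 25 (.add (.var 25) (.var 25)), asg 25 (.add (.var 25) (.var 25)),
      asg 25 (.add (.var 25) (.var 25)), asg 25 (.add (.var 25) (.var 25))]).run s2 := rfl
    rw [this]
    simp only [block, run, Expr.eval, State.setReg_reg, if_true, key, e2]
    ring
  intro i u hi hF hi' hu
  have e2 : u.reg 2 = s.reg 2 := (hF.reg 2 (by decide)).trans (by simp [hs1, run])
  simp only [when, run, Expr.holds_lt, Expr.eval, hi', e2]
  split_ifs with hc
  · simp only [State.setReg_reg, if_true, hu, min_eq_left hc.le, min_eq_left (Nat.succ_le_of_lt hc),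
      Nat.succ_mul]
  · rw [hu, min_eq_right (by omega), min_eq_right (by omega)]

theorem run_vertexProg {n : ℕ} {H : SimpleGraph ℕ} {s : State} (h : Mat n H s) :
    let t := vertexProg.run s
    t.reg 26 ≤ n ∧ (∀ p < t.reg 26, t.arr 7 p < n ∧ ∃ b, H.Adj (t.arr 7 p) b) ∧
      (∀ p < t.reg 26, ∀ q < t.reg 26, t.arr 7 p = t.arr 7 q → p = q) ∧
      ∀ a b, H.Adj a b → ∃ p < t.reg 26, t.arr 7 p = a := by
  intro t
  set s1 := (asg 26 (.lit 0)).run s with hs1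
  have M1 : Mat n H s1 := ⟨by simp [hs1, run, h.reg1], h.row, h.adj, h.lt⟩
  have key := run_forr (x := 7) (r := 1) (s := s1) (p := block [
    anyLoop 8 1 11 (coreE (.var 7) (.var 8)),
    when (.var 11) (block [sto 7 (.var 26) (.var 7), asg 26 (.add (.var 26) (.lit 1))])])
    (fun i t => t.reg 26 ≤ i ∧ (∀ p < t.reg 26, t.arr 7 p < i ∧ ∃ b, H.Adj (t.arr 7 p) b) ∧
      (∀ p < t.reg 26, ∀ q < t.reg 26, t.arr 7 p = t.arr 7 q → p = q) ∧
      ∀ a < i, ∀ b, H.Adj a b → ∃ p < t.reg 26, t.arr 7 p = a)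
    (fun i t v h => by simpa using h) (by simp [hs1, run]) ?_
  · rw [M1.reg1] at key
    exact ⟨key.1, key.2.1, key.2.2.1, fun a b hab => key.2.2.2 a (h.lt a b hab) b hab⟩
  rintro i u hi hF hi' ⟨k1, k2, k3, k4⟩
  rw [M1.reg1] at hi
  have Mu : Mat n H u := M1.frame hF (by decide) (by decide) (by decide)
  have hany := run_anyLoop (x := 8) (r := 1) (f := 11) (s := u) (c := coreE (.var 7) (.var 8))
    (fun j => H.Adj i j) (by decide) (by decide) (fun j w hj hF' hj' => by
      rw [Mu.reg1] at hj
      have Mw : Mat n H w := Mu.frame hF' (by decide) (by decide) (by decide)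
      have e : w.reg 7 = i := (hF'.reg 7 (by decide)).trans hi'
      rw [Mw.holds_coreE (by simpa [e]) (by simpa [hj'])]
      simp [e, hj'])
  set w := (anyLoop 8 1 11 (coreE (.var 7) (.var 8))).run u with hw
  have F2 : Frame _ _ u w := frame _ _
  have w26 : w.reg 26 = u.reg 26 := F2.reg 26 (by decide)
  have w7 : w.reg 7 = i := (F2.reg 7 (by decide)).trans hi'
  have wa7 : w.arr 7 = u.arr 7 := F2.arr 7 (by decide)
  have hiff : w.reg 11 ≠ 0 ↔ ∃ b, H.Adj i b := by
    rw [hany, Mu.reg1]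
    have : (∃ j < n, H.Adj i j) ↔ ∃ b, H.Adj i b :=
      ⟨fun ⟨j, _, h⟩ => ⟨j, h⟩, fun ⟨b, hb⟩ => ⟨b, h.lt b i hb.symm, hb⟩⟩
    rw [← this]
    split_ifs with hx
    · exact ⟨fun _ => hx, fun _ => one_ne_zero⟩
    · exact ⟨fun h => absurd rfl h, fun h => absurd h hx⟩
  simp only [block, when, run, Expr.holds_var, ← hw]
  split_ifs with hc
  · rw [hiff] at hc
    simp only [Expr.eval, State.setReg_reg, State.setReg_arr, State.setArr_reg, State.setArr_arr,
      if_true, w26, w7, wa7]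
    have hval : ∀ p, p < u.reg 26 + 1 → (p < u.reg 26 ∧
        Function.update (u.arr 7) (u.reg 26) i p = u.arr 7 p) ∨ (p = u.reg 26 ∧
        Function.update (u.arr 7) (u.reg 26) i p = i) := by
      intro p hp
      rcases Nat.lt_succ_iff_lt_or_eq.1 hp with h' | rfl
      · exact .inl ⟨h', Function.update_of_ne h'.ne _ _⟩
      · exact .inr ⟨rfl, Function.update_self ..⟩
    refine ⟨by omega, fun p hp => ?_, fun p hp q hq e => ?_, fun a ha b hab => ?_⟩
    · rcases hval p hp with ⟨p1, p2⟩ | ⟨p1, p2⟩ <;> rw [p2]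
      · have := k2 p p1
        exact ⟨by omega, this.2⟩
      · exact ⟨by omega, hc⟩
    · rcases hval p hp with ⟨p1, p2⟩ | ⟨p1, p2⟩ <;> rcases hval q hq with ⟨q1, q2⟩ | ⟨q1, q2⟩ <;>
        rw [p2, q2] at e
      · exact k3 p p1 q q1 e
      · have := (k2 p p1).1
        omega
      · have := (k2 q q1).1
        omega
      · omega
    · rcases Nat.lt_succ_iff_lt_or_eq.1 ha with h' | rfl
      · obtain ⟨p, hp, e⟩ := k4 a h' b hab
        exact ⟨p, by omega, by rw [Function.update_of_ne hp.ne]; exact e⟩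
      · exact ⟨u.reg 26, by omega, Function.update_self ..⟩
  · rw [hiff] at hc
    rw [w26, wa7]
    refine ⟨by omega, fun p hp => ⟨by have := (k2 p hp).1; omega, (k2 p hp).2⟩, k3,
      fun a ha b hab => ?_⟩
    rcases Nat.lt_succ_iff_lt_or_eq.1 ha with h' | rfl
    · exact k4 a h' b hab
    · exact absurd ⟨b, hab⟩ hc

/-- The number of edges of the reduced graph of a yes-instance. -/
theorem ncard_core_le {n K : ℕ} {G : SimpleGraph ℕ} (hlt : ∀ a b, G.Adj a b → a < n)
    (hirr : ∀ v < n, Irr n G v K) (hcov : HasCov G K) :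
    (core G).edgeSet.ncard ≤ 64 * (min n (K - 1) * (K - 1) + (K - 1)) := by
  classical
  have hlt' : ∀ a b, (core G).Adj a b → a < n := fun a b h => hlt a b (InP4.adj h)
  obtain ⟨S, hS, hc⟩ := hcov
  have hfin := edgeSet_finite hlt'
  have hnb : ∀ v w, w ∈ (Finset.range n).filter (fun l => G.Adj v l) ↔ G.Adj v w := fun v w => by
    simp only [Finset.mem_filter, Finset.mem_range, and_iff_right_iff_imp]
    exact fun h => hlt w v h.symm
  have h1 : hfin.toFinset.card ≤ 7 * (S.card * (6 * (K - 1) + 2)) := by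
    refine card_core_le hc _ hnb _ ?_ ?_ _ ?_
    · intro v hv
      -- A cover in `ℕ` may contain numbers from `n` on; they have degree zero.
      by_cases hvn : v < n
      · exact (hirr v hvn).1
      · rw [Finset.filter_false_of_mem fun w _ hw => hvn (hlt v w hw)]
        simp
    · intro v p q hp hq
      exact (hirr v (hlt v p hp.1)).2 p q hp hq
    · intro a b hab
      exact (Set.Finite.mem_toFinset hfin).1 hab
  rw [Set.ncard_eq_toFinset_card _ hfin]
  obtain ⟨k, rfl⟩ : ∃ k, K = k + 1 := ⟨K - 1, by omega⟩
  simp only [Nat.add_sub_cancel] at h1 ⊢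
  -- For `k ≤ n` use `7k(6k + 2) = 42k² + 14k`. For `n ≤ k` the trivial bound `n² ≤ nk` is enough,
  -- so capping the loop at `n` loses nothing.
  rcases le_total k n with hkn | hkn
  · rw [min_eq_right hkn]
    have h2 : S.card ≤ k := by omega
    have h3 := Nat.mul_le_mul_right (6 * k + 2) h2
    nlinarith
  · rw [min_eq_left hkn, ← Set.ncard_eq_toFinset_card _ hfin, ncard_edgeSet hlt']
    have : ∑ i ∈ Finset.range n,
        ((Finset.range n).filter fun j => i < j ∧ (core G).Adj i j).card ≤ n * n := by
      refine (Finset.sum_le_card_nsmul _ _ n fun i _ => ?_).trans (by simp)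
      exact (Finset.card_filter_le _ _).trans (by simp)
    have := Nat.mul_le_mul_left n hkn
    omega

/-! ### The kernelization -/

/-- The graph of an instance, as a graph on the natural numbers. -/
def natGraph (I : Inst) : SimpleGraph ℕ where
  Adj a b := ∃ (ha : a < I.n) (hb : b < I.n), I.graph.Adj ⟨a, ha⟩ ⟨b, hb⟩
  symm := ⟨fun _ _ ⟨ha, hb, h⟩ => ⟨hb, ha, h.symm⟩⟩
  loopless := ⟨fun _ ⟨_, _, h⟩ => h.ne rfl⟩

theorem isYes_iff_natGraph (I : Inst) : I.IsYes 4 ↔ HasCov (natGraph I) (I.k + 1) :=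
  isYes_iff I _ Fin.val Fin.val_injective
    (fun p q => ⟨fun h => ⟨p.2, q.2, h⟩, fun ⟨_, _, h⟩ => h⟩) fun a _ ⟨ha, _⟩ => ⟨⟨a, ha⟩, rfl⟩

theorem length_encode (I : Inst) : I.encode.length = 2 + I.n * I.n := by
  simp [Inst.encode]; ring

open Classical in
theorem encode_getD (I : Inst) (p q : Fin I.n) :
    I.encode.getD (2 + p * I.n + q) 0 = if I.graph.Adj p q then 1 else 0 := by
  have hq := q.2
  have hlt : (p : ℕ) * I.n + q < I.n * I.n := by
    have := Nat.mul_le_mul_right I.n (Nat.succ_le_of_lt p.2)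
    rw [Nat.succ_mul] at this
    omega
  have e : 2 + (p : ℕ) * I.n + q = (p * I.n + q) + 1 + 1 := by ring
  rw [e, Inst.encode, List.getD_cons_succ, List.getD_cons_succ,
    List.getD_eq_getElem _ _ (by simpa using hlt), List.getElem_ofFn]
  have h1 : (Fin.divNat (⟨p * I.n + q, hlt⟩ : Fin (I.n * I.n))) = p := by
    ext
    simp only [Fin.divNat]
    rw [Nat.mul_comm, Nat.mul_add_div (by omega), Nat.div_eq_of_lt hq, add_zero]
  have h2 : (Fin.modNat (⟨p * I.n + q, hlt⟩ : Fin (I.n * I.n))) = q := by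
    ext
    simp only [Fin.modNat]
    rw [Nat.mul_comm, Nat.mul_add_mod, Nat.mod_eq_of_lt hq]
  rw [h1, h2]

open Classical in
theorem output_eq_encode (I : Inst) (s : State) (h : s.reg 0 = 2 + I.n * I.n)
    (h0 : s.arr 0 0 = I.n) (h1 : s.arr 0 1 = I.k)
    (hadj : ∀ p q : Fin I.n, s.arr 0 (2 + p * I.n + q) = if I.graph.Adj p q then 1 else 0) :
    output s = I.encode := by
  refine List.ext_getElem (by simp [output, length_encode, h]) fun i hi hi' => ?_
  rw [← List.getD_eq_getElem (d := 0) I.encode hi']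
  simp only [output, List.getElem_map, List.getElem_range]
  match i with
  | 0 => simpa [Inst.encode] using h0
  | 1 => simpa [Inst.encode] using h1
  | x + 2 =>
    rw [length_encode] at hi'
    have hx : x < I.n * I.n := by omega
    have hn : 0 < I.n := Nat.pos_of_mul_pos_right (Nat.zero_lt_of_lt hx)
    have hp : x / I.n < I.n := Nat.div_lt_of_lt_mul hx
    have hq : x % I.n < I.n := Nat.mod_lt _ hn
    have e : x + 2 = 2 + (x / I.n) * I.n + x % I.n := by
      have := Nat.div_add_mod x I.n
      rw [Nat.mul_comm] at this
      omega
    rw [e]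
    exact (hadj ⟨_, hp⟩ ⟨_, hq⟩).trans (encode_getD I ⟨_, hp⟩ ⟨_, hq⟩).symm

/-! ### Input, output and the rejected instance -/

/-- Read the sizes. -/
def readProg : FP :=
  block [asg 1 (.get 0 (.lit 0)), asg 2 (.add (.get 0 (.lit 1)) (.lit 1)),
    asg 3 (.add (.var 1) (.var 1)), asg 4 (.add (.var 3) (.lit 1)), asg 29 (.lit 2)]

/-- Prepare the offsets of the rows and the vertices of the slots. -/
def tableProg : FP :=
  block [forr 7 1 (block [sto 1 (.var 7) (.var 29), asg 29 (.add (.var 29) (.var 1))]),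
    forr 7 1 (block [sto 2 (.var 7) (.var 7), sto 2 (.add (.var 1) (.var 7)) (.var 7)])]

/-- The reduction, without input and output. -/
def reduceProg : FP :=
  block [tableProg, roundsProg, coreProg, edgeProg, limitProg, vertexProg]

/-- Write the reduced instance. -/
def writeProg : FP :=
  block [asg 29 (.lit 2), forr 27 26 (forr 28 26 (block [
    sto 0 (.var 29) (coreE (.get 7 (.var 27)) (.get 7 (.var 28))),
    asg 29 (.add (.var 29) (.lit 1))])),
    sto 0 (.lit 0) (.var 26), sto 0 (.lit 1) (.sub (.var 2) (.lit 1)), asg 0 (.var 29)]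

/-- Write the path on four vertices with parameter `0`. -/
def rejectProg : FP :=
  block [asg 29 (.lit 4), forr 27 29 (forr 28 29 (sto 0
    (.add (.lit 2) (.add (.add (.add (.var 27) (.var 27)) (.add (.var 27) (.var 27))) (.var 28)))
    (.add (.eq (.add (.var 27) (.lit 1)) (.var 28)) (.eq (.add (.var 28) (.lit 1)) (.var 27))))),
    sto 0 (.lit 0) (.lit 4), sto 0 (.lit 1) (.lit 0), asg 0 (.lit 18)]

/-- The test for rejection. -/
def rejectE : Expr := .add (.not (.var 2)) (.lt (.var 25) (.var 24))

/-- The path on four vertices with parameter `0`. -/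
def noInst : Inst := ⟨4, SimpleGraph.pathGraph 4, 0⟩

theorem not_isYes_noInst : ¬ noInst.IsYes 4 := by
  rintro ⟨S, hS, hc⟩
  obtain rfl : S = ∅ := Finset.card_eq_zero.1 (Nat.le_zero.1 hS)
  rw [isPathVertexCover_iff] at hc
  have := hc (0 : Fin 4) (1 : Fin 4) (2 : Fin 4) (3 : Fin 4) (by
    simp only [P4, noInst, SimpleGraph.pathGraph_adj]
    decide)
  rcases this with h | h | h | h <;> exact absurd h (Finset.notMem_empty _)

theorem numEdges_noInst : noInst.numEdges ≤ 3 := by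
  have h : (SimpleGraph.pathGraph 4).edgeSet ⊆
      (({s(0, 1), s(1, 2), s(2, 3)} : Finset (Sym2 (Fin 4))) : Set (Sym2 (Fin 4))) := by
    intro e he
    induction e using Sym2.ind with
    | _ a b =>
      rw [SimpleGraph.mem_edgeSet, SimpleGraph.pathGraph_adj] at he
      revert he
      revert a b
      simp only [Finset.mem_coe]
      decide
  have h' : (SimpleGraph.pathGraph 4).edgeSet.ncard ≤ 3 := by
    refine (Set.ncard_le_ncard h (Finset.finite_toSet _)).trans ?_
    rw [Set.ncard_coe_finset]
    exact Finset.card_le_three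
  exact h'

theorem output_rejectProg (s : State) : output (rejectProg.run s) = noInst.encode := by
  set s1 := (asg 29 (.lit 4)).run s with hs1
  have e29 : s1.reg 29 = 4 := by simp [hs1, run]
  have key := run_forr (x := 27) (r := 29) (s := s1) (p := forr 28 29 (sto 0
    (.add (.lit 2) (.add (.add (.add (.var 27) (.var 27)) (.add (.var 27) (.var 27))) (.var 28)))
    (.add (.eq (.add (.var 27) (.lit 1)) (.var 28)) (.eq (.add (.var 28) (.lit 1)) (.var 27)))))
    (fun m t => ∀ p < m, ∀ q < 4, t.arr 0 (2 + p * 4 + q) = if p + 1 = q ∨ q + 1 = p then 1 else 0)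
    (fun i t v h => by simpa using h) (by simp) ?_
  · rw [e29] at key
    have hrun : rejectProg.run s = (block [sto 0 (.lit 0) (.lit 4), sto 0 (.lit 1) (.lit 0),
      asg 0 (.lit 18)]).run ((forr 27 29 (forr 28 29 (sto 0
        (.add (.lit 2) (.add (.add (.add (.var 27) (.var 27)) (.add (.var 27) (.var 27)))
          (.var 28)))
        (.add (.eq (.add (.var 27) (.lit 1)) (.var 28))
          (.eq (.add (.var 28) (.lit 1)) (.var 27)))))).run s1) := rfl
    rw [hrun]
    refine output_eq_encode _ _ (by simp [block, run, noInst]) (by simp [block, run, noInst])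
      (by simp [block, run, noInst]) fun p q => ?_
    have hp := p.2
    have hq := q.2
    have := key p hp q hq
    have h0 : 2 + (p : ℕ) * 4 + q ≠ 0 := by omega
    have h1 : 2 + (p : ℕ) * 4 + q ≠ 1 := by omega
    have hadj : noInst.graph.Adj p q ↔ ((p : ℕ) + 1 = q ∨ (q : ℕ) + 1 = p) :=
      SimpleGraph.pathGraph_adj
    simp only [hadj]
    rw [← this]
    simp only [block, run, Expr.eval, State.setReg_arr, State.setArr_arr, if_true,
      Function.update_apply]
    change (if 2 + (p : ℕ) * 4 + q = 1 then _ else if 2 + (p : ℕ) * 4 + q = 0 then _ else _) = _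
    rw [if_neg h1, if_neg h0]
    rfl
  intro i u hi hF hi' hu
  have u29 : u.reg 29 = 4 := (hF.reg 29 (by decide)).trans e29
  have key2 := run_forr (x := 28) (r := 29) (s := u) (p := sto 0
    (.add (.lit 2) (.add (.add (.add (.var 27) (.var 27)) (.add (.var 27) (.var 27))) (.var 28)))
    (.add (.eq (.add (.var 27) (.lit 1)) (.var 28)) (.eq (.add (.var 28) (.lit 1)) (.var 27))))
    (fun m t => ∀ p, ∀ q < 4, (p < i ∨ p = i ∧ q < m) →
      t.arr 0 (2 + p * 4 + q) = if p + 1 = q ∨ q + 1 = p then 1 else 0)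
    (fun i t v h => by simpa using h) (fun p q hq hh => hu p (by omega) q hq) ?_
  · rw [u29] at key2
    exact fun p hp q hq => key2 p q hq (by omega)
  intro j w hj hF' hj' hw p q hq hh
  have w27 : w.reg 27 = i := (hF'.reg 27 (by decide)).trans hi'
  rw [u29] at hj
  simp only [run, Expr.eval, State.setArr_arr, if_true, Function.update_apply, w27, hj', Expr.eq]
  by_cases hpq : p = i ∧ q = j
  · obtain ⟨rfl, rfl⟩ := hpq
    rw [if_pos (by ring)]
    split_ifs <;> omega
  · rw [if_neg (by omega)]
    exact hw p q hq (by omega)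

theorem run_tableProg {n : ℕ} {s : State} (h1 : s.reg 1 = n) (h29 : s.reg 29 = 2) :
    let t := tableProg.run s
    (∀ i < n, t.arr 1 i = 2 + i * n) ∧ ∀ i < n + n, t.arr 2 i = slotVertex n i := by
  intro t
  have key := run_forr (x := 7) (r := 1) (s := s)
    (p := block [sto 1 (.var 7) (.var 29), asg 29 (.add (.var 29) (.var 1))])
    (fun m t => t.reg 29 = 2 + m * n ∧ ∀ i < m, t.arr 1 i = 2 + i * n)
    (fun i t v h => by simpa using h) (by simpa using h29) ?_
  swap
  · rintro i u hi hF hi' ⟨k1, k2⟩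
    have u1 : u.reg 1 = n := (hF.reg 1 (by decide)).trans h1
    simp only [block, run, Expr.eval, State.setReg_reg, State.setArr_reg, State.setReg_arr,
      State.setArr_arr, if_true, k1, u1, hi']
    refine ⟨by rw [Nat.succ_mul]; ring, fun j hj => ?_⟩
    rw [Function.update_apply]
    split_ifs with e
    · rw [e]
    · exact k2 j (by omega)
  set s1 := (forr 7 1 (block [sto 1 (.var 7) (.var 29),
    asg 29 (.add (.var 29) (.var 1))])).run s with hs1
  have r1 : s1.reg 1 = n := by rw [hs1, run_reg _ _ _ (by decide), h1]
  have key2 := run_forr (x := 7) (r := 1) (s := s1)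
    (p := block [sto 2 (.var 7) (.var 7), sto 2 (.add (.var 1) (.var 7)) (.var 7)])
    (fun m t => ∀ i < m, t.arr 2 i = i ∧ t.arr 2 (n + i) = i)
    (fun i t v h => by simpa using h) (by simp) ?_
  · have e1 : t.arr 1 = s1.arr 1 := (run_arr (forr 7 1 (block [sto 2 (.var 7) (.var 7),
      sto 2 (.add (.var 1) (.var 7)) (.var 7)])) s1 1 (by decide))
    rw [h1] at key
    rw [r1] at key2
    rw [e1]
    refine ⟨key.2, fun i hi => ?_⟩
    unfold slotVertex
    split_ifs with hin
    · exact (key2 i hin).1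
    · have := (key2 (i - n) (by omega)).2
      rw [show n + (i - n) = i by omega] at this
      exact this
  intro i u hi hF hi' hu
  have u1 : u.reg 1 = n := (hF.reg 1 (by decide)).trans r1
  rw [r1] at hi
  simp only [block, run, Expr.eval, State.setArr_reg, State.setArr_arr, if_true, u1, hi',
    Function.update_apply]
  intro j hj
  rcases Nat.lt_succ_iff_lt_or_eq.1 hj with h' | rfl
  · have := hu j h'
    rw [if_neg (by omega), if_neg (by omega), if_neg (by omega), if_neg (by omega)]
    exact this
  · simp

theorem wf_reduceProg : reduceProg.wf = true := by decide +kernel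
-- This is what `exec_compile` asks for. It is the reason for treating reading, reducing and writing
-- separately: registers `1`, `3`, `4` are set before this part, and register `26`, set here, bounds
-- loops only afterwards.
theorem bounds_reduceProg : ∀ r ∈ reduceProg.bounds, (r = 1 ∨ r = 3 ∨ r = 4) ∧ r ∉ reduceProg.wr := by
  decide +kernel

/-- The subgraph of `H` spanned by the vertices `e 0, …, e (m - 1)`, with parameter `k`. -/
def spanInst (H : SimpleGraph ℕ) (e : ℕ → ℕ) (m k : ℕ) : Inst :=
  ⟨m, H.comap fun p : Fin m => e p, k⟩

theorem output_writeProg {n : ℕ} {H : SimpleGraph ℕ} {s : State} (h : Mat n H s)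
    (hv : ∀ p < s.reg 26, s.arr 7 p < n) :
    output (writeProg.run s) = (spanInst H (s.arr 7) (s.reg 26) (s.reg 2 - 1)).encode := by
  classical
  set m := s.reg 26 with hm
  set e := s.arr 7 with he
  set s1 := (asg 29 (.lit 2)).run s with hs1
  have M1 : Mat n H s1 := ⟨by simp [hs1, run, h.reg1], h.row, h.adj, h.lt⟩
  have m1 : s1.reg 26 = m := by simp [hs1, run, hm]
  have e1 : s1.arr 7 = e := rfl
  have k1 : s1.reg 2 = s.reg 2 := by simp [hs1, run]
  have key := run_forr (x := 27) (r := 26) (s := s1) (p := forr 28 26 (block [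
    sto 0 (.var 29) (coreE (.get 7 (.var 27)) (.get 7 (.var 28))),
    asg 29 (.add (.var 29) (.lit 1))]))
    (fun i t => t.reg 29 = 2 + i * m ∧ ∀ p < i, ∀ q < m,
      t.arr 0 (2 + p * m + q) = if H.Adj (e p) (e q) then 1 else 0)
    (fun i t v h => by simpa using h) (by simp [hs1, run]) ?_
  · set s2 := (forr 27 26 (forr 28 26 (block [
      sto 0 (.var 29) (coreE (.get 7 (.var 27)) (.get 7 (.var 28))),
      asg 29 (.add (.var 29) (.lit 1))]))).run s1 with hs2
    have F2 : Frame _ _ s1 s2 := frame _ _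
    have m2 : s2.reg 26 = m := (F2.reg 26 (by decide)).trans m1
    have k2 : s2.reg 2 = s.reg 2 := (F2.reg 2 (by decide)).trans k1
    have hrun : writeProg.run s = (block [sto 0 (.lit 0) (.var 26),
      sto 0 (.lit 1) (.sub (.var 2) (.lit 1)), asg 0 (.var 29)]).run s2 := rfl
    rw [m1] at key
    obtain ⟨key1, key2⟩ := key
    rw [hrun]
    refine output_eq_encode _ _ (by simp [block, run, key1, spanInst])
      (by simp [block, run, m2, spanInst]) (by simp [block, run, k2, spanInst]) fun p q => ?_
    have := key2 p p.2 q q.2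
    have h0 : 2 + (p : ℕ) * m + q ≠ 0 := by omega
    have h1 : 2 + (p : ℕ) * m + q ≠ 1 := by omega
    have hadj : (spanInst H e m (s.reg 2 - 1)).graph.Adj p q ↔ H.Adj (e p) (e q) := Iff.rfl
    simp only [hadj]
    rw [← this]
    simp only [block, run, Expr.eval, State.setReg_arr, State.setArr_arr, if_true,
      Function.update_apply]
    change (if 2 + (p : ℕ) * m + q = 1 then _ else if 2 + (p : ℕ) * m + q = 0 then _ else _) = _
    rw [if_neg h1, if_neg h0]
    rfl
  rintro i u hi hF hi' ⟨hu1, hu2⟩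
  rw [m1] at hi
  have um : u.reg 26 = m := (hF.reg 26 (by decide)).trans m1
  have ue : u.arr 7 = e := (hF.arr 7 (by decide)).trans e1
  have Mu : Mat n H u := M1.frame hF (by decide) (by decide) (by decide)
  have key2 := run_forr (x := 28) (r := 26) (s := u) (p := block [
    sto 0 (.var 29) (coreE (.get 7 (.var 27)) (.get 7 (.var 28))),
    asg 29 (.add (.var 29) (.lit 1))])
    (fun j t => t.reg 29 = 2 + i * m + j ∧ ∀ p, ∀ q < m, (p < i ∨ p = i ∧ q < j) →
      t.arr 0 (2 + p * m + q) = if H.Adj (e p) (e q) then 1 else 0)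
    (fun i t v h => by simpa using h) ⟨hu1, fun p q hq hh => hu2 p (by omega) q hq⟩ ?_
  · rw [um] at key2
    exact ⟨by rw [key2.1, Nat.succ_mul]; ring, fun p hp q hq => key2.2 p q hq (by omega)⟩
  rintro j w hj hF' hj' ⟨hw1, hw2⟩
  rw [um] at hj
  have w27 : w.reg 27 = i := (hF'.reg 27 (by decide)).trans hi'
  have we : w.arr 7 = e := (hF'.arr 7 (by decide)).trans ue
  have Mw : Mat n H w := Mu.frame hF' (by decide) (by decide) (by decide)
  have hval : (coreE (.get 7 (.var 27)) (.get 7 (.var 28))).eval w =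
      if H.Adj (e i) (e j) then 1 else 0 := by
    simp only [coreE, Expr.eval, we, w27, hj', Mw.row _ (hv i hi)]
    have := Mw.adj _ (hv i hi) _ (hv j hj)
    split_ifs with hA
    · exact this.1 hA
    · exact this.2 hA
  simp only [block, run, State.setReg_reg, State.setArr_reg, State.setReg_arr, State.setArr_arr,
    if_true, hval]
  simp only [Expr.eval, State.setArr_reg, hw1]
  refine ⟨by omega, fun p q hq hh => ?_⟩
  simp only [Function.update_apply, index_inj hq hj]
  by_cases hpq : p = i ∧ q = j
  · rw [if_pos hpq, hpq.1, hpq.2]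
  · rw [if_neg hpq]
    exact hw2 p q hq (by omega)

/-- Rejection is sound because a budget `K = 0` admits no cover and because a yes-instance obeys the
edge limit by `ncard_core_le`. Passing the test gives both `K ≥ 1`, so that `K - 1` is a genuine
parameter, and the edge bound. -/
theorem run_reduceProg (I : Inst) :
    let t := reduceProg.run (readProg.run (input I.encode))
    ∃ H, Mat I.n H t ∧ (I.IsYes 4 ↔ HasCov H (t.reg 2)) ∧ t.reg 2 ≤ I.k + 1 ∧
      (rejectE.Holds t → ¬ I.IsYes 4) ∧
      (¬ rejectE.Holds t → 1 ≤ t.reg 2 ∧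
        H.edgeSet.ncard ≤ 64 * ((t.reg 2 - 1) * (t.reg 2 - 1) + (t.reg 2 - 1))) ∧
      t.reg 26 ≤ I.n ∧ (∀ p < t.reg 26, t.arr 7 p < I.n ∧ ∃ b, H.Adj (t.arr 7 p) b) ∧
      (∀ p < t.reg 26, ∀ q < t.reg 26, t.arr 7 p = t.arr 7 q → p = q) ∧
      ∀ a b, H.Adj a b → ∃ p < t.reg 26, t.arr 7 p = a := by
  classical
  intro t
  set n := I.n with hn
  set s := readProg.run (input I.encode) with hs
  have r1 : s.reg 1 = n := by simp [hs, readProg, run, block, input, Inst.encode, hn]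
  have r2 : s.reg 2 = I.k + 1 := by simp [hs, readProg, run, block, input, Inst.encode]
  have r3 : s.reg 3 = n + n := by simp [hs, readProg, run, block, input, Inst.encode, hn]
  have r4 : s.reg 4 = n + n + 1 := by simp [hs, readProg, run, block, input, Inst.encode, hn]
  have r29 : s.reg 29 = 2 := by simp [hs, readProg, run, block]
  have a0 : s.arr 0 = fun i => I.encode.getD i 0 := by
    funext i; simp [hs, readProg, run, block, input]
  set s0 := tableProg.run s with hs0
  have F0 : Frame tableProg.wr tableProg.wrA s s0 := frame _ _
  obtain ⟨t1, t2⟩ := run_tableProg r1 r29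
  have R0 : Rep n (natGraph I) s0 := by
    refine ⟨(F0.reg 1 (by decide)).trans r1, (F0.reg 3 (by decide)).trans r3,
      (F0.reg 4 (by decide)).trans r4, t1, t2, fun i hi j hj => ?_, fun a _ ⟨ha, _⟩ => ha⟩
    rw [F0.arr 0 (by decide), a0]
    have := encode_getD I ⟨i, hi⟩ ⟨j, hj⟩
    simp only at this ⊢
    rw [this]
    have e : (natGraph I).Adj i j ↔ I.graph.Adj ⟨i, hi⟩ ⟨j, hj⟩ :=
      ⟨fun ⟨_, _, h⟩ => h, fun h => ⟨hi, hj, h⟩⟩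
    rw [e]
    split_ifs with h <;> simp [h]
  have k0 : s0.reg 2 = I.k + 1 := (F0.reg 2 (by decide)).trans r2
  obtain ⟨G, R1, eq1, le1, irr⟩ := run_roundsProg R0
  set s1 := roundsProg.run s0 with hs1
  rw [k0, ← isYes_iff_natGraph] at eq1
  rw [k0] at le1
  set s2 := coreProg.run s1 with hs2
  have F2 : Frame coreProg.wr coreProg.wrA s1 s2 := frame _ _
  set s3 := edgeProg.run s2 with hs3
  have F3 : Frame edgeProg.wr edgeProg.wrA s2 s3 := frame _ _
  set s4 := limitProg.run s3 with hs4
  have F4 : Frame limitProg.wr limitProg.wrA s3 s4 := frame _ _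
  have F5 : Frame vertexProg.wr vertexProg.wrA s4 t := frame vertexProg s4
  have M2 : Mat n (core G) s2 := by
    refine ⟨(F2.reg 1 (by decide)).trans R1.reg1, ?_, fun i hi j hj => ?_,
      fun a b h => R1.lt a b (InP4.adj h)⟩
    · rw [F2.arr 1 (by decide)]; exact R1.row
    · have := run_coreProg R1 i hi j hj
      rw [← hs2] at this
      rw [this]
      exact ⟨fun h => if_pos h, fun h => if_neg h⟩
  have M3 : Mat n (core G) s3 := M2.frame F3 (by decide) (by decide) (by decide)
  have M4 : Mat n (core G) s4 := M3.frame F4 (by decide) (by decide) (by decide)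
  have M5 : Mat n (core G) t := M4.frame F5 (by decide) (by decide) (by decide)
  have K3 : s3.reg 2 = s1.reg 2 := (F3.reg 2 (by decide)).trans (F2.reg 2 (by decide))
  have K5 : t.reg 2 = s1.reg 2 :=
    (F5.reg 2 (by decide)).trans ((F4.reg 2 (by decide)).trans K3)
  have E5 : t.reg 24 = (core G).edgeSet.ncard := by
    rw [F5.reg 24 (by decide), F4.reg 24 (by decide), hs3, run_edgeProg M2]
  have L5 : t.reg 25 = 64 * (min n (t.reg 2 - 1) * (t.reg 2 - 1) + (t.reg 2 - 1)) := by
    rw [F5.reg 25 (by decide), hs4, run_limitProg, M3.reg1, K3, K5]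
  have hrej : rejectE.Holds t ↔ t.reg 2 = 0 ∨ t.reg 25 < t.reg 24 := by
    rw [rejectE, Expr.holds_or, Expr.holds_not, Expr.holds_lt, Expr.holds_var, not_not]
    rfl
  have hyes : I.IsYes 4 ↔ HasCov (core G) (t.reg 2) := by rw [hasCov_core, K5, eq1]
  refine ⟨core G, M5, hyes, by rw [K5]; exact le1, ?_, ?_, run_vertexProg M4⟩
  · rw [hrej, eq1]
    rintro (h | h) hcov
    · obtain ⟨S, hS, -⟩ := hcov
      omega
    · have := ncard_core_le R1.lt irr hcov
      rw [← K5] at this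
      omega
  · rw [hrej]
    intro h
    push Not at h
    refine ⟨by omega, ?_⟩
    have := Nat.mul_le_mul_right (t.reg 2 - 1) (min_le_right n (t.reg 2 - 1))
    omega

/-! ### The complete program, its running time and the size of its output -/

/-- The whole kernelization program. -/
def kernelProg : Prog :=
  .seq readProg.compile (.seq reduceProg.compile (ite rejectE rejectProg writeProg).compile)

/-- A bound for its running time. -/
noncomputable def kernelTime : Polynomial ℕ :=
  (readProg.time + reduceProg.time + (ite rejectE rejectProg writeProg).time).comp
    (2 * .X + 5) + (.X * .X + 18)

/-- Each listed vertex is an end of an edge, and an edge has two ends; this turns the edge bound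
into a bound for the number of vertices. -/
theorem card_le_two_mul_ncard {H : SimpleGraph ℕ} {e : ℕ → ℕ} {m : ℕ} (hfin : H.edgeSet.Finite)
    (hne : ∀ p < m, ∃ b, H.Adj (e p) b) (hinj : ∀ p < m, ∀ q < m, e p = e q → p = q) :
    m ≤ 2 * H.edgeSet.ncard := by
  have h1 : (Finset.range m).image e ⊆ hfin.toFinset.biUnion Sym2.toFinset := by
    intro a ha
    obtain ⟨p, hp, rfl⟩ := Finset.mem_image.1 ha
    obtain ⟨b, hb⟩ := hne p (Finset.mem_range.1 hp)
    exact Finset.mem_biUnion.2 ⟨s(e p, b), (Set.Finite.mem_toFinset hfin).2 hb, by simp⟩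
  have h2 := Finset.card_le_card h1
  rw [Finset.card_image_of_injOn fun p hp q hq h => hinj p (by simpa using hp) q (by simpa using hq) h,
    Finset.card_range] at h2
  have h3 : (hfin.toFinset.biUnion Sym2.toFinset).card ≤ hfin.toFinset.card * 2 :=
    Finset.card_biUnion_le_card_mul _ _ _ fun z _ => by
      rw [Sym2.card_toFinset]; split_ifs <;> omega
  rw [Set.ncard_eq_toFinset_card _ hfin]
  omega

theorem length_le_wordLength (w : List ℕ) : w.length ≤ wordLength w := by
  induction w with
  | nil => simp
  | cons a l ih => simp only [wordLength, List.map_cons, List.sum_cons, List.length_cons] at *; omega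

/-- The vertex bound is twice the edge bound, plus `4` to allow for the fixed rejected instance.
That instance is also why the edge bound has a separate alternative for no-instances. -/
theorem exists_kernel (I : Inst) : ∃ (t : ℕ) (s : State) (J : Inst),
    Exec kernelProg (input I.encode) t s ∧ output s = J.encode ∧
    t + (output s).length ≤ kernelTime.eval (wordLength I.encode) ∧
    (J.IsYes 4 ↔ I.IsYes 4) ∧ J.k ≤ I.k ∧ J.n ≤ 128 * (I.k * I.k + I.k) + 4 ∧
    ((¬ I.IsYes 4 ∧ J.numEdges ≤ 3) ∨ J.numEdges ≤ 64 * (I.k * I.k + I.k)) := by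
  set l := wordLength I.encode with hl
  have hnl : 2 + I.n * I.n ≤ l := by rw [← length_encode]; exact length_le_wordLength _
  have hnn : I.n ≤ I.n * I.n := Nat.le_mul_self _
  -- Large enough for every loop bound: `n`, `2n`, `2n + 1`, the number of output vertices, and the
  -- constant `4` used on rejection.
  set b := 2 * l + 5 with hb
  set s1 := readProg.run (input I.encode) with hs1
  set s2 := reduceProg.run s1 with hs2
  set s3 := (ite rejectE rejectProg writeProg).run s2 with hs3
  obtain ⟨t1, ht1, ex1⟩ := exec_compile readProg (input I.encode) b (by decide)
    fun r hr => absurd (show r ∈ [] from hr) List.not_mem_nil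
  have r1 : s1.reg 1 = I.n := by simp [hs1, readProg, run, block, input, Inst.encode]
  have r3 : s1.reg 3 = I.n + I.n := by simp [hs1, readProg, run, block, input, Inst.encode]
  have r4 : s1.reg 4 = I.n + I.n + 1 := by simp [hs1, readProg, run, block, input, Inst.encode]
  obtain ⟨t2, ht2, ex2⟩ := exec_compile reduceProg s1 b wf_reduceProg fun r hr => by
    obtain ⟨h1, h2⟩ := bounds_reduceProg r hr
    refine ⟨?_, h2⟩
    rcases h1 with rfl | rfl | rfl <;> omega
  obtain ⟨H, M, hyes, hk, hrej, hacc, hm, hv, hinj, hsurj⟩ := run_reduceProg I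
  rw [← hs1, ← hs2] at M hyes hk hrej hacc hm hv hinj hsurj
  have hfin := edgeSet_finite M.lt
  have hex3 : ∃ t3 ≤ (ite rejectE rejectProg writeProg).time.eval b,
      Exec (ite rejectE rejectProg writeProg).compile s2 t3 s3 := by
    by_cases hc : rejectE.Holds s2
    · have hx : ∃ t ≤ rejectProg.time.eval b, Exec rejectProg.compile s2 t (rejectProg.run s2) := by
        -- The first assignment is split off because it writes register `29`, which bounds the loops
        -- that follow.
        obtain ⟨t, ht, ex⟩ := exec_compile (block [forr 27 29 (forr 28 29 (sto 0
          (.add (.lit 2) (.add (.add (.add (.var 27) (.var 27)) (.add (.var 27) (.var 27)))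
            (.var 28)))
          (.add (.eq (.add (.var 27) (.lit 1)) (.var 28))
            (.eq (.add (.var 28) (.lit 1)) (.var 27))))),
          sto 0 (.lit 0) (.lit 4), sto 0 (.lit 1) (.lit 0), asg 0 (.lit 18)])
          ((asg 29 (.lit 4)).run s2) b (by decide) (by
            intro r hr
            have hr' : r = 29 := by
              revert r; decide
            subst hr'
            exact ⟨by simp [run, hb], by decide⟩)
        refine ⟨_, ?_, .seq (.assign 29 (.lit 4) s2) ex⟩
        simp only [rejectProg, block, time, Polynomial.eval_add, Polynomial.eval_C,
          Expr.cost] at ht ⊢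
        omega
      obtain ⟨t, ht, ex⟩ := hx
      refine ⟨_, ?_, by
        rw [hs3, run, if_pos hc]
        exact Exec.ite_true hc ex⟩
      simp only [time, Polynomial.eval_add, Polynomial.eval_C]
      omega
    · obtain ⟨t, ht, ex⟩ := exec_compile writeProg s2 b (by decide) (by
        intro r hr
        have hr' : r = 26 := by
          revert r; decide
        subst hr'
        exact ⟨by omega, by decide⟩)
      refine ⟨_, ?_, by
        rw [hs3, run, if_neg hc]
        exact Exec.ite_false (not_not.1 hc) ex⟩
      simp only [time, Polynomial.eval_add, Polynomial.eval_C]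
      omega
  obtain ⟨t3, ht3, ex3⟩ := hex3
  have hex : Exec kernelProg (input I.encode) (t1 + (t2 + t3)) s3 := .seq ex1 (.seq ex2 ex3)
  -- The summand `X * X + 18` of `kernelTime` pays for the output, whose length is at most `2 + l² +
  -- 16`.
  have htime : ∀ J : Inst, output s3 = J.encode → J.n ≤ I.n ∨ J.n ≤ 4 →
      t1 + (t2 + t3) + (output s3).length ≤ kernelTime.eval l := by
    intro J hJ hJn
    have hlen : J.n * J.n ≤ l * l + 16 := by
      rcases hJn with h | h
      · exact (Nat.mul_le_mul (h.trans (show I.n ≤ l by omega)) (h.trans (show I.n ≤ l by omega))).trans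
          (by omega)
      · exact (Nat.mul_le_mul h h).trans (by omega)
    rw [hJ, length_encode]
    simp only [kernelTime, Polynomial.eval_add, Polynomial.eval_comp, Polynomial.eval_mul,
      Polynomial.eval_X, Polynomial.eval_ofNat]
    rw [← hb]
    omega
  by_cases hc : rejectE.Holds s2
  · have hout : output s3 = noInst.encode := by
      rw [hs3, run, if_pos hc, output_rejectProg]
    refine ⟨_, s3, noInst, hex, hout, htime noInst hout (.inr le_rfl), ?_, Nat.zero_le _,
      by simp [noInst], .inl ⟨hrej hc, numEdges_noInst⟩⟩
    exact ⟨fun h => absurd h not_isYes_noInst, fun h => absurd h (hrej hc)⟩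
  · obtain ⟨a1, a2⟩ := hacc hc
    set J := spanInst H (s2.arr 7) (s2.reg 26) (s2.reg 2 - 1) with hJ
    have hout : output s3 = J.encode := by
      rw [hs3, run, if_neg hc]
      exact output_writeProg M fun p hp => (hv p hp).1
    have hkk : s2.reg 2 - 1 ≤ I.k := by omega
    have hE : H.edgeSet.ncard ≤ 64 * (I.k * I.k + I.k) :=
      a2.trans (Nat.mul_le_mul_left _ (Nat.add_le_add (Nat.mul_le_mul hkk hkk) hkk))
    have hJn : J.n = s2.reg 26 := rfl
    have hJk : J.k = s2.reg 2 - 1 := rfl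
    clear_value s3 s2 s1
    have hei : Function.Injective fun p : Fin J.n => s2.arr 7 p := fun p q h =>
      Fin.ext (hinj p p.2 q q.2 h)
    refine ⟨_, s3, J, hex, hout, htime J hout (.inl (by rw [hJn]; exact hm)), ?_,
      by rw [hJk]; exact hkk, ?_, .inr ?_⟩
    · rw [hyes, isYes_iff J H (fun p => s2.arr 7 p) hei (fun p q => Iff.rfl) fun a b hab => by
        obtain ⟨p, hp, e⟩ := hsurj a b hab
        exact ⟨⟨p, hp⟩, e⟩]
      rw [hJk, Nat.sub_add_cancel a1]
    · have := card_le_two_mul_ncard hfin (fun p hp => (hv p hp).2) hinj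
      rw [hJn]
      omega
    · exact (numEdges_le J H _ hei (fun p q => Iff.rfl) hfin).trans hE

/-- Bounding the binary length of a number by the number itself is crude, but the size bound only
has to be a computable function of `k`. -/
theorem wordLength_encode_le (I : Inst) :
    wordLength I.encode ≤ (I.n + 1) + (I.k + 1) + 2 * (I.n * I.n) := by
  classical
  have hsize : ∀ a : ℕ, a.size ≤ a := fun a => Nat.size_le.2 Nat.lt_two_pow_self
  have h : ∀ l : List ℕ, (∀ a ∈ l, a ≤ 1) → (l.map fun a => Nat.size a + 1).sum ≤ 2 * l.length := by
    intro l hl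
    have := List.sum_le_card_nsmul (l.map fun a => Nat.size a + 1) 2 (by
      intro x hx
      obtain ⟨a, ha, rfl⟩ := List.mem_map.1 hx
      have := hl a ha
      have := hsize a
      omega)
    simpa [Nat.mul_comm] using this
  have h1 := hsize I.n
  have h2 := hsize I.k
  have h3 := h (List.ofFn fun p : Fin (I.n * I.n) => if I.graph.Adj p.divNat p.modNat then 1 else 0)
    (by
      intro a ha
      obtain ⟨i, rfl⟩ := (List.mem_ofFn' _ _).1 ha
      simp only
      split_ifs <;> omega)
  rw [List.length_ofFn] at h3
  simp only [wordLength, Inst.encode, List.map_cons, List.sum_cons]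
  omega

theorem computable_sizeBound : Computable fun k : ℕ =>
    let m := 128 * (k * k + k) + 4
    (m + 1) + (k + 1) + 2 * (m * m) + k := by
  have hk : Primrec fun k : ℕ => k := Primrec.id
  have hm : Primrec fun k : ℕ => 128 * (k * k + k) + 4 :=
    Primrec.nat_add.comp (Primrec.nat_mul.comp (Primrec.const 128)
      (Primrec.nat_add.comp (Primrec.nat_mul.comp hk hk) hk)) (Primrec.const 4)
  exact (Primrec.nat_add.comp (Primrec.nat_add.comp (Primrec.nat_add.comp
    (Primrec.nat_add.comp hm (Primrec.const 1)) (Primrec.nat_add.comp hk (Primrec.const 1)))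
    (Primrec.nat_mul.comp (Primrec.const 2) (Primrec.nat_mul.comp hm hm))) hk).to_comp

end FourPath

theorem mainTheorem1 :
    ∃ f : PathVertexCover.Inst → PathVertexCover.Inst,
      PathVertexCover.IsKernelization (PathVertexCover.Inst.IsYes 4) f ∧
      (∀ I : PathVertexCover.Inst, (1 ≤ I.k ∨ I.IsYes 4) →
        (f I).numEdges ≤ 96 * I.k ^ 2 + 96 * I.k) ∧
      (∀ I : PathVertexCover.Inst, I.k = 0 → (f I).numEdges ≤ 3) := by
  -- The map `f` is picked by choice, but its code is the output of the one program `kernelProg` on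
  -- every instance.
  choose t s f hexec hout htime hyes hk hn hE using FourPath.exists_kernel
  refine ⟨f, ⟨⟨FourPath.kernelProg, FourPath.kernelTime, fun I =>
    ⟨t I, s I, hexec I, hout I, htime I⟩⟩, hyes, ⟨_, FourPath.computable_sizeBound, fun I => ?_⟩⟩,
    fun I hI => ?_, fun I hI => ?_⟩
  · have h1 := FourPath.wordLength_encode_le (f I)
    have h2 := Nat.mul_le_mul (hn I) (hn I)
    have h3 := hn I
    have h4 := hk I
    dsimp only
    omega
  -- A rejected instance with `k ≥ 1` yields at most `3 ≤ 96 + 96` edges; otherwise the bound proved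
  -- is `64(k² + k)`.
  · rcases hE I with ⟨h1, h2⟩ | h
    · have : 1 ≤ I.k := hI.resolve_right h1
      nlinarith
    · nlinarith
  -- For `k = 0` an instance that is not rejected is left without edges.
  · rcases hE I with ⟨-, h⟩ | h
    · exact h
    · simp only [hI] at h
      omega
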